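/- Setting. Let $\Gamma$ be a finite graph whose edges are divided into the edges of a train track part $\widehat\Gamma$ and the remaining ones. Let $\mathcal G^1$ be obtained from $\Gamma$ by adding finitely many auxiliary edges, each with both endpoints at vertices of $\Gamma$ and a midpoint, the auxiliary vertex; several auxiliary edges may share their auxiliary vertex, in which case any two of the auxiliary half-edges meeting there form an auxiliary edge. The relative part $X$ consists of all vertices, all edges of $\Gamma\smallsetminus\widehat\Gamma$ and all auxiliary edges. Let $\mathcal G^2$ be obtained from $\mathcal G^1$ by gluing, for every auxiliary edge $e$, a 2-cell along $\bar e\circ\eta_e$, for an edge path $\eta_e$ in $\mathcal G^1$ with the same endpoints as $e$. Let $f:\mathcal G^2\to\mathcal G^2$ be a continuous map with $f(X)\subset X$ which maps vertices of $\Gamma$ to vertices of $\Gamma$, auxiliary vertices to vertices, and edges of $\mathcal G^1$ to edge paths. Paths are edge paths in $\mathcal G^1$ between vertices of $\Gamma$; subpaths in $X$ are taken to be reduced. Let $\widehat r$ replace every auxiliary edge $e$ of a path by $\eta_e$, and let $r=\widehat r^{\,m}$ be a power of $\widehat r$ which maps every auxiliary edge to a reduced path in $\Gamma$. A path is relatively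 reduced if each of its subpaths which is homotopic in $\mathcal G^2$ rel. endpoints into $X$ is contained in $X$. A path $\gamma$ is legal if $f^t(\gamma)$ is relatively reduced for all $t\ge 1$. An INP is a reduced path $\eta=\eta'\circ\eta''$ that begins and ends with an edge of $\widehat\Gamma$, with $\eta',\eta''$ legal, no $f^t(\eta)$, $t\ge0$, legal, and $f^{t_0}(\eta)$ homotopic to $\eta$ in $\mathcal G^1$ rel. endpoints for some $t_0\ge1$; its tip is its unique turn that is not legal. Here a turn is a path $e\circ\chi\circ e'$ with $e,e'$ edges of $\widehat\Gamma$ and $\chi$ a path in $X$. A path is strongly legal if it is reduced and legal and if, after replacing all its auxiliary edges $e_i$ by $\eta_{e_i}$, the only turns that are not legal are the tips of the $\eta_{e_i}$. A turn $e\circ\chi\circ e'$ is illegal if it is not legal or if (for $\chi$ non-trivial) $e\circ\chi$ or $\chi\circ e'$ is not strongly legal. The map $f$ is a $\beta$-train track map representing $\alpha\in\mathrm{Aut}(F_n)$ if: (0) the INPs are precisely the paths $\eta_e$ (for the auxiliary edges $e$ in both orientations); an isomorphism $\pi_1\mathcal G^2\cong F_n$ conjugates $f_*$ to the outer automorphism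 given by $\alpha$; and every loop has an iterate freely homotopic in $\mathcal G^2$ to a legal loop; (a) the components of $X$ are $\pi_1$-injective in $\mathcal G^2$, and loops in $X$ represent conjugacy classes of polynomial $\alpha$-growth; (b) $r$ induces a homotopy equivalence $\mathcal G^2\to\Gamma$, and $r\circ f|_\Gamma$ is a relative train track map in the sense of Bestvina and Handel; (c) every edge of $\widehat\Gamma$ is strongly legal; (d) $f$ maps strongly legal paths to strongly legal paths; (e) every edge of $\widehat\Gamma$ has an iterate that runs over at least two edges of $\widehat\Gamma$; (f) strongly legal paths lift to quasi-geodesics in the universal covering of $\mathcal G^2$ (every edge having length 1), with uniform constants; (g) the same holds for reduced paths in $\Gamma$, for paths with reduced image under $r$, and for paths derived from strongly legal ones by applying $r$ to any collection of subpaths; (h) for every path $\gamma$ some $f^{t}(\gamma)$ is homotopic in $\mathcal G^2$ rel. endpoints to a strongly legal path, where $t$ depends only on the number of illegal turns of $\gamma$. A pre-INP is a path $r(e)$ for an auxiliary edge $e$. In a reduced path of $\Gamma$ it is isolated if every other pre-INP occurring in this path which meets it in more than a point is contained in it. A path $\gamma$ is normalized if $r(\gamma)$ is reduced and $\gamma$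 is obtained from $r(\gamma)$ by replacing every isolated pre-INP $r(e)$ by $e$. The normalized path homotopic in $\mathcal G^2$ to $\gamma$ rel. endpoints is denoted $\gamma_*$. The relative length $|\gamma|_{rel}$ is the number of edges of $\widehat\Gamma$ that $\gamma$ crosses. Statement. Let $f:\mathcal G^2\to\mathcal G^2$ be a $\beta$-train track map representing an automorphism of $F_n$. For every real $\lambda>1$ there is an integer $N\ge1$ such that for every normalized edge path $\gamma$ one has: (a) either the normalized path $f^N(\gamma)_*$ satisfies $|f^N(\gamma)_*|_{rel}\ge\lambda|\gamma|_{rel}$, (b) or else every normalized edge path $\gamma'$ with $f^N(\gamma')_*=\gamma$ satisfies $|\gamma'|_{rel}\ge\lambda|\gamma|_{rel}$. -/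

import Mathlib

namespace BetaTrainTrack

open FreeGroup (IsReduced invRev)

/-- The edges of the 1-skeleton `G¹`: the edges `T` of the train track part, the edges `R` of
`Γ` which belong to the relative part, and the auxiliary half-edges `H`. -/
inductive Edge (T R H : Type*)
  | train (e : T)
  | low (e : R)
  | half (h : H)

/-- Oriented edges; `(e, true)` is `e` with its own orientation, `(e, false)` is `e` reversed. -/
abbrev Letter (T R H : Type*) := Edge T R H × Bool

/-- Sequences of oriented edges. The reversed sequence is `FreeGroup.invRev p`. -/
abbrev Word (T R H : Type*) := List (Letter T R H)

variable {V T R S H : Type*}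

/-- The oriented edge belongs to the train track part. -/
def IsTrain (x : Letter T R H) : Prop := ∃ e, x.1 = Edge.train e

/-- The word runs inside the relative part `X`. -/
def InX (p : Word T R H) : Prop := ∀ x ∈ p, ¬ IsTrain x

/-- The word runs inside `Γ`, i.e. it crosses no auxiliary half-edge. -/
def InΓ (p : Word T R H) : Prop := ∀ x ∈ p, ∀ h, x.1 ≠ Edge.half h

/-- The reverse of an oriented edge. -/
def rev (x : Letter T R H) : Letter T R H := (x.1, !x.2)

/-- Subpaths inside `X` are reduced paths of the graph `X`. -/
def XTight (p : Word T R H) : Prop :=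
  ∀ (a : Word T R H) (x : Letter T R H) (b : Word T R H), p = a ++ x :: rev x :: b → IsTrain x

/-- Reduction of a path in the graph `G¹`: cancel all backtracking. -/
noncomputable def tighten (p : Word T R H) : Word T R H :=
  @FreeGroup.reduce _ (Classical.decEq _) p

open Classical in
/-- Relative length: edges of the train track part have length `1`, edges of `X` length `0`. -/
noncomputable def relLength (p : Word T R H) : ℕ := p.countP (fun x => decide (IsTrain x))

/-- The graph `G¹`. Its vertices are the vertices `V` of `Γ` and the auxiliary vertices `S`. An
auxiliary half-edge `h` joins the auxiliary vertex `star h` to the vertex `foot h` of `Γ`. -/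
structure Graph1 (V T R S H : Type*) where
  trainEnds : T → V × V
  lowEnds : R → V × V
  star : H → S
  foot : H → V

namespace Graph1

variable (G : Graph1 V T R S H)

def src : Edge T R H → V ⊕ S
  | Edge.train e => Sum.inl (G.trainEnds e).1
  | Edge.low e => Sum.inl (G.lowEnds e).1
  | Edge.half h => Sum.inr (G.star h)

def tgt : Edge T R H → V ⊕ S
  | Edge.train e => Sum.inl (G.trainEnds e).2
  | Edge.low e => Sum.inl (G.lowEnds e).2
  | Edge.half h => Sum.inl (G.foot h)

def init (x : Letter T R H) : V ⊕ S := if x.2 then G.src x.1 else G.tgt x.1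

def term (x : Letter T R H) : V ⊕ S := if x.2 then G.tgt x.1 else G.src x.1

/-- `p` is an edge path from `u` to `v`. -/
def IsPath : V ⊕ S → Word T R H → V ⊕ S → Prop
  | u, [], v => u = v
  | u, x :: p, v => G.init x = u ∧ IsPath (G.term x) p v

/-- The half-edges `h`, `h'` are the two halves of an auxiliary edge. -/
def IsAux (h h' : H) : Prop := h ≠ h' ∧ G.star h = G.star h'

end Graph1

/-- The auxiliary edge from `foot h` to `foot h'`. -/
def auxWord (h h' : H) : Word T R H := [(Edge.half h, false), (Edge.half h', true)]

/-- The 2-complex `G²`: the graph `G¹` together with, for every auxiliary edge, a Nielsen face,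
glued along the auxiliary edge and the path `face h h'` with the same endpoints. -/
structure Complex (V T R S H : Type*) extends Graph1 V T R S H where
  /-- every auxiliary vertex is the midpoint of an auxiliary edge -/
  exists_aux : ∀ s : S, ∃ h h' : H, toGraph1.IsAux h h' ∧ star h = s
  face : H → H → Word T R H
  /-- convention for the degenerate case `h = h'` -/
  face_self : ∀ h, face h h = []
  face_rev : ∀ h h', toGraph1.IsAux h h' → face h' h = invRev (face h h')
  face_path : ∀ h h', toGraph1.IsAux h h' →
    toGraph1.IsPath (Sum.inl (foot h)) (face h h') (Sum.inl (foot h'))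
  /-- the number of times that the retraction `rhat` has to be iterated in order to reach `Γ` -/
  depth : ℕ

namespace Complex

variable (G : Complex V T R S H)

/-- Elementary homotopies: remove a backtracking, or push an auxiliary edge over its Nielsen
face. -/
inductive Move : Word T R H → Word T R H → Prop
  | cancel (a : Word T R H) (x : Letter T R H) (b : Word T R H) :
      Move (a ++ x :: rev x :: b) (a ++ b)
  | push (a : Word T R H) (h h' : H) (b : Word T R H) (hh : G.IsAux h h') :
      Move (a ++ (auxWord h h' ++ b)) (a ++ (G.face h h' ++ b))

/-- Homotopy in `G²`, relative to the endpoints, of edge paths from `u` to `v`. -/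
def Homotopic (u v : V ⊕ S) (p q : Word T R H) : Prop :=
  G.IsPath u p v ∧ G.IsPath u q v ∧
    Relation.EqvGen (fun p q => G.IsPath u p v ∧ G.IsPath u q v ∧ G.Move p q) p q

/-- The map which replaces every auxiliary edge of a path by the associated INP. (A path which
starts and ends at vertices of `Γ` enters and leaves an auxiliary vertex through two consecutive
half-edges.) -/
def rhat : Word T R H → Word T R H
  | (Edge.half h, false) :: (Edge.half h', true) :: p => G.face h h' ++ rhat p
  | x :: p => x :: rhat p
  | [] => []

/-- The retraction onto `Γ`, as a power of `rhat`. -/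
def retr (p : Word T R H) : Word T R H := G.rhat^[G.depth] p

/-- Every relative backtracking subpath is contained in `X`. -/
def RelReduced (p : Word T R H) : Prop :=
  ∀ σ : Word T R H, σ <:+: p → ∀ u v : V ⊕ S,
    (∃ q, InX q ∧ G.Homotopic u v σ q) → InX σ

/-- The lift of the path `p` to the universal covering of `G²` is an `(A, B)`-quasi-geodesic for
the simplicial metric. The distance between the endpoints of the lift of a subpath `σ` is the
minimal number of edges of a path homotopic to `σ`. -/
def LiftsToQuasiGeodesic (A B : ℕ) (p : Word T R H) : Prop :=
  ∀ σ : Word T R H, σ <:+: p → ∀ (u v : V ⊕ S) (q : Word T R H),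
    G.Homotopic u v σ q → σ.length ≤ A * q.length + B

/-- The pre-INP of the auxiliary edge `(h, h')` occurs in `ρ`, starting after `i` edges. -/
def PreINPAt (ρ : Word T R H) (i : ℕ) (h h' : H) : Prop :=
  G.IsAux h h' ∧ ∃ p q : Word T R H, p.length = i ∧ ρ = p ++ G.retr (auxWord h h') ++ q

/-- This occurrence is isolated: every pre-INP occurring in `ρ` which intersects it in more than
a point is contained in it. -/
def IsolatedAt (ρ : Word T R H) (i : ℕ) (h h' : H) : Prop :=
  G.PreINPAt ρ i h h' ∧ ∀ (j : ℕ) (k k' : H), G.PreINPAt ρ j k k' →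
    i < j + (G.retr (auxWord k k')).length → j < i + (G.retr (auxWord h h')).length →
    i ≤ j ∧ j + (G.retr (auxWord k k')).length ≤ i + (G.retr (auxWord h h')).length

/-- The building blocks of a path: a single oriented edge, or an auxiliary edge. -/
def blockPath : Letter T R H ⊕ (H × H) → Word T R H
  | Sum.inl x => [x]
  | Sum.inr (h, h') => auxWord h h'

/-- The corresponding blocks in `Γ`: every auxiliary edge is replaced by its pre-INP. -/
def blockRetr : Letter T R H ⊕ (H × H) → Word T R H
  | Sum.inl x => [x]
  | Sum.inr (h, h') => G.retr (auxWord h h')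

/-- `γ` is obtained from `ρ` by replacing every isolated pre-INP by its auxiliary edge. -/
def IsReplacement (ρ γ : Word T R H) : Prop :=
  ∃ bs : List (Letter T R H ⊕ (H × H)),
    ρ = bs.flatMap G.blockRetr ∧ γ = bs.flatMap blockPath ∧
    ∀ i h h', G.IsolatedAt ρ i h h' ↔
      ∃ b₁ b₂, bs = b₁ ++ Sum.inr (h, h') :: b₂ ∧ i = (b₁.flatMap G.blockRetr).length

/-- `γ` is a normalized path from `u` to `v`. -/
def Normalized (u v : V) (γ : Word T R H) : Prop :=
  G.IsPath (Sum.inl u) γ (Sum.inl v) ∧ InΓ (G.retr γ) ∧ IsReduced (G.retr γ) ∧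
    G.IsReplacement (G.retr γ) γ

/-- `δ` is the normalized path `γ_*` associated to the path `γ` from `u` to `v`. -/
def IsNormalization (u v : V) (γ δ : Word T R H) : Prop :=
  G.Normalized u v δ ∧ G.Homotopic (Sum.inl u) (Sum.inl v) γ δ

end Complex

/-- Map given on the oriented edges by a map `φ` defined on the edges. -/
def mapWord (φ : Edge T R H → Word T R H) (p : Word T R H) : Word T R H :=
  p.flatMap fun x => if x.2 then φ x.1 else invRev (φ x.1)

/-- A cellular self-map of `G²` which maps `X` to `X`: vertices of `Γ` are mapped to vertices of
`Γ`, auxiliary vertices to vertices, edges to edge paths, and the boundary of every Nielsen face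
to a contractible loop, so that the map extends to the face. -/
structure SelfMap (G : Complex V T R S H) where
  onV : V → V
  onS : S → V ⊕ S
  onE : Edge T R H → Word T R H
  onE_path : ∀ e, G.IsPath (Sum.elim (fun v => Sum.inl (onV v)) onS (G.src e)) (onE e)
    (Sum.elim (fun v => Sum.inl (onV v)) onS (G.tgt e))
  low_inX : ∀ e, InX (onE (Edge.low e))
  half_inX : ∀ h, InX (onE (Edge.half h))
  map_face : ∀ h h', G.IsAux h h' →
    G.Homotopic (Sum.inl (onV (G.foot h))) (Sum.inl (onV (G.foot h')))
      (mapWord onE (auxWord h h')) (mapWord onE (G.face h h'))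

namespace SelfMap

variable {G : Complex V T R S H} (f : SelfMap G)

/-- The image of an edge path under the `t`-th iterate of `f`. -/
def iter (t : ℕ) (p : Word T R H) : Word T R H := (mapWord f.onE)^[t] p

/-- A path is legal if all its forward images are relatively reduced. -/
def Legal (p : Word T R H) : Prop := ∀ t : ℕ, 1 ≤ t → G.RelReduced (f.iter t p)

/-- An indivisible (periodic) Nielsen path. Two paths of the graph `G¹` with the same endpoints
are homotopic in `G¹` if and only if they agree in the free group on the edges. -/
def IsINP (η : Word T R H) : Prop :=
  IsReduced η ∧
  (∃ x ∈ η.head?, IsTrain x) ∧ (∃ x ∈ η.getLast?, IsTrain x) ∧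
  (∃ η₁ η₂, η = η₁ ++ η₂ ∧ f.Legal η₁ ∧ f.Legal η₂) ∧
  (∀ t, ¬ f.Legal (f.iter t η)) ∧
  ∃ u v : V, G.IsPath (Sum.inl u) η (Sum.inl v) ∧
    ∃ t : ℕ, 1 ≤ t ∧ f.onV^[t] u = u ∧ f.onV^[t] v = v ∧
      FreeGroup.mk (f.iter t η) = FreeGroup.mk η

/-- A turn: two edges of the train track part, joined by a (possibly trivial) path in `X`. -/
def IsTurn (τ : Word T R H) : Prop :=
  ∃ a χ b, IsTrain a ∧ IsTrain b ∧ InX χ ∧ τ = a :: (χ ++ [b])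

/-- Strongly legal paths: reduced legal paths `γ` such that, after replacing every auxiliary edge
by its INP, every turn which is not legal lies inside one of the inserted INPs, i.e. is its tip.
(The branches of an INP are legal, so that its tip is the only turn of it that is not legal.) -/
def StronglyLegal (γ : Word T R H) : Prop :=
  (∃ u v : V, G.IsPath (Sum.inl u) γ (Sum.inl v)) ∧ IsReduced γ ∧ f.Legal γ ∧
  ∀ p τ q, G.rhat γ = p ++ τ ++ q → IsTurn τ → ¬ f.Legal τ →
    ∃ α h h' β p₁ q₁, G.IsAux h h' ∧ γ = α ++ auxWord h h' ++ β ∧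
      G.face h h' = p₁ ++ τ ++ q₁ ∧ p = G.rhat α ++ p₁ ∧ q = q₁ ++ G.rhat β

/-- A turn is illegal if it is not legal, or if one of its two maximal half turns is not strongly
legal. -/
def IllegalTurn (τ : Word T R H) : Prop :=
  ∃ a χ b, IsTrain a ∧ IsTrain b ∧ InX χ ∧ τ = a :: (χ ++ [b]) ∧
    (¬ f.Legal τ ∨ (χ ≠ [] ∧ (¬ f.StronglyLegal (a :: χ) ∨ ¬ f.StronglyLegal (χ ++ [b]))))

/-- The number of illegal turns of a path: count the subpaths which are illegal turns. -/
noncomputable def ilt (γ : Word T R H) : ℕ :=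
  {s : Word T R H × Word T R H × Word T R H |
    γ = s.1 ++ s.2.1 ++ s.2.2 ∧ f.IllegalTurn s.2.1}.ncard

/-- The map `r ∘ f` on paths of `Γ`. -/
def onΓ (p : Word T R H) : Word T R H := G.retr (mapWord f.onE p)

/-- Two directions of `Γ` form an illegal turn for `r ∘ f` if some iterate maps them to the same
direction. -/
def SameDir (x y : Letter T R H) : Prop :=
  ∃ k : ℕ, (f.onΓ^[k] [x]).head? = (f.onΓ^[k] [y]).head?

/-- All consecutive oriented edges `x`, `y` of `p`, for which both edges satisfy `P`, form a
legal turn for `r ∘ f`. -/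
def TurnsLegal (P : Edge T R H → Prop) (p : Word T R H) : Prop :=
  ∀ a x y b, p = a ++ x :: y :: b → P x.1 → P y.1 → ¬ f.SameDir (rev x) y

/-- The restriction of `r ∘ f` to `Γ` is a relative train track map in the sense of Bestvina and
Handel. The stratum number `k` of the filtration consists of the edges of height `k`. An
irreducible transition matrix with non-negative integer entries has Perron-Frobenius eigenvalue
`> 1` if and only if one of its column sums is at least `2`. -/
def IsRelativeTrainTrack : Prop :=
  ∃ height : Edge T R H → ℕ,
    -- edges of `Γ` are mapped to non-trivial reduced edge paths of `Γ`
    (∀ x : Letter T R H, InΓ [x] →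
      f.onΓ [x] ≠ [] ∧ InΓ (f.onΓ [x]) ∧ IsReduced (f.onΓ [x])) ∧
    -- the filtration is invariant
    (∀ x : Letter T R H, InΓ [x] → ∀ y ∈ f.onΓ [x], height y.1 ≤ height x.1) ∧
    -- every transition matrix is zero or irreducible
    (∀ k : ℕ,
      (∀ x : Letter T R H, InΓ [x] → height x.1 = k → ∀ y ∈ f.onΓ [x], height y.1 ≠ k) ∨
      (∀ x y : Letter T R H, InΓ [x] → InΓ [y] → height x.1 = k → height y.1 = k →
        ∃ t : ℕ, 1 ≤ t ∧ ∃ z ∈ f.onΓ^[t] [x], z.1 = y.1)) ∧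
    -- the three properties of the exponentially growing strata
    ∀ k : ℕ,
      (∀ x y : Letter T R H, InΓ [x] → InΓ [y] → height x.1 = k → height y.1 = k →
        ∃ t : ℕ, 1 ≤ t ∧ ∃ z ∈ f.onΓ^[t] [x], z.1 = y.1) →
      (∃ x : Letter T R H, InΓ [x] ∧ height x.1 = k ∧
        2 ≤ (f.onΓ [x]).countP (fun y => decide (height y.1 = k))) →
      (∀ x : Letter T R H, InΓ [x] → height x.1 = k →
        ∃ y ∈ (f.onΓ [x]).head?, height y.1 = k) ∧
      (∀ (u v : V) (p : Word T R H), G.IsPath (Sum.inl u) p (Sum.inl v) → InΓ p → p ≠ [] →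
        IsReduced p → (∀ y ∈ p, height y.1 < k) →
        (∃ x : Letter T R H, InΓ [x] ∧ height x.1 = k ∧ G.init x = Sum.inl u) →
        (∃ x : Letter T R H, InΓ [x] ∧ height x.1 = k ∧ G.init x = Sum.inl v) →
        FreeGroup.mk (f.onΓ p) ≠ 1) ∧
      (∀ (u v : V) (p : Word T R H), G.IsPath (Sum.inl u) p (Sum.inl v) → InΓ p →
        (∀ y ∈ p, height y.1 = k) → f.TurnsLegal (fun _ => True) p →
        f.TurnsLegal (fun e => height e = k) (f.onΓ p))

end SelfMap

/-- `f` represents the (outer automorphism given by the) automorphism `α` of the free group of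
rank `n`: a marking isomorphism from the fundamental group of `G²` to the free group, induced by
the map `θ` on loops, conjugates the map induced by `f` to the outer class of `α`. -/
structure Marking (G : Complex V T R S H) (f : SelfMap G) (n : ℕ)
    (α : FreeGroup (Fin n) ≃* FreeGroup (Fin n)) where
  base : V
  /-- `G²` is connected -/
  connected : ∀ u : V ⊕ S, ∃ p, G.IsPath (Sum.inl base) p u
  θ : Word T R H → FreeGroup (Fin n)
  θ_mul : ∀ p q, G.IsPath (Sum.inl base) p (Sum.inl base) →
    G.IsPath (Sum.inl base) q (Sum.inl base) → θ (p ++ q) = θ p * θ q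
  θ_eq_iff : ∀ p q, G.IsPath (Sum.inl base) p (Sum.inl base) →
    G.IsPath (Sum.inl base) q (Sum.inl base) →
    (θ p = θ q ↔ G.Homotopic (Sum.inl base) (Sum.inl base) p q)
  θ_surj : ∀ w, ∃ p, G.IsPath (Sum.inl base) p (Sum.inl base) ∧ θ p = w
  /-- a path from the base point to its image -/
  tail : Word T R H
  tail_path : G.IsPath (Sum.inl base) tail (Sum.inl (f.onV base))
  conj : ∀ p, G.IsPath (Sum.inl base) p (Sum.inl base) →
    θ (tail ++ f.iter 1 p ++ invRev tail) = α (θ p)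

/-- The cyclic length of `w`: the minimal word length of a conjugate of `w`. -/
noncomputable def cyclicLength {n : ℕ} (w : FreeGroup (Fin n)) : ℕ :=
  sInf (Set.range fun g : FreeGroup (Fin n) => (g * w * g⁻¹).norm)

/-- `w` is of polynomial `α`-growth. -/
def PolynomialGrowth {n : ℕ} (α : FreeGroup (Fin n) ≃* FreeGroup (Fin n))
    (w : FreeGroup (Fin n)) : Prop :=
  ∃ C d : ℝ, 0 < C ∧ 0 ≤ d ∧ ∀ t : ℕ, 1 ≤ t → (cyclicLength (α^[t] w) : ℝ) ≤ C * (t : ℝ) ^ d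

/-- `f : G² → G²` is a β-train track map, with respect to the given marking. -/
structure IsBetaTrainTrack {G : Complex V T R S H} {f : SelfMap G} {n : ℕ}
    {α : FreeGroup (Fin n) ≃* FreeGroup (Fin n)} (m : Marking G f n α) : Prop where
  /-- Nielsen faces are glued along INPs, -/
  face_inp : ∀ h h', G.IsAux h h' → f.IsINP (G.face h h')
  /-- and every INP has its auxiliary edge. -/
  inp_face : ∀ η, f.IsINP η → ∃ h h', G.IsAux h h' ∧ η = G.face h h'
  /-- every loop has an iterate which is freely homotopic to a legal loop -/
  loops : ∀ (u : V) (γ : Word T R H), G.IsPath (Sum.inl u) γ (Sum.inl u) →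
    ∃ (t : ℕ) (w : V) (τ δ : Word T R H), G.IsPath (Sum.inl (f.onV^[t] u)) τ (Sum.inl w) ∧
      G.IsPath (Sum.inl w) δ (Sum.inl w) ∧
      G.Homotopic (Sum.inl (f.onV^[t] u)) (Sum.inl (f.onV^[t] u)) (f.iter t γ)
        (τ ++ δ ++ invRev τ) ∧
      ∀ k : ℕ, f.Legal (List.replicate k δ).flatten
  /-- the fundamental groups of the components of `X` inject -/
  X_inj : ∀ (u : V ⊕ S) (γ : Word T R H), G.IsPath u γ u → InX γ → G.Homotopic u u γ [] →
    FreeGroup.mk γ = 1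
  /-- loops in `X` represent conjugacy classes of polynomial growth -/
  X_growth : ∀ (u : V ⊕ S) (ρ γ : Word T R H), G.IsPath (Sum.inl m.base) ρ u →
    G.IsPath u γ u → InX γ → PolynomialGrowth α (m.θ (ρ ++ γ ++ invRev ρ))
  /-- the retraction maps every auxiliary edge to a reduced path in `Γ`, -/
  retr_aux : ∀ h h', G.IsAux h h' →
    InΓ (G.retr (auxWord h h')) ∧ IsReduced (G.retr (auxWord h h'))
  /-- and it is well defined on `G²`: it maps homotopic paths to homotopic paths in `Γ`. -/
  retr_homotopic : ∀ (u v : V) (p q : Word T R H), G.Homotopic (Sum.inl u) (Sum.inl v) p q →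
    FreeGroup.mk (G.retr p) = FreeGroup.mk (G.retr q)
  /-- `r ∘ f` is a relative train track map on `Γ` -/
  relativeTrainTrack : f.IsRelativeTrainTrack
  /-- every edge of the train track part is strongly legal -/
  train_stronglyLegal : ∀ (e : T) (b : Bool), f.StronglyLegal [(Edge.train e, b)]
  /-- the image of a strongly legal path is strongly legal (subpaths in `X` being reduced) -/
  map_stronglyLegal : ∀ γ, f.StronglyLegal γ → f.StronglyLegal (tighten (f.iter 1 γ))
  /-- every edge of the train track part is expanding -/
  expanding : ∀ e : T, ∃ t : ℕ, 1 ≤ t ∧ 2 ≤ relLength (f.iter t [(Edge.train e, true)])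
  /-- strongly legal paths lift to quasi-geodesics -/
  qg_stronglyLegal : ∃ A B : ℕ, ∀ γ, f.StronglyLegal γ → G.LiftsToQuasiGeodesic A B γ
  /-- reduced paths in `Γ` lift to quasi-geodesics -/
  qg_Γ : ∃ A B : ℕ, ∀ (u v : V) (γ : Word T R H), G.IsPath (Sum.inl u) γ (Sum.inl v) →
    InΓ γ → IsReduced γ → G.LiftsToQuasiGeodesic A B γ
  /-- paths with reduced image in `Γ` lift to quasi-geodesics -/
  qg_retr : ∃ A B : ℕ, ∀ (u v : V) (γ : Word T R H), G.IsPath (Sum.inl u) γ (Sum.inl v) →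
    XTight γ → IsReduced (G.retr γ) → G.LiftsToQuasiGeodesic A B γ
  /-- the same for paths derived from strongly legal ones by applying `r` to some subpaths -/
  qg_derived : ∃ A B : ℕ, ∀ L : List (Word T R H × Bool),
    (∀ s ∈ L, ∃ u v : V, G.IsPath (Sum.inl u) s.1 (Sum.inl v)) →
    f.StronglyLegal (L.map Prod.fst).flatten →
    G.LiftsToQuasiGeodesic A B (L.map fun s => if s.2 then G.retr s.1 else s.1).flatten
  /-- every path has an iterate which is homotopic to a strongly legal path, where the exponent
  depends only on the number of illegal turns -/
  eventually_stronglyLegal : ∃ that : ℕ → ℕ, ∀ (u v : V) (γ : Word T R H),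
    G.IsPath (Sum.inl u) γ (Sum.inl v) → XTight γ →
    ∃ σ, f.StronglyLegal σ ∧
      G.Homotopic (Sum.inl (f.onV^[that (f.ilt γ)] u)) (Sum.inl (f.onV^[that (f.ilt γ)] v))
        (f.iter (that (f.ilt γ)) γ) σ

end BetaTrainTrack

/-!
Write `r` for the retraction onto `Γ`. A reduced path of `Γ` is a normal form for a homotopy class
of paths in `G²`, and `f.image t p`, the reduced path homotopic to `r (f^t p)`, is the map induced
by `f^t` on these normal forms. The relative length of a normalized path `γ` is a quantity of the
reduced path `r(γ)`, its *uncovered length*: the number of edges of the train track part which lie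
on no isolated pre-INP. Since isolation is decided in a neighbourhood of bounded size, the uncovered
length is additive under concatenation up to a bounded error (`uncoveredLength_append_le`,
`le_uncoveredLength_append`).

The uncovered length of `r(σ)`, for a strongly legal path `σ`, is comparable to the relative length
of `σ` (`relLength_le_uncoveredLength`, `uncoveredLength_retr_le`). The lower bound holds since a
legal path has no subpath which crosses the train track part and is homotopic into `X`. For the
upper bound the retraction of a strongly legal path `χ` in `X` has to be completely covered by
isolated pre-INPs, i.e. every pre-INP occurring in `r(χ)` has to be contained in the pre-INP of an
auxiliary edge of `χ` (`exists_block_of_preINP`). This is the heart of the proof. Take an exponent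
`s` which fixes all INPs and stretches the train track part by a huge factor. If a pre-INP, which is
fixed by `f.image s`, were a product of a proper terminal piece of one pre-INP and further pieces,
then its image would be the product of their images without cancellation (`image_of_suffix`,
`image_prefix_in_X`); but the image of a proper piece of a pre-INP is longer than every pre-INP
(`image_of_prefix`). If no block is cut by the pre-INP, then it is the retraction of two different
reduced paths in `X`, which contradicts the `π₁`-injectivity of `X` (`eq_of_retr_eq`).

High iterates of `f` expand the relative length of strongly legal paths. For the reduced path of a
concatenation of `K` strongly legal paths, bounded cancellation (`exists_bounded_cancellation`)
yields that an iterate multiplies its uncovered length by any given factor, up to an error `K * C`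
(`exists_mul_uncoveredLength_le_of_isChain`). Bounded cancellation for reduced paths of `Γ` follows
from the injectivity of `f` on homotopy classes and the finiteness of the set of short words.

Now let `γ` be homotopic to `f^N(γ')` with `|γ'| < λ |γ|`. A normalized path has no backtracking in
`X` (`xTight_of_normalized`), so that `γ'` can be cut into `K` pieces, each with a bounded number of
illegal turns, where `K - 1` is at most a small multiple of `|γ'|`. Hence `γ` is homotopic to the
concatenation of `K` strongly legal paths, if `N` is large. If `K = 1`, the expansion of strongly
legal paths applies; if `K ≥ 2`, then `|γ|` is large in comparison with `K`, and the estimate for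
concatenations, applied repeatedly, shows that `f^N` stretches `γ` (`exists_exponent`).
-/

namespace BetaTrainTrack

open FreeGroup (IsReduced invRev)

variable {V T R S H : Type*}

/-! ### Words, reduction and relative length -/

@[simp] theorem rev_rev (x : Letter T R H) : rev (rev x) = x := by simp [rev]

@[simp] theorem isTrain_rev (x : Letter T R H) : IsTrain (rev x) ↔ IsTrain x := Iff.rfl

theorem invRev_cons_rev (x : Letter T R H) (p : Word T R H) :
    invRev (x :: p) = invRev p ++ [rev x] := by
  simp [invRev, rev]

@[simp] theorem invRev_singleton (x : Letter T R H) : invRev [x] = [rev x] := by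
  simp [invRev, rev]

@[simp] theorem invRev_eq_nil {p : Word T R H} : invRev p = [] ↔ p = [] := by
  rw [← List.length_eq_zero_iff, FreeGroup.invRev_length, List.length_eq_zero_iff]

theorem invRev_append_singleton (p : Word T R H) (x : Letter T R H) :
    invRev (p ++ [x]) = rev x :: invRev p := by
  simp [FreeGroup.invRev_append]

theorem mem_invRev {x : Letter T R H} {p : Word T R H} : x ∈ invRev p ↔ rev x ∈ p := by
  induction p with
  | nil => simp
  | cons y p ih =>
    rw [invRev_cons_rev, List.mem_append, ih, List.mem_singleton, List.mem_cons, or_comm]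
    refine or_congr_left ⟨fun h => by rw [h, rev_rev], fun h => by rw [← h, rev_rev]⟩

theorem reduced_rel_iff (x y : Letter T R H) : (x.1 = y.1 → x.2 = y.2) ↔ y ≠ rev x := by
  obtain ⟨a, b⟩ := x
  obtain ⟨c, d⟩ := y
  constructor
  · rintro h h'
    simp only [rev, Prod.mk.injEq] at h'
    have := h h'.1.symm
    simp_all
  · intro h h'
    simp only at h'
    subst h'
    by_contra hne
    apply h
    simp only [rev, Prod.mk.injEq, true_and]
    cases b <;> cases d <;> simp_all

theorem _root_.FreeGroup.IsReduced.append {a b : Word T R H} (ha : IsReduced a) (hb : IsReduced b)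
    (h : ∀ x ∈ a.getLast?, ∀ y ∈ b.head?, y ≠ rev x) : IsReduced (a ++ b) := by
  unfold FreeGroup.IsReduced at *
  rw [List.isChain_append]
  exact ⟨ha, hb, fun x hx y hy => (reduced_rel_iff x y).2 (h x hx y hy)⟩

theorem _root_.FreeGroup.IsReduced.left {a b : Word T R H} (h : IsReduced (a ++ b)) : IsReduced a :=
  h.infix ⟨[], b, rfl⟩

theorem _root_.FreeGroup.IsReduced.right {a b : Word T R H} (h : IsReduced (a ++ b)) : IsReduced b :=
  h.infix ⟨a, [], by simp⟩

theorem _root_.FreeGroup.IsReduced.ne_rev {a b : Word T R H} {x y : Letter T R H}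
    (h : IsReduced (a ++ x :: y :: b)) : y ≠ rev x := by
  have h2 : IsReduced ([x] ++ [y]) := h.infix ⟨a, b, by simp⟩
  unfold FreeGroup.IsReduced at h2
  rw [List.isChain_append] at h2
  exact (reduced_rel_iff x y).1 (h2.2.2 x (by simp) y (by simp))

/-- Two reduced words which overlap in a letter can be joined along that letter. -/
theorem _root_.FreeGroup.IsReduced.glue {a b : Word T R H} {x : Letter T R H}
    (ha : IsReduced (a ++ [x])) (hb : IsReduced (x :: b)) : IsReduced (a ++ x :: b) := by
  have := FreeGroup.IsReduced.append_overlap (L₃ := b) ha (by simpa using hb) (by simp)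
  simpa using this

theorem _root_.FreeGroup.IsReduced.glue_append {a b c : Word T R H} (ha : IsReduced (a ++ b))
    (hb : IsReduced (b ++ c)) (h : b ≠ []) : IsReduced (a ++ b ++ c) :=
  FreeGroup.IsReduced.append_overlap ha hb h

theorem exists_backtracking {p : Word T R H} (h : ¬ IsReduced p) :
    ∃ a x b, p = a ++ x :: rev x :: b := by
  induction p with
  | nil => exact absurd FreeGroup.IsReduced.nil h
  | cons x p ih =>
    by_cases hp : IsReduced p
    · cases p with
      | nil => exact absurd FreeGroup.IsReduced.singleton h
      | cons y p =>
        rw [FreeGroup.isReduced_cons_cons] at h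
        rw [reduced_rel_iff] at h
        have : y = rev x := by
          by_contra hne
          exact h ⟨hne, hp⟩
        exact ⟨[], x, p, by simp [this]⟩
    · obtain ⟨a, y, b, rfl⟩ := ih hp
      exact ⟨x :: a, y, b, by simp⟩

theorem isReduced_invRev {p : Word T R H} (h : IsReduced p) : IsReduced (invRev p) := by
  by_contra h'
  obtain ⟨a, x, b, hab⟩ := exists_backtracking h'
  have : p = invRev b ++ x :: rev x :: invRev a := by
    rw [← FreeGroup.invRev_invRev (L₁ := p), hab]
    simp [FreeGroup.invRev_append, invRev_cons_rev]
  rw [this] at h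
  exact FreeGroup.IsReduced.ne_rev h rfl

/-! #### Reduction -/

@[simp] theorem mk_tighten (p : Word T R H) : FreeGroup.mk (tighten p) = FreeGroup.mk p := by
  classical
  exact @FreeGroup.reduce.self _ p (Classical.decEq _)

theorem isReduced_tighten (p : Word T R H) : IsReduced (tighten p) :=
  (@FreeGroup.isReduced_iff_reduce_eq _ _ (Classical.decEq _)).2
    (@FreeGroup.reduce.idem _ _ (Classical.decEq _))

theorem _root_.FreeGroup.IsReduced.tighten_eq {p : Word T R H} (h : IsReduced p) : tighten p = p :=
  (@FreeGroup.isReduced_iff_reduce_eq _ _ (Classical.decEq _)).1 h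

theorem tighten_congr {p q : Word T R H} (h : FreeGroup.mk p = FreeGroup.mk q) :
    tighten p = tighten q := @FreeGroup.reduce.sound _ _ _ (Classical.decEq _) h

theorem _root_.FreeGroup.IsReduced.eq_of_mk {p q : Word T R H} (hp : IsReduced p) (hq : IsReduced q)
    (h : FreeGroup.mk p = FreeGroup.mk q) : p = q := by
  rw [← FreeGroup.IsReduced.tighten_eq hp, ← FreeGroup.IsReduced.tighten_eq hq, tighten_congr h]

theorem _root_.FreeGroup.IsReduced.eq_tighten {p q : Word T R H} (hp : IsReduced p)
    (h : FreeGroup.mk p = FreeGroup.mk q) : p = tighten q := by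
  rw [← FreeGroup.IsReduced.tighten_eq hp, tighten_congr h]

theorem mk_append (p q : Word T R H) :
    FreeGroup.mk (p ++ q) = FreeGroup.mk p * FreeGroup.mk q := FreeGroup.mul_mk.symm

theorem mk_invRev (p : Word T R H) : FreeGroup.mk (invRev p) = (FreeGroup.mk p)⁻¹ :=
  FreeGroup.inv_mk.symm

theorem mk_nil : FreeGroup.mk ([] : Word T R H) = 1 := rfl

theorem tighten_invRev (p : Word T R H) : tighten (invRev p) = invRev (tighten p) := by
  refine (FreeGroup.IsReduced.eq_tighten (isReduced_invRev (isReduced_tighten p)) ?_).symm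
  rw [mk_invRev, mk_invRev, mk_tighten]

theorem tighten_sublist (p : Word T R H) : (tighten p).Sublist p :=
  FreeGroup.Red.sublist (@FreeGroup.reduce.red _ p (Classical.decEq _))

theorem tighten_length_le (p : Word T R H) : (tighten p).length ≤ p.length :=
  (tighten_sublist p).length_le

@[simp] theorem tighten_nil : tighten ([] : Word T R H) = [] :=
  FreeGroup.IsReduced.tighten_eq FreeGroup.IsReduced.nil

theorem tighten_append_tighten (p q : Word T R H) :
    tighten (tighten p ++ tighten q) = tighten (p ++ q) :=
  tighten_congr (by rw [mk_append, mk_append, mk_tighten, mk_tighten])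

/-- A decomposition of the reduced word comes from a decomposition of the word. -/
theorem exists_split_of_tighten {w p q : Word T R H} (h : tighten w = p ++ q) :
    ∃ w₁ w₂, w = w₁ ++ w₂ ∧ tighten w₁ = p ∧ tighten w₂ = q := by
  have hr : FreeGroup.Red w (p ++ q) := h ▸ @FreeGroup.reduce.red _ w (Classical.decEq _)
  obtain ⟨w₁, w₂, rfl, h₁, h₂⟩ := FreeGroup.Red.to_append_iff.1 hr
  have hpq : IsReduced (p ++ q) := h ▸ isReduced_tighten _
  refine ⟨w₁, w₂, rfl, ?_, ?_⟩
  · exact (FreeGroup.IsReduced.eq_tighten (FreeGroup.IsReduced.left hpq)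
      (@FreeGroup.reduce.exact _ _ _ (Classical.decEq _)
        (@FreeGroup.reduce.eq_of_red _ _ _ (Classical.decEq _) h₁).symm)).symm
  · exact (FreeGroup.IsReduced.eq_tighten (FreeGroup.IsReduced.right hpq)
      (@FreeGroup.reduce.exact _ _ _ (Classical.decEq _)
        (@FreeGroup.reduce.eq_of_red _ _ _ (Classical.decEq _) h₂).symm)).symm

/-- The product of two reduced words: a terminal subword of the first one cancels against an
initial subword of the second one. -/
theorem exists_cancellation {a b : Word T R H} (ha : IsReduced a) (hb : IsReduced b) :
    ∃ p c q, a = p ++ c ∧ b = invRev c ++ q ∧ IsReduced (p ++ q) := by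
  induction a using List.reverseRecOn generalizing b with
  | nil => exact ⟨[], [], b, by simp, by simp, by simpa using hb⟩
  | append_singleton a x ih =>
    by_cases h : IsReduced (a ++ [x] ++ b)
    · exact ⟨a ++ [x], [], b, by simp, by simp, h⟩
    · cases b with
      | nil => exact absurd (by simpa using ha) h
      | cons y b =>
        have hy : y = rev x := by
          by_contra hne
          exact h (FreeGroup.IsReduced.append ha hb (by simp [hne]))
        subst hy
        obtain ⟨p, c, q, rfl, rfl, hpq⟩ := ih (FreeGroup.IsReduced.left ha)
          (FreeGroup.IsReduced.right (a := [rev x]) (by simpa using hb))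
        exact ⟨p, c ++ [x], q, by simp, by simp [FreeGroup.invRev_append], hpq⟩

theorem tighten_eq_of_cancellation {a b p c q : Word T R H} (ha : a = p ++ c)
    (hb : b = invRev c ++ q) (hpq : IsReduced (p ++ q)) : tighten (a ++ b) = p ++ q := by
  refine (FreeGroup.IsReduced.eq_tighten hpq ?_).symm
  subst ha hb
  simp only [mk_append, mk_invRev]
  group

/-! #### The relative part -/

@[simp] theorem inX_nil : InX ([] : Word T R H) := by simp [InX]

theorem inX_append {p q : Word T R H} : InX (p ++ q) ↔ InX p ∧ InX q := by
  simp [InX, or_imp, forall_and]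

theorem inX_cons {x : Letter T R H} {q : Word T R H} :
    InX (x :: q) ↔ ¬ IsTrain x ∧ InX q := by
  simp [InX]

theorem inX_invRev {p : Word T R H} : InX (invRev p) ↔ InX p := by
  constructor
  · intro h x hx
    have := h (rev x) (mem_invRev.2 (by simpa using hx))
    simpa using this
  · intro h x hx
    simpa using h (rev x) (mem_invRev.1 hx)

theorem InX.tighten {p : Word T R H} (h : InX p) : InX (tighten p) :=
  fun x hx => h x ((tighten_sublist p).subset hx)

theorem inΓ_append {p q : Word T R H} : InΓ (p ++ q) ↔ InΓ p ∧ InΓ q := by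
  simp only [InΓ, List.mem_append, or_imp, forall_and]

@[simp] theorem inΓ_nil : InΓ ([] : Word T R H) := by simp [InΓ]

theorem InΓ.infix {p q : Word T R H} (h : InΓ q) (hp : p <:+: q) : InΓ p :=
  fun x hx => h x (hp.subset hx)

theorem InΓ.tighten {p : Word T R H} (h : InΓ p) : InΓ (tighten p) :=
  fun x hx => h x ((tighten_sublist p).subset hx)

theorem inΓ_invRev {p : Word T R H} (h : InΓ p) : InΓ (invRev p) :=
  fun x hx => h (rev x) (mem_invRev.1 hx)

theorem inΓ_singleton_of_isTrain {x : Letter T R H} (hx : IsTrain x) : InΓ [x] := by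
  obtain ⟨e, he⟩ := hx
  simp [InΓ, he]

@[simp] theorem relLength_nil : relLength ([] : Word T R H) = 0 := by simp [relLength]

@[simp] theorem relLength_append (p q : Word T R H) :
    relLength (p ++ q) = relLength p + relLength q := by simp [relLength]

theorem relLength_cons (x : Letter T R H) (q : Word T R H) :
    relLength (x :: q) = relLength [x] + relLength q := by
  rw [← relLength_append]; rfl

theorem relLength_singleton_of_isTrain {x : Letter T R H} (hx : IsTrain x) :
    relLength [x] = 1 := by simp [relLength, hx]

theorem relLength_eq_zero {p : Word T R H} : relLength p = 0 ↔ InX p := by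
  simp [relLength, List.countP_eq_zero, InX]

theorem relLength_le_length (p : Word T R H) : relLength p ≤ p.length := by
  simp only [relLength]
  exact List.countP_le_length

@[simp] theorem relLength_invRev (p : Word T R H) : relLength (invRev p) = relLength p := by
  induction p with
  | nil => simp
  | cons x p ih =>
    rw [invRev_cons_rev, relLength_append, ih, relLength_cons x p, add_comm]
    congr 1

theorem relLength_le_of_prefix {p q : Word T R H} (h : p <+: q) :
    relLength p ≤ relLength q := by
  obtain ⟨r, rfl⟩ := h
  simp

theorem exists_last_train {p : Word T R H} (h : ¬ InX p) :
    ∃ a y z, p = a ++ y :: z ∧ IsTrain y ∧ InX z := by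
  induction p with
  | nil => simp at h
  | cons x p ih =>
    by_cases hp : InX p
    · refine ⟨[], x, p, rfl, ?_, hp⟩
      by_contra hx
      exact h (inX_cons.2 ⟨hx, hp⟩)
    · obtain ⟨a, y, z, rfl, hy, hz⟩ := ih hp
      exact ⟨x :: a, y, z, rfl, hy, hz⟩

/-! #### Maps on words -/

@[simp] theorem mapWord_nil (φ : Edge T R H → Word T R H) : mapWord φ [] = [] := rfl

@[simp] theorem mapWord_append (φ : Edge T R H → Word T R H) (p q : Word T R H) :
    mapWord φ (p ++ q) = mapWord φ p ++ mapWord φ q := by simp [mapWord]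

theorem mapWord_cons (φ : Edge T R H → Word T R H) (x : Letter T R H) (q : Word T R H) :
    mapWord φ (x :: q) = mapWord φ [x] ++ mapWord φ q := by
  rw [← mapWord_append]; rfl

theorem mapWord_rev (φ : Edge T R H → Word T R H) (x : Letter T R H) :
    mapWord φ [rev x] = invRev (mapWord φ [x]) := by
  obtain ⟨e, b⟩ := x
  cases b <;> simp [mapWord, rev]

theorem mapWord_invRev (φ : Edge T R H → Word T R H) (p : Word T R H) :
    mapWord φ (invRev p) = invRev (mapWord φ p) := by
  induction p with
  | nil => simp
  | cons x p ih =>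
    rw [invRev_cons_rev, mapWord_append, ih, mapWord_rev, mapWord_cons φ x p,
      FreeGroup.invRev_append]

theorem mk_mapWord (φ : Edge T R H → Word T R H) (p : Word T R H) :
    FreeGroup.mk (mapWord φ p) = FreeGroup.lift (fun e => FreeGroup.mk (φ e)) (FreeGroup.mk p) := by
  induction p with
  | nil => rw [mapWord_nil, mk_nil, map_one]
  | cons x p ih =>
    have : (x :: p) = [x] ++ p := rfl
    rw [mapWord_cons, mk_append, ih, this, mk_append [x] p, map_mul]
    congr 1
    obtain ⟨e, b⟩ := x
    cases b
    · simp only [mapWord, List.flatMap_cons, List.flatMap_nil, List.append_nil]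
      simp
    · simp [mapWord]

theorem mk_mapWord_congr (φ : Edge T R H → Word T R H) {p q : Word T R H}
    (h : FreeGroup.mk p = FreeGroup.mk q) :
    FreeGroup.mk (mapWord φ p) = FreeGroup.mk (mapWord φ q) := by
  rw [mk_mapWord, mk_mapWord, h]

/-! ### Edge paths and homotopies -/

namespace Graph1

variable {G : Graph1 V T R S H}

@[simp] theorem init_rev (x : Letter T R H) : G.init (rev x) = G.term x := by
  obtain ⟨e, b⟩ := x
  cases b <;> simp [init, term, rev]

@[simp] theorem term_rev (x : Letter T R H) : G.term (rev x) = G.init x := by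
  obtain ⟨e, b⟩ := x
  cases b <;> simp [init, term, rev]

@[simp] theorem isPath_nil {u v : V ⊕ S} : G.IsPath u [] v ↔ u = v := Iff.rfl

theorem isPath_cons {u v : V ⊕ S} {x : Letter T R H} {p : Word T R H} :
    G.IsPath u (x :: p) v ↔ G.init x = u ∧ G.IsPath (G.term x) p v := Iff.rfl

theorem isPath_append {u v : V ⊕ S} {p q : Word T R H} :
    G.IsPath u (p ++ q) v ↔ ∃ w, G.IsPath u p w ∧ G.IsPath w q v := by
  induction p generalizing u with
  | nil => simp
  | cons x p ih => simp only [List.cons_append, isPath_cons, ih]; tauto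

theorem isPath_singleton {u v : V ⊕ S} {x : Letter T R H} :
    G.IsPath u [x] v ↔ G.init x = u ∧ G.term x = v := Iff.rfl

theorem IsPath.append {u v w : V ⊕ S} {p q : Word T R H} (hp : G.IsPath u p w)
    (hq : G.IsPath w q v) : G.IsPath u (p ++ q) v := isPath_append.2 ⟨w, hp, hq⟩

theorem IsPath.invRev {u v : V ⊕ S} {p : Word T R H} (hp : G.IsPath u p v) :
    G.IsPath v (invRev p) u := by
  induction p generalizing u with
  | nil => exact hp.symm
  | cons x p ih =>
    rw [invRev_cons_rev]
    refine (ih hp.2).append ?_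
    rw [isPath_singleton]
    simpa using hp.1

theorem IsPath.end_unique {u v v' : V ⊕ S} {p : Word T R H} (hp : G.IsPath u p v)
    (hp' : G.IsPath u p v') : v = v' := by
  induction p generalizing u with
  | nil => exact hp.symm.trans hp'
  | cons x p ih => exact ih hp.2 hp'.2

theorem IsPath.start_unique {u u' v v' : V ⊕ S} {p : Word T R H} (hp : G.IsPath u p v)
    (hp' : G.IsPath u' p v') (hne : p ≠ []) : u = u' := by
  cases p with
  | nil => exact absurd rfl hne
  | cons x p => exact hp.1.symm.trans hp'.1

theorem IsPath.red {u v : V ⊕ S} {p q : Word T R H} (hp : G.IsPath u p v)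
    (h : FreeGroup.Red p q) : G.IsPath u q v := by
  induction h with
  | refl => exact hp
  | tail _ hs ih =>
    cases hs with
    | @not a b x c =>
      obtain ⟨w, h₁, h₂⟩ := isPath_append.1 ih
      have h₃ : G.term (rev (x, c)) = w := by rw [term_rev]; exact h₂.1
      refine h₁.append ?_
      rw [← h₃]
      exact h₂.2.2

theorem IsPath.tighten {u v : V ⊕ S} {p : Word T R H} (hp : G.IsPath u p v) :
    G.IsPath u (tighten p) v := hp.red (@FreeGroup.reduce.red _ p (Classical.decEq _))

/-- Both endpoints of an edge of `Γ` are vertices of `Γ`. -/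
theorem exists_init_eq_inl {x : Letter T R H} (hx : ∀ h, x.1 ≠ Edge.half h) :
    ∃ v, G.init x = Sum.inl v := by
  obtain ⟨e, b⟩ := x
  cases e <;> cases b <;> simp_all [init, src, tgt]

theorem exists_term_eq_inl {x : Letter T R H} (hx : ∀ h, x.1 ≠ Edge.half h) :
    ∃ v, G.term x = Sum.inl v := by
  rw [← init_rev]; exact exists_init_eq_inl hx

theorem _root_.BetaTrainTrack.IsTrain.ne_half {x : Letter T R H} (hx : IsTrain x) (h : H) :
    x.1 ≠ Edge.half h := by
  obtain ⟨e, he⟩ := hx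
  simp [he]

theorem IsAux.symm {h h' : H} (hh : G.IsAux h h') : G.IsAux h' h :=
  ⟨hh.1.symm, hh.2.symm⟩

theorem isPath_auxWord {h h' : H} (hh : G.star h = G.star h') :
    G.IsPath (Sum.inl (G.foot h)) (auxWord h h') (Sum.inl (G.foot h')) := by
  simp [auxWord, isPath_cons, init, term, src, tgt, hh]

/-- A path which ends at a vertex of `Γ` and all of whose edges lie in `Γ` can be cut anywhere. -/
theorem IsPath.exists_cut_of_inΓ {u : V} {v : V ⊕ S} {p q : Word T R H}
    (hp : G.IsPath (Sum.inl u) (p ++ q) v) (hΓ : InΓ p) :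
    ∃ w : V, G.IsPath (Sum.inl u) p (Sum.inl w) ∧ G.IsPath (Sum.inl w) q v := by
  induction p generalizing u with
  | nil => exact ⟨u, rfl, hp⟩
  | cons x p ih =>
    obtain ⟨w, hw⟩ := exists_term_eq_inl (G := G) (hΓ x (by simp))
    have h2 := hp.2
    rw [hw] at h2
    obtain ⟨w', h₁, h₂⟩ := ih h2 (fun y hy => hΓ y (by simp [hy]))
    exact ⟨w', ⟨hp.1, by rw [hw]; exact h₁⟩, h₂⟩

/-- A path can be cut at the endpoint of an edge of the train track part. -/
theorem IsPath.exists_cut_after {u v : V ⊕ S} {p q : Word T R H} {x : Letter T R H}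
    (hp : G.IsPath u (p ++ x :: q) v) (hx : IsTrain x) :
    ∃ w w' : V, G.IsPath u p (Sum.inl w) ∧ G.IsPath (Sum.inl w) [x] (Sum.inl w') ∧
      G.IsPath (Sum.inl w') q v := by
  obtain ⟨w, h₁, h₂⟩ := isPath_append.1 hp
  obtain ⟨a, ha⟩ := exists_init_eq_inl (G := G) hx.ne_half
  obtain ⟨b, hb⟩ := exists_term_eq_inl (G := G) hx.ne_half
  have : w = Sum.inl a := by rw [← ha]; exact h₂.1.symm
  subst this
  exact ⟨a, b, h₁, ⟨ha, hb⟩, by rw [← hb]; exact h₂.2⟩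

end Graph1

open Graph1

@[simp] theorem invRev_auxWord (h h' : H) :
    invRev (auxWord h h' : Word T R H) = auxWord h' h := by
  simp [auxWord, invRev]

theorem inX_auxWord (h h' : H) : InX (auxWord h h' : Word T R H) := by
  simp [InX, auxWord, IsTrain]

namespace Complex

variable {G : Complex V T R S H}

namespace Homotopic

theorem left {u v : V ⊕ S} {p q : Word T R H} (h : G.Homotopic u v p q) : G.IsPath u p v := h.1

theorem right {u v : V ⊕ S} {p q : Word T R H} (h : G.Homotopic u v p q) : G.IsPath u q v :=
  h.2.1

theorem refl {u v : V ⊕ S} {p : Word T R H} (h : G.IsPath u p v) : G.Homotopic u v p p :=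
  ⟨h, h, Relation.EqvGen.refl _⟩

theorem symm {u v : V ⊕ S} {p q : Word T R H} (h : G.Homotopic u v p q) :
    G.Homotopic u v q p := ⟨h.2.1, h.1, h.2.2.symm⟩

theorem trans {u v : V ⊕ S} {p q r : Word T R H} (h : G.Homotopic u v p q)
    (h' : G.Homotopic u v q r) : G.Homotopic u v p r :=
  ⟨h.1, h'.2.1, h.2.2.trans _ _ _ h'.2.2⟩

theorem of_move {u v : V ⊕ S} {p q : Word T R H} (hp : G.IsPath u p v) (hq : G.IsPath u q v)
    (h : G.Move p q) : G.Homotopic u v p q := ⟨hp, hq, Relation.EqvGen.rel _ _ ⟨hp, hq, h⟩⟩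

/-- To transport homotopies along a map of words, it suffices to transport elementary
homotopies. -/
theorem map {u v u' v' : V ⊕ S} {F : Word T R H → Word T R H}
    (hF : ∀ p q, G.IsPath u p v → G.IsPath u q v → G.Move p q →
      G.Homotopic u' v' (F p) (F q))
    (hP : ∀ p, G.IsPath u p v → G.IsPath u' (F p) v')
    {p q : Word T R H} (h : G.Homotopic u v p q) : G.Homotopic u' v' (F p) (F q) := by
  refine ⟨hP _ h.1, hP _ h.2.1, ?_⟩
  have h3 := h.2.2
  clear h
  induction h3 with
  | rel x y hxy => exact (hF x y hxy.1 hxy.2.1 hxy.2.2).2.2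
  | refl x => exact Relation.EqvGen.refl _
  | symm x y _ ih => exact ih.symm
  | trans x y z _ _ ih₁ ih₂ => exact ih₁.trans _ _ _ ih₂

theorem append_left {u v w : V ⊕ S} {p q r : Word T R H} (hr : G.IsPath u r v)
    (h : G.Homotopic v w p q) : G.Homotopic u w (r ++ p) (r ++ q) := by
  refine map (F := fun p => r ++ p) (fun p q hp hq hm => of_move (hr.append hp) (hr.append hq) ?_)
    (fun p hp => hr.append hp) h
  cases hm with
  | cancel a x b => simpa using Move.cancel (r ++ a) x b
  | push a k k' b hk => simpa using Move.push (r ++ a) k k' b hk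

theorem append_right {u v w : V ⊕ S} {p q r : Word T R H} (h : G.Homotopic u v p q)
    (hr : G.IsPath v r w) : G.Homotopic u w (p ++ r) (q ++ r) := by
  refine map (F := fun p => p ++ r) (fun p q hp hq hm => of_move (hp.append hr) (hq.append hr) ?_)
    (fun p hp => hp.append hr) h
  cases hm with
  | cancel a x b => simpa using Move.cancel a x (b ++ r)
  | push a k k' b hk => simpa using Move.push a k k' (b ++ r) hk

theorem append {u v w : V ⊕ S} {p q p' q' : Word T R H} (h : G.Homotopic u v p p')
    (h' : G.Homotopic v w q q') : G.Homotopic u w (p ++ q) (p' ++ q') :=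
  (h.append_right h'.left).trans (h'.append_left h.right)

theorem of_red {u v : V ⊕ S} {p q : Word T R H} (hp : G.IsPath u p v)
    (h : FreeGroup.Red p q) : G.Homotopic u v p q := by
  induction h with
  | refl => exact refl hp
  | tail hb hs ih =>
    refine ih.trans (of_move ih.right (ih.right.red (Relation.ReflTransGen.single hs)) ?_)
    cases hs with
    | @not a b x c => exact Move.cancel a (x, c) b

theorem tighten {u v : V ⊕ S} {p : Word T R H} (hp : G.IsPath u p v) :
    G.Homotopic u v p (tighten p) := of_red hp (@FreeGroup.reduce.red _ p (Classical.decEq _))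

/-- Paths which are homotopic in the graph `G¹` are homotopic in `G²`. -/
theorem of_mk {u v : V ⊕ S} {p q : Word T R H} (hp : G.IsPath u p v) (hq : G.IsPath u q v)
    (h : FreeGroup.mk p = FreeGroup.mk q) : G.Homotopic u v p q :=
  (tighten hp).trans (tighten_congr h ▸ (tighten hq).symm)

theorem invRev {u v : V ⊕ S} {p q : Word T R H} (h : G.Homotopic u v p q) :
    G.Homotopic v u (invRev p) (invRev q) := by
  refine map (F := FreeGroup.invRev)
    (fun p q hp hq hm => of_move hp.invRev hq.invRev ?_) (fun p hp => hp.invRev) h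
  cases hm with
  | cancel a x b =>
    simpa [FreeGroup.invRev_append, invRev_cons_rev] using
      Move.cancel (FreeGroup.invRev b) x (FreeGroup.invRev a)
  | push a k k' b hk =>
    rw [FreeGroup.invRev_append, FreeGroup.invRev_append, FreeGroup.invRev_append,
      FreeGroup.invRev_append, invRev_auxWord, ← G.face_rev _ _ hk, List.append_assoc,
      List.append_assoc]
    exact Move.push _ _ _ _ hk.symm

theorem aux_face {h h' : H} (hh : G.IsAux h h') :
    G.Homotopic (Sum.inl (G.foot h)) (Sum.inl (G.foot h')) (auxWord h h') (G.face h h') := by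
  refine of_move (isPath_auxWord hh.2) (G.face_path _ _ hh) ?_
  simpa using Move.push [] h h' [] hh

theorem cancel_left {u v w : V ⊕ S} {p q r : Word T R H} (hr : G.IsPath u r v)
    (hp : G.IsPath v p w) (hq : G.IsPath v q w) (h : G.Homotopic u w (r ++ p) (r ++ q)) :
    G.Homotopic v w p q := by
  have key : ∀ s, G.IsPath v s w → G.Homotopic v w s (FreeGroup.invRev r ++ (r ++ s)) :=
    fun s hs => of_mk hs (hr.invRev.append (hr.append hs)) (by
      simp only [mk_append, mk_invRev]; group)
  exact ((key p hp).trans (h.append_left hr.invRev)).trans (key q hq).symm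

theorem cancel_right {u v w : V ⊕ S} {p q r : Word T R H} (hr : G.IsPath v r w)
    (hp : G.IsPath u p v) (hq : G.IsPath u q v) (h : G.Homotopic u w (p ++ r) (q ++ r)) :
    G.Homotopic u v p q := by
  have key : ∀ s, G.IsPath u s v → G.Homotopic u v s ((s ++ r) ++ FreeGroup.invRev r) :=
    fun s hs => of_mk hs ((hs.append hr).append hr.invRev) (by
      simp only [mk_append, mk_invRev]; group)
  exact ((key p hp).trans (h.append_right hr.invRev)).trans (key q hq).symm

end Homotopic

/-! ### The retraction onto `Γ` -/

/-- The building blocks of paths between vertices of `Γ`: edges of `Γ`, and pairs of half-edges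
with the same auxiliary vertex. Degenerate pairs, which form a backtracking at the auxiliary
vertex, are allowed. -/
def IsBlock (G : Complex V T R S H) : Letter T R H ⊕ (H × H) → Prop
  | Sum.inl x => ∀ h, x.1 ≠ Edge.half h
  | Sum.inr (h, h') => G.star h = G.star h'

theorem IsBlock.exists_path {β : Letter T R H ⊕ (H × H)} (hβ : G.IsBlock β) :
    ∃ u v : V, G.IsPath (Sum.inl u) (blockPath β) (Sum.inl v) := by
  rcases β with x | ⟨h, h'⟩
  · obtain ⟨a, ha⟩ := exists_init_eq_inl (G := G.toGraph1) hβ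
    obtain ⟨b, hb⟩ := exists_term_eq_inl (G := G.toGraph1) hβ
    exact ⟨a, b, ha, hb⟩
  · exact ⟨_, _, isPath_auxWord hβ⟩

theorem blockPath_ne_nil (β : Letter T R H ⊕ (H × H)) : blockPath β ≠ [] := by
  rcases β with x | ⟨h, h'⟩ <;> simp [blockPath, auxWord]

/-- The first block of a non-trivial path between vertices of `Γ`. -/
theorem exists_block_append {u v : V} {p : Word T R H} (hp : G.IsPath (Sum.inl u) p (Sum.inl v))
    (hne : p ≠ []) : ∃ (β : Letter T R H ⊕ (H × H)) (q : Word T R H) (w : V), G.IsBlock β ∧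
      p = blockPath β ++ q ∧ G.IsPath (Sum.inl u) (blockPath β) (Sum.inl w) ∧
      G.IsPath (Sum.inl w) q (Sum.inl v) := by
  cases p with
  | nil => exact absurd rfl hne
  | cons x p =>
    by_cases hx : ∀ h, x.1 ≠ Edge.half h
    · obtain ⟨w, hw⟩ := exists_term_eq_inl (G := G.toGraph1) hx
      refine ⟨Sum.inl x, p, w, hx, rfl, ⟨hp.1, hw⟩, ?_⟩
      rw [← hw]; exact hp.2
    · push Not at hx
      obtain ⟨h, hx⟩ := hx
      obtain ⟨e, b⟩ := x
      simp only at hx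
      subst hx
      cases b with
      | true => exact absurd hp.1 (by simp [init, src])
      | false =>
        have h2 := hp.2
        simp only [term, src, Bool.false_eq_true, if_false] at h2
        cases p with
        | nil => exact absurd h2 (by simp)
        | cons y p =>
          obtain ⟨e', b'⟩ := y
          have h3 := h2.1
          cases b' with
          | false => cases e' <;> simp [init, tgt] at h3
          | true =>
            cases e' with
            | train e => simp [init, src] at h3
            | low e => simp [init, src] at h3
            | half h' =>
              have h4 : G.star h' = G.star h := by simpa [init, src] using h3
              refine ⟨Sum.inr (h, h'), p, G.foot h', h4.symm, rfl, ?_, h2.2⟩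
              have hu : u = G.foot h := by
                have := hp.1
                simpa [init, tgt] using this.symm
              subst hu
              exact isPath_auxWord h4.symm

theorem exists_blocks {u v : V} {p : Word T R H} (hp : G.IsPath (Sum.inl u) p (Sum.inl v)) :
    ∃ bs : List (Letter T R H ⊕ (H × H)), (∀ β ∈ bs, G.IsBlock β) ∧
      p = bs.flatMap blockPath := by
  induction hn : p.length using Nat.strong_induction_on generalizing u p with
  | _ n ih =>
    by_cases hne : p = []
    · exact ⟨[], by simp, by simp [hne]⟩
    · obtain ⟨β, q, w, hβ, rfl, -, h2⟩ := exists_block_append hp hne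
      have hlen : q.length < n := by
        have := List.length_pos_iff.2 (blockPath_ne_nil β)
        simp only [List.length_append] at hn
        omega
      obtain ⟨bs, hbs, rfl⟩ := ih _ hlen h2 rfl
      exact ⟨β :: bs, List.forall_mem_cons.2 ⟨hβ, hbs⟩, by simp⟩

@[simp] theorem rhat_nil : G.rhat [] = [] := by simp [rhat]

theorem rhat_cons {x : Letter T R H} (hx : ∀ h, x.1 ≠ Edge.half h) (p : Word T R H) :
    G.rhat (x :: p) = x :: G.rhat p := by
  obtain ⟨e, b⟩ := x
  rw [rhat]
  intro h h' p' he
  exact absurd (congrArg Prod.fst he) (hx h)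

theorem rhat_auxWord_append (h h' : H) (p : Word T R H) :
    G.rhat (auxWord h h' ++ p) = G.face h h' ++ G.rhat p := by
  simp [auxWord, rhat]

theorem rhat_auxWord (h h' : H) : G.rhat (auxWord h h') = G.face h h' := by
  simp [auxWord, rhat]

theorem rhat_blockPath_append {β : Letter T R H ⊕ (H × H)} (hβ : G.IsBlock β) (p : Word T R H) :
    G.rhat (blockPath β ++ p) = G.rhat (blockPath β) ++ G.rhat p := by
  rcases β with x | ⟨h, h'⟩
  · simp [blockPath, rhat_cons hβ]
  · simp [blockPath, rhat_auxWord_append, rhat_auxWord]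

theorem rhat_append {u v : V} {p : Word T R H} (hp : G.IsPath (Sum.inl u) p (Sum.inl v))
    (q : Word T R H) : G.rhat (p ++ q) = G.rhat p ++ G.rhat q := by
  obtain ⟨bs, hbs, rfl⟩ := exists_blocks hp
  clear hp
  induction bs with
  | nil => simp
  | cons β bs ih =>
    rw [List.flatMap_cons, List.append_assoc, rhat_blockPath_append (hbs β (by simp)),
      rhat_blockPath_append (hbs β (by simp)), ih (fun b hb => hbs b (by simp [hb])),
      List.append_assoc]

theorem homotopic_rhat {u v : V} {p : Word T R H} (hp : G.IsPath (Sum.inl u) p (Sum.inl v)) :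
    G.Homotopic (Sum.inl u) (Sum.inl v) p (G.rhat p) := by
  induction hn : p.length using Nat.strong_induction_on generalizing u p with
  | _ n ih =>
    by_cases hne : p = []
    · subst hne; simpa using Homotopic.refl hp
    · obtain ⟨β, q, w, hβ, rfl, h1, h2⟩ := exists_block_append hp hne
      have hlen : q.length < n := by
        have := List.length_pos_iff.2 (blockPath_ne_nil β)
        simp only [List.length_append] at hn
        omega
      rw [rhat_blockPath_append hβ]
      refine Homotopic.append ?_ (ih _ hlen h2 rfl)
      rcases β with x | ⟨h, h'⟩
      · simpa [blockPath, rhat_cons hβ] using Homotopic.refl h1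
      · simp only [blockPath, rhat_auxWord] at h1 ⊢
        have e1 : Sum.inl u = Sum.inl (G.foot h) :=
          h1.start_unique (isPath_auxWord (G := G.toGraph1) hβ) (by simp [auxWord])
        rw [e1] at h1 ⊢
        have e2 : Sum.inl w = Sum.inl (G.foot h') :=
          h1.end_unique (isPath_auxWord (G := G.toGraph1) hβ)
        rw [e2] at h1 ⊢
        by_cases hh : h = h'
        · subst hh
          rw [G.face_self]
          refine Homotopic.of_mk h1 rfl ?_
          have : (auxWord h h : Word T R H) = [(Edge.half h, false)] ++
            invRev [(Edge.half h, false)] := rfl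
          rw [this, mk_append, mk_invRev, mul_inv_cancel, mk_nil]
        · exact Homotopic.aux_face ⟨hh, hβ⟩

theorem isPath_iterate_rhat {u v : V} {p : Word T R H}
    (hp : G.IsPath (Sum.inl u) p (Sum.inl v)) (k : ℕ) :
    G.Homotopic (Sum.inl u) (Sum.inl v) p (G.rhat^[k] p) := by
  induction k with
  | zero => exact Homotopic.refl hp
  | succ k ih =>
    rw [Function.iterate_succ_apply']
    exact ih.trans (homotopic_rhat ih.right)

theorem iterate_rhat_append {u v : V} {p : Word T R H}
    (hp : G.IsPath (Sum.inl u) p (Sum.inl v)) (q : Word T R H) (k : ℕ) :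
    G.rhat^[k] (p ++ q) = G.rhat^[k] p ++ G.rhat^[k] q := by
  induction k with
  | zero => rfl
  | succ k ih =>
    rw [Function.iterate_succ_apply', Function.iterate_succ_apply', Function.iterate_succ_apply',
      ih, rhat_append (isPath_iterate_rhat hp k).right]

theorem homotopic_retr {u v : V} {p : Word T R H} (hp : G.IsPath (Sum.inl u) p (Sum.inl v)) :
    G.Homotopic (Sum.inl u) (Sum.inl v) p (G.retr p) := isPath_iterate_rhat hp _

theorem retr_append {u v : V} {p : Word T R H}
    (hp : G.IsPath (Sum.inl u) p (Sum.inl v)) (q : Word T R H) :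
    G.retr (p ++ q) = G.retr p ++ G.retr q := iterate_rhat_append hp q _

@[simp] theorem iterate_rhat_nil (k : ℕ) : G.rhat^[k] [] = [] := by
  induction k with
  | zero => rfl
  | succ k ih => rw [Function.iterate_succ_apply', ih, rhat_nil]

@[simp] theorem retr_nil : G.retr [] = [] := iterate_rhat_nil _

theorem rhat_of_inΓ {p : Word T R H} (hp : InΓ p) : G.rhat p = p := by
  induction p with
  | nil => simp
  | cons x p ih =>
    rw [rhat_cons (hp x (by simp)), ih (fun y hy => hp y (by simp [hy]))]

theorem retr_of_inΓ {p : Word T R H} (hp : InΓ p) : G.retr p = p :=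
  Function.iterate_fixed (rhat_of_inΓ hp) _

theorem blockRetr_eq {β : Letter T R H ⊕ (H × H)} (hβ : G.IsBlock β) :
    G.blockRetr β = G.retr (blockPath β) := by
  rcases β with x | ⟨h, h'⟩
  · exact (retr_of_inΓ (fun y hy => by rw [List.mem_singleton.1 hy]; exact hβ)).symm
  · rfl

theorem retr_blocks {u v : V} {bs : List (Letter T R H ⊕ (H × H))}
    (hp : G.IsPath (Sum.inl u) (bs.flatMap blockPath) (Sum.inl v)) (hbs : ∀ β ∈ bs, G.IsBlock β) :
    G.retr (bs.flatMap blockPath) = bs.flatMap G.blockRetr := by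
  induction bs generalizing u with
  | nil => simp
  | cons β bs ih =>
    have hβ := hbs β (by simp)
    rw [List.flatMap_cons] at hp ⊢
    obtain ⟨w, h1, h2⟩ := isPath_append.1 hp
    obtain ⟨u', w', h3⟩ := hβ.exists_path
    have e1 := h1.start_unique h3 (blockPath_ne_nil β)
    rw [e1] at h1
    have e2 := h1.end_unique h3
    subst e2
    rw [retr_append h1, ih h2 (fun b hb => hbs b (by simp [hb])),
      List.flatMap_cons, blockRetr_eq hβ]

theorem rhat_invRev {u v : V} {p : Word T R H} (hp : G.IsPath (Sum.inl u) p (Sum.inl v)) :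
    G.rhat (invRev p) = invRev (G.rhat p) := by
  induction hn : p.length using Nat.strong_induction_on generalizing u p with
  | _ n ih =>
    by_cases hne : p = []
    · subst hne; simp
    · obtain ⟨β, q, w, hβ, rfl, h1, h2⟩ := exists_block_append hp hne
      have hlen : q.length < n := by
        have := List.length_pos_iff.2 (blockPath_ne_nil β)
        simp only [List.length_append] at hn
        omega
      rw [rhat_blockPath_append hβ, FreeGroup.invRev_append, rhat_append h2.invRev,
        FreeGroup.invRev_append, ih _ hlen h2 rfl]
      congr 1
      rcases β with x | ⟨h, h'⟩
      · have hx' : ∀ h, (rev x).1 ≠ Edge.half h := hβ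
        simp [blockPath, rhat_cons hβ, rhat_cons hx']
      · simp only [blockPath, rhat_auxWord, invRev_auxWord]
        by_cases hh : h = h'
        · subst hh; simp [G.face_self]
        · exact G.face_rev _ _ ⟨hh, hβ⟩

theorem retr_invRev {u v : V} {p : Word T R H} (hp : G.IsPath (Sum.inl u) p (Sum.inl v)) :
    G.retr (invRev p) = invRev (G.retr p) := by
  unfold retr
  induction G.depth with
  | zero => rfl
  | succ k ih =>
    rw [Function.iterate_succ_apply', Function.iterate_succ_apply', ih,
      rhat_invRev (isPath_iterate_rhat hp k).right]

end Complex

/-! ### The action of the map on paths -/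

namespace SelfMap

variable {G : Complex V T R S H} {f : SelfMap G}

/-- The map induced by `f` on all vertices. -/
def onVertex (f : SelfMap G) : V ⊕ S → V ⊕ S := Sum.elim (fun v => Sum.inl (f.onV v)) f.onS

theorem isPath_mapWord {u v : V ⊕ S} {p : Word T R H} (hp : G.IsPath u p v) :
    G.IsPath (f.onVertex u) (mapWord f.onE p) (f.onVertex v) := by
  induction p generalizing u with
  | nil => rw [isPath_nil] at hp; subst hp; rfl
  | cons x p ih =>
    rw [mapWord_cons]
    refine Graph1.IsPath.append ?_ (ih hp.2)
    rw [← hp.1]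
    have h : G.IsPath (f.onVertex (G.src x.1)) (f.onE x.1) (f.onVertex (G.tgt x.1)) :=
      f.onE_path x.1
    obtain ⟨e, b⟩ := x
    cases b
    · simpa [mapWord, init, term] using h.invRev
    · simpa [mapWord, init, term] using h

theorem homotopic_mapWord {u v : V ⊕ S} {p q : Word T R H} (h : G.Homotopic u v p q) :
    G.Homotopic (f.onVertex u) (f.onVertex v) (mapWord f.onE p) (mapWord f.onE q) := by
  refine Complex.Homotopic.map (F := mapWord f.onE) ?_ (fun p hp => isPath_mapWord hp) h
  intro p q hp hq hm
  cases hm with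
  | cancel a x b =>
    refine Complex.Homotopic.of_mk (isPath_mapWord hp) (isPath_mapWord hq) (mk_mapWord_congr _ ?_)
    exact (@FreeGroup.reduce.exact _ _ _ (Classical.decEq _)
      (@FreeGroup.reduce.eq_of_red _ _ _ (Classical.decEq _)
        (Relation.ReflTransGen.single (FreeGroup.Red.Step.not (x := x.1) (b := x.2)))))
  | push a k k' b hk =>
    obtain ⟨w, h1, h2⟩ := isPath_append.1 hp
    obtain ⟨w', h3, h4⟩ := isPath_append.1 h2
    have e1 : w = Sum.inl (G.foot k) :=
      h3.start_unique (isPath_auxWord (G := G.toGraph1) hk.2) (by simp [auxWord])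
    subst e1
    have e2 := h3.end_unique (isPath_auxWord (G := G.toGraph1) hk.2)
    subst e2
    simp only [mapWord_append]
    exact ((f.map_face k k' hk).append_right (isPath_mapWord h4)).append_left (isPath_mapWord h1)

theorem iter_succ (t : ℕ) (p : Word T R H) : f.iter (t + 1) p = mapWord f.onE (f.iter t p) :=
  Function.iterate_succ_apply' _ _ _

@[simp] theorem iter_zero (p : Word T R H) : f.iter 0 p = p := rfl

theorem iter_add (s t : ℕ) (p : Word T R H) : f.iter (s + t) p = f.iter s (f.iter t p) :=
  Function.iterate_add_apply _ _ _ _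

@[simp] theorem iter_nil (t : ℕ) : f.iter t [] = [] := by
  induction t with
  | zero => rfl
  | succ t ih => rw [iter_succ, ih, mapWord_nil]

@[simp] theorem iter_append (t : ℕ) (p q : Word T R H) :
    f.iter t (p ++ q) = f.iter t p ++ f.iter t q := by
  induction t with
  | zero => rfl
  | succ t ih => rw [iter_succ, iter_succ, iter_succ, ih, mapWord_append]

theorem iter_cons (t : ℕ) (x : Letter T R H) (q : Word T R H) :
    f.iter t (x :: q) = f.iter t [x] ++ f.iter t q := by
  rw [← iter_append]; rfl

theorem iter_invRev (t : ℕ) (p : Word T R H) :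
    f.iter t (invRev p) = invRev (f.iter t p) := by
  induction t with
  | zero => rfl
  | succ t ih => rw [iter_succ, iter_succ, ih, mapWord_invRev]

theorem mk_iter_congr (t : ℕ) {p q : Word T R H} (h : FreeGroup.mk p = FreeGroup.mk q) :
    FreeGroup.mk (f.iter t p) = FreeGroup.mk (f.iter t q) := by
  induction t with
  | zero => exact h
  | succ t ih => rw [iter_succ, iter_succ]; exact mk_mapWord_congr _ ih

theorem homotopic_iter (t : ℕ) {u v : V ⊕ S} {p q : Word T R H} (h : G.Homotopic u v p q) :
    G.Homotopic (f.onVertex^[t] u) (f.onVertex^[t] v) (f.iter t p) (f.iter t q) := by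
  induction t with
  | zero => exact h
  | succ t ih =>
    rw [Function.iterate_succ_apply', Function.iterate_succ_apply', iter_succ, iter_succ]
    exact homotopic_mapWord ih

theorem isPath_iter (t : ℕ) {u v : V ⊕ S} {p : Word T R H} (h : G.IsPath u p v) :
    G.IsPath (f.onVertex^[t] u) (f.iter t p) (f.onVertex^[t] v) :=
  (homotopic_iter t (Complex.Homotopic.refl h)).left

theorem iterate_onVertex_inl (t : ℕ) (v : V) :
    f.onVertex^[t] (Sum.inl v) = Sum.inl (f.onV^[t] v) := by
  induction t with
  | zero => rfl
  | succ t ih => rw [Function.iterate_succ_apply', ih, Function.iterate_succ_apply']; rfl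

theorem isPath_iter_inl (t : ℕ) {u v : V} {p : Word T R H}
    (h : G.IsPath (Sum.inl u) p (Sum.inl v)) :
    G.IsPath (Sum.inl (f.onV^[t] u)) (f.iter t p) (Sum.inl (f.onV^[t] v)) := by
  rw [← iterate_onVertex_inl, ← iterate_onVertex_inl]
  exact isPath_iter t h

theorem homotopic_iter_inl (t : ℕ) {u v : V} {p q : Word T R H}
    (h : G.Homotopic (Sum.inl u) (Sum.inl v) p q) :
    G.Homotopic (Sum.inl (f.onV^[t] u)) (Sum.inl (f.onV^[t] v)) (f.iter t p) (f.iter t q) := by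
  rw [← iterate_onVertex_inl, ← iterate_onVertex_inl]
  exact homotopic_iter t h

theorem inX_mapWord {p : Word T R H} (h : InX p) : InX (mapWord f.onE p) := by
  induction p with
  | nil => simp
  | cons x p ih =>
    rw [inX_cons] at h
    rw [mapWord_cons, inX_append]
    refine ⟨?_, ih h.2⟩
    obtain ⟨e, b⟩ := x
    have hE : InX (f.onE e) := by
      cases e with
      | train e => exact absurd ⟨e, rfl⟩ h.1
      | low e => exact f.low_inX e
      | half k => exact f.half_inX k
    cases b
    · simpa [mapWord] using inX_invRev.2 hE
    · simpa [mapWord] using hE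

theorem inX_iter (t : ℕ) {p : Word T R H} (h : InX p) : InX (f.iter t p) := by
  induction t with
  | zero => exact h
  | succ t ih => rw [iter_succ]; exact inX_mapWord ih

end SelfMap

open BetaTrainTrack.Graph1 BetaTrainTrack.Complex

/-! ### Relatively reduced paths -/

theorem append_cons_eq_append {a z p c : Word T R H} {y : Letter T R H}
    (h : a ++ y :: z = p ++ c) (hy : IsTrain y) (hc : InX c) :
    ∃ z₀, z = z₀ ++ c ∧ p = a ++ y :: z₀ := by
  rcases List.append_eq_append_iff.1 h with ⟨r, rfl, hr⟩ | ⟨r, rfl, hr⟩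
  · cases r with
    | nil =>
      simp only [List.nil_append] at hr
      rw [← hr, inX_cons] at hc
      exact absurd hy hc.1
    | cons x r =>
      simp only [List.cons_append, List.cons.injEq] at hr
      obtain ⟨rfl, rfl⟩ := hr
      exact ⟨r, rfl, by simp⟩
  · rw [hr, inX_append, inX_cons] at hc
    exact absurd hy hc.2.1

namespace Complex

variable {G : Complex V T R S H}

theorem RelReduced.infix {p q : Word T R H} (h : G.RelReduced q) (hp : p <:+: q) :
    G.RelReduced p := fun σ hσ => h σ (hσ.trans hp)

theorem RelReduced.invRev {p : Word T R H} (h : G.RelReduced p) : G.RelReduced (invRev p) := by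
  rintro σ ⟨a, b, hab⟩ u v ⟨q, hq, hσ⟩
  rw [← inX_invRev]
  refine h _ ⟨FreeGroup.invRev b, FreeGroup.invRev a, ?_⟩ v u
    ⟨FreeGroup.invRev q, inX_invRev.2 hq, hσ.invRev⟩
  rw [← FreeGroup.invRev_invRev (L₁ := p), ← hab]
  simp [FreeGroup.invRev_append]

/-- When a relatively reduced path is tightened, only edges of the relative part cancel. -/
theorem RelReduced.inX_of_cancel {w₁ w₂ p c q : Word T R H} {u v : V ⊕ S}
    (hw : G.RelReduced (w₁ ++ w₂)) (hp : G.IsPath u (w₁ ++ w₂) v)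
    (h₁ : tighten w₁ = p ++ c) (h₂ : tighten w₂ = FreeGroup.invRev c ++ q) : InX c := by
  obtain ⟨x₁, x₂, rfl, -, hx⟩ := exists_split_of_tighten h₁
  obtain ⟨y₁, y₂, rfl, hy, -⟩ := exists_split_of_tighten h₂
  have hp' : G.IsPath u (x₁ ++ ((x₂ ++ y₁) ++ y₂)) v := by simpa using hp
  obtain ⟨a, -, h3⟩ := isPath_append.1 hp'
  obtain ⟨b, h4, -⟩ := isPath_append.1 h3
  have hmk : FreeGroup.mk (x₂ ++ y₁) = FreeGroup.mk [] := by
    rw [mk_append, ← mk_tighten x₂, ← mk_tighten y₁, hx, hy, mk_invRev, mul_inv_cancel, mk_nil]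
  have h5 : G.IsPath a [] b := by
    have := h4.tighten
    rwa [tighten_congr hmk, tighten_nil] at this
  have h6 := hw (x₂ ++ y₁) ⟨x₁, y₂, by simp⟩ a b ⟨[], inX_nil, Homotopic.of_mk h4 h5 hmk⟩
  rw [← hx]
  exact (inX_append.1 h6).1.tighten

/-- Tightening a relatively reduced path does not change its relative length. -/
theorem RelReduced.relLength_tighten {w : Word T R H} {u v : V ⊕ S} (hw : G.RelReduced w)
    (hp : G.IsPath u w v) : relLength (tighten w) = relLength w := by
  induction w generalizing u with
  | nil => simp
  | cons x w ih =>
    have hw' : G.RelReduced w := hw.infix ⟨[x], [], by simp⟩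
    have ih' := ih hw' hp.2
    obtain ⟨p, c, q, hpc, hcq, hred⟩ :=
      exists_cancellation (FreeGroup.IsReduced.singleton (a := x)) (isReduced_tighten w)
    have hc : InX c := RelReduced.inX_of_cancel (w₁ := [x]) (w₂ := w) hw hp
      (by rw [FreeGroup.IsReduced.singleton.tighten_eq, hpc]) hcq
    have ht : tighten (x :: w) = p ++ q := by
      have : tighten ([x] ++ tighten w) = p ++ q := tighten_eq_of_cancellation hpc hcq hred
      rw [← this]
      exact tighten_congr (by rw [mk_append, mk_tighten, ← mk_append]; rfl)
    have h0 : relLength c = 0 := relLength_eq_zero.2 hc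
    have e1 : relLength [x] = relLength p + relLength c := by rw [hpc, relLength_append]
    have e2 : relLength (tighten w) = relLength c + relLength q := by
      rw [hcq, relLength_append, relLength_invRev]
    rw [ht, relLength_cons, relLength_append]
    omega

/-- Extending a relatively reduced path does not affect the tightened path up to its last edge in
the train track part. -/
theorem RelReduced.tighten_append {w₁ w₂ a z : Word T R H} {y : Letter T R H} {u v : V ⊕ S}
    (hw : G.RelReduced (w₁ ++ w₂)) (hp : G.IsPath u (w₁ ++ w₂) v)
    (h : tighten w₁ = a ++ y :: z) (hy : IsTrain y) :
    ∃ z', tighten (w₁ ++ w₂) = a ++ y :: z' := by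
  obtain ⟨p, c, q, hpc, hcq, hred⟩ :=
    exists_cancellation (isReduced_tighten w₁) (isReduced_tighten w₂)
  have hc := RelReduced.inX_of_cancel hw hp hpc hcq
  obtain ⟨z₀, -, rfl⟩ := append_cons_eq_append (h.symm.trans hpc) hy hc
  refine ⟨z₀ ++ q, ?_⟩
  rw [← tighten_append_tighten, tighten_eq_of_cancellation hpc hcq hred]
  simp

/-- The mirror image of `RelReduced.tighten_append`. -/
theorem RelReduced.tighten_append' {w₁ w₂ a z : Word T R H} {y : Letter T R H} {u v : V ⊕ S}
    (hw : G.RelReduced (w₁ ++ w₂)) (hp : G.IsPath u (w₁ ++ w₂) v)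
    (h : tighten w₂ = z ++ y :: a) (hy : IsTrain y) :
    ∃ z', tighten (w₁ ++ w₂) = z' ++ y :: a := by
  have h1 : G.RelReduced (FreeGroup.invRev w₂ ++ FreeGroup.invRev w₁) := by
    rw [← FreeGroup.invRev_append]; exact hw.invRev
  have h2 : G.IsPath v (FreeGroup.invRev w₂ ++ FreeGroup.invRev w₁) u := by
    rw [← FreeGroup.invRev_append]; exact hp.invRev
  obtain ⟨z', hz'⟩ := h1.tighten_append h2 (a := FreeGroup.invRev a) (y := rev y)
    (z := FreeGroup.invRev z) (by rw [tighten_invRev, h]; simp [FreeGroup.invRev_append,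
      invRev_cons_rev]) hy
  refine ⟨FreeGroup.invRev z', ?_⟩
  rw [← FreeGroup.invRev_append, tighten_invRev] at hz'
  rw [← FreeGroup.invRev_invRev (L₁ := tighten (w₁ ++ w₂)), hz']
  simp [FreeGroup.invRev_append, invRev_cons_rev]

/-! ### Blocks of reduced paths -/

/-- The building blocks of reduced paths between vertices of `Γ`: edges of `Γ` and auxiliary
edges. -/
def IsProperBlock (G : Complex V T R S H) : Letter T R H ⊕ (H × H) → Prop
  | Sum.inl x => ∀ h, x.1 ≠ Edge.half h
  | Sum.inr (h, h') => G.IsAux h h'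

theorem IsProperBlock.isBlock {β : Letter T R H ⊕ (H × H)} (hβ : G.IsProperBlock β) :
    G.IsBlock β := by
  rcases β with x | ⟨h, h'⟩
  · exact hβ
  · exact hβ.2

theorem IsBlock.isProperBlock {β : Letter T R H ⊕ (H × H)} (hβ : G.IsBlock β)
    (hr : IsReduced (blockPath β)) : G.IsProperBlock β := by
  rcases β with x | ⟨h, h'⟩
  · exact hβ
  · refine ⟨?_, hβ⟩
    rintro rfl
    exact FreeGroup.IsReduced.ne_rev (a := []) (b := []) hr rfl

theorem exists_properBlocks {u v : V} {p : Word T R H}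
    (hp : G.IsPath (Sum.inl u) p (Sum.inl v)) (hr : IsReduced p) :
    ∃ bs : List (Letter T R H ⊕ (H × H)), (∀ β ∈ bs, G.IsProperBlock β) ∧
      p = bs.flatMap blockPath := by
  obtain ⟨bs, hbs, rfl⟩ := exists_blocks hp
  refine ⟨bs, fun β hβ => (hbs β hβ).isProperBlock (hr.infix ?_), rfl⟩
  obtain ⟨b₁, b₂, rfl⟩ := List.append_of_mem hβ
  exact ⟨b₁.flatMap blockPath, b₂.flatMap blockPath, by simp⟩

end Complex

namespace IsBetaTrainTrack

variable {G : Complex V T R S H} {f : SelfMap G} {n : ℕ}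
  {α : FreeGroup (Fin n) ≃* FreeGroup (Fin n)} {m : Marking G f n α}

/-! ### The Nielsen faces -/

theorem face_eq_cons (hf : IsBetaTrainTrack m) {h h' : H} (hh : G.IsAux h h') :
    ∃ x q, G.face h h' = x :: q ∧ IsTrain x := by
  obtain ⟨x, hx, hT⟩ := (hf.face_inp h h' hh).2.1
  exact ⟨x, _, List.eq_cons_of_mem_head? hx, hT⟩

theorem face_eq_append (hf : IsBetaTrainTrack m) {h h' : H} (hh : G.IsAux h h') :
    ∃ q x, G.face h h' = q ++ [x] ∧ IsTrain x := by
  obtain ⟨x, q, hx, hT⟩ := hf.face_eq_cons hh.symm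
  refine ⟨invRev q, rev x, ?_, hT⟩
  rw [G.face_rev _ _ hh.symm, hx, invRev_cons_rev]

theorem isTrain_of_face (hf : IsBetaTrainTrack m) {h h' : H} (hh : G.IsAux h h')
    {x : Letter T R H} {q : Word T R H} (hx : G.face h h' = x :: q) : IsTrain x := by
  obtain ⟨x', q', e, hT⟩ := hf.face_eq_cons hh
  rw [hx] at e
  obtain ⟨rfl, -⟩ := List.cons.inj e
  exact hT

theorem isReduced_face (hf : IsBetaTrainTrack m) {h h' : H} (hh : G.IsAux h h') :
    IsReduced (G.face h h') := (hf.face_inp h h' hh).1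

theorem depth_ne_zero (hf : IsBetaTrainTrack m) {h h' : H} (hh : G.IsAux h h') :
    G.depth ≠ 0 := by
  intro h0
  have := (hf.retr_aux h h' hh).1
  unfold retr at this
  rw [h0] at this
  exact this (Edge.half h, false) (by simp [auxWord]) h rfl

theorem iterate_rhat_cons {x : Letter T R H} (hx : ∀ h, x.1 ≠ Edge.half h) (q : Word T R H)
    (k : ℕ) : ∃ q', G.rhat^[k] (x :: q) = x :: q' := by
  induction k with
  | zero => exact ⟨q, rfl⟩
  | succ k ih =>
    obtain ⟨q', hq'⟩ := ih
    exact ⟨G.rhat q', by rw [Function.iterate_succ_apply', hq', rhat_cons hx]⟩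

/-- The pre-INP of an auxiliary edge starts with the same edge as the INP. -/
theorem retr_auxWord_eq_cons (hf : IsBetaTrainTrack m) {h h' : H} (hh : G.IsAux h h')
    {x : Letter T R H} {q : Word T R H} (hx : G.face h h' = x :: q) (hT : IsTrain x) :
    ∃ q', G.retr (auxWord h h') = x :: q' := by
  unfold retr
  obtain ⟨k, hk⟩ := Nat.exists_eq_succ_of_ne_zero (hf.depth_ne_zero hh)
  rw [hk, Function.iterate_succ_apply, rhat_auxWord, hx]
  exact iterate_rhat_cons hT.ne_half q k

theorem retr_auxWord_symm {h h' : H} (hh : G.IsAux h h') :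
    G.retr (auxWord h' h) = invRev (G.retr (auxWord h h')) := by
  rw [← invRev_auxWord, retr_invRev (isPath_auxWord hh.2)]

theorem retr_auxWord_eq_append (hf : IsBetaTrainTrack m) {h h' : H} (hh : G.IsAux h h')
    {x : Letter T R H} {q : Word T R H} (hx : G.face h h' = q ++ [x]) (hT : IsTrain x) :
    ∃ q', G.retr (auxWord h h') = q' ++ [x] := by
  obtain ⟨q', hq'⟩ := hf.retr_auxWord_eq_cons hh.symm (x := rev x) (q := invRev q)
    (by rw [G.face_rev _ _ hh, hx, invRev_append_singleton]) hT
  refine ⟨invRev q', ?_⟩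
  rw [retr_auxWord_symm hh.symm, hq', invRev_cons_rev, rev_rev]

/-- The retraction and its first stage do not change the initial edge of a block, and this edge
lies in the train track part unless the block is an edge of the relative part. -/
theorem block_first (hf : IsBetaTrainTrack m) {β : Letter T R H ⊕ (H × H)}
    (hβ : G.IsProperBlock β) : ∃ y q q', G.rhat (blockPath β) = y :: q ∧
      G.blockRetr β = y :: q' ∧ (IsTrain y ∨ β = Sum.inl y) := by
  rcases β with x | ⟨h, h'⟩
  · exact ⟨x, [], [], by simp [blockPath, rhat_cons hβ], rfl, Or.inr rfl⟩
  · obtain ⟨x, q, hx, hT⟩ := hf.face_eq_cons hβ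
    obtain ⟨q', hq'⟩ := hf.retr_auxWord_eq_cons hβ hx hT
    exact ⟨x, q, q', by simp [blockPath, rhat_auxWord, hx], hq', Or.inl hT⟩

theorem block_last (hf : IsBetaTrainTrack m) {β : Letter T R H ⊕ (H × H)}
    (hβ : G.IsProperBlock β) : ∃ y q q', G.rhat (blockPath β) = q ++ [y] ∧
      G.blockRetr β = q' ++ [y] ∧ (IsTrain y ∨ β = Sum.inl y) := by
  rcases β with x | ⟨h, h'⟩
  · exact ⟨x, [], [], by simp [blockPath, rhat_cons hβ], rfl, Or.inr rfl⟩
  · obtain ⟨q, x, hx, hT⟩ := hf.face_eq_append hβ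
    obtain ⟨q', hq'⟩ := hf.retr_auxWord_eq_append hβ hx hT
    exact ⟨x, q, q', by simp [blockPath, rhat_auxWord, hx], hq', Or.inl hT⟩

theorem isReduced_blockRetr (hf : IsBetaTrainTrack m) {β : Letter T R H ⊕ (H × H)}
    (hβ : G.IsProperBlock β) : IsReduced (G.blockRetr β) := by
  rcases β with x | ⟨h, h'⟩
  · exact FreeGroup.IsReduced.singleton
  · exact (hf.retr_aux h h' hβ).2

/-- The retraction maps paths between vertices of `Γ` to paths in `Γ`. -/
theorem inΓ_retr (hf : IsBetaTrainTrack m) {u v : V} {p : Word T R H}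
    (hp : G.IsPath (Sum.inl u) p (Sum.inl v)) : InΓ (G.retr p) := by
  obtain ⟨bs, hbs, rfl⟩ := exists_blocks hp
  rw [retr_blocks hp hbs]
  intro x hx
  obtain ⟨β, hβ, hxβ⟩ := List.mem_flatMap.1 hx
  have hb := hbs β hβ
  rcases β with y | ⟨h, h'⟩
  · rw [List.mem_singleton.1 hxβ]
    exact hb
  · by_cases hh : h = h'
    · subst hh
      obtain ⟨k, k', hk, -⟩ := G.exists_aux (G.star h)
      obtain ⟨d, hd⟩ := Nat.exists_eq_succ_of_ne_zero (hf.depth_ne_zero hk)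
      have : G.blockRetr (Sum.inr (h, h)) = ([] : Word T R H) := by
        show G.retr (auxWord h h) = []
        unfold retr
        rw [hd, Function.iterate_succ_apply, rhat_auxWord, G.face_self, iterate_rhat_nil]
      rw [this] at hxβ
      exact absurd hxβ (by simp)
    · exact (hf.retr_aux h h' ⟨hh, hb⟩).1 x hxβ

/-! ### Expansion -/

theorem not_inX_onE_train (hf : IsBetaTrainTrack m) (e : T) : ¬ InX (f.onE (Edge.train e)) := by
  intro h
  obtain ⟨t, ht, h2⟩ := hf.expanding e
  obtain ⟨k, rfl⟩ := Nat.exists_eq_add_of_le ht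
  have h3 : InX (f.iter (1 + k) [(Edge.train e, true)]) := by
    rw [add_comm, SelfMap.iter_add]
    refine SelfMap.inX_iter k ?_
    simpa [SelfMap.iter, mapWord] using h
  rw [relLength_eq_zero.2 h3] at h2
  omega

theorem one_le_relLength_mapWord (hf : IsBetaTrainTrack m) {x : Letter T R H} (hx : IsTrain x) :
    1 ≤ relLength (mapWord f.onE [x]) := by
  obtain ⟨e, b⟩ := x
  obtain ⟨e, rfl⟩ := hx
  have h : relLength (f.onE (Edge.train e)) ≠ 0 := fun h =>
    hf.not_inX_onE_train e (relLength_eq_zero.1 h)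
  cases b <;> simp [mapWord] <;> omega

theorem relLength_le_mapWord (hf : IsBetaTrainTrack m) (p : Word T R H) :
    relLength p ≤ relLength (mapWord f.onE p) := by
  induction p with
  | nil => simp
  | cons x p ih =>
    rw [mapWord_cons, relLength_append, relLength_cons]
    refine add_le_add ?_ ih
    by_cases hx : IsTrain x
    · rw [relLength_singleton_of_isTrain hx]
      exact hf.one_le_relLength_mapWord hx
    · rw [relLength_eq_zero.2 (by simpa [InX] using hx)]
      omega

theorem relLength_le_iter (hf : IsBetaTrainTrack m) (t : ℕ) (p : Word T R H) :
    relLength p ≤ relLength (f.iter t p) := by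
  induction t with
  | zero => exact le_rfl
  | succ t ih => rw [SelfMap.iter_succ]; exact ih.trans (hf.relLength_le_mapWord _)

theorem mul_relLength_le_iter {t c : ℕ}
    (h : ∀ e : T, c ≤ relLength (f.iter t [(Edge.train e, true)])) (p : Word T R H) :
    c * relLength p ≤ relLength (f.iter t p) := by
  induction p with
  | nil => simp
  | cons x p ih =>
    rw [SelfMap.iter_cons, relLength_append, relLength_cons, mul_add]
    refine add_le_add ?_ ih
    by_cases hx : IsTrain x
    · rw [relLength_singleton_of_isTrain hx, mul_one]
      obtain ⟨e, b⟩ := x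
      obtain ⟨e, rfl⟩ := hx
      cases b
      · have : ([(Edge.train e, false)] : Word T R H) = invRev [(Edge.train e, true)] := rfl
        rw [this, SelfMap.iter_invRev, relLength_invRev]
        exact h e
      · exact h e
    · rw [relLength_eq_zero.2 (by simpa [InX] using hx)]
      omega

/-- High iterates of `f` expand the relative length by any given factor. -/
theorem exists_expansion [Finite T] (hf : IsBetaTrainTrack m) (c : ℕ) :
    ∃ t₀, ∀ t, t₀ ≤ t → ∀ p : Word T R H, c * relLength p ≤ relLength (f.iter t p) := by
  have mono : ∀ {t t' : ℕ}, t ≤ t' → ∀ p : Word T R H,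
      relLength (f.iter t p) ≤ relLength (f.iter t' p) := by
    intro t t' h p
    obtain ⟨k, rfl⟩ := Nat.exists_eq_add_of_le' h
    rw [SelfMap.iter_add]
    exact hf.relLength_le_iter _ _
  choose τ _ hτ using hf.expanding
  obtain ⟨t₁, ht₁⟩ := (Set.finite_range τ).bddAbove
  have h2 : ∀ p : Word T R H, 2 * relLength p ≤ relLength (f.iter t₁ p) :=
    mul_relLength_le_iter fun e => (hτ e).trans (mono (ht₁ ⟨e, rfl⟩) _)
  have hpow : ∀ k (p : Word T R H), 2 ^ k * relLength p ≤ relLength (f.iter (k * t₁) p) := by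
    intro k
    induction k with
    | zero => simp
    | succ k ih =>
      intro p
      have e : (k + 1) * t₁ = t₁ + k * t₁ := by ring
      rw [e, SelfMap.iter_add]
      calc 2 ^ (k + 1) * relLength p = 2 * (2 ^ k * relLength p) := by ring
        _ ≤ 2 * relLength (f.iter (k * t₁) p) := by have := ih p; omega
        _ ≤ _ := h2 _
  refine ⟨c * t₁, fun t ht p => ?_⟩
  calc c * relLength p ≤ 2 ^ c * relLength p := Nat.mul_le_mul_right _ Nat.lt_two_pow_self.le
    _ ≤ relLength (f.iter (c * t₁) p) := hpow c p
    _ ≤ _ := mono ht p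

/-! ### Legal and strongly legal paths -/

end IsBetaTrainTrack

namespace SelfMap

variable {G : Complex V T R S H} {f : SelfMap G}

theorem Legal.infix {p q : Word T R H} (h : f.Legal q) (hp : p <:+: q) : f.Legal p := by
  intro t ht
  obtain ⟨a, b, rfl⟩ := hp
  exact (h t ht).infix ⟨f.iter t a, f.iter t b, by simp⟩

theorem StronglyLegal.isReduced {p : Word T R H} (h : f.StronglyLegal p) : IsReduced p := h.2.1

theorem StronglyLegal.legal {p : Word T R H} (h : f.StronglyLegal p) : f.Legal p := h.2.2.1

/-- A vertex of `Γ` at which a path is cut does not lie in the interior of an auxiliary edge. -/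
theorem auxWord_cut {u : V ⊕ S} {v : V} {p q a d : Word T R H} {h h' : H}
    (hp : G.IsPath u p (Sum.inl v)) (e : p ++ q = a ++ auxWord h h' ++ d) :
    (∃ b, a = p ++ b ∧ q = b ++ auxWord h h' ++ d) ∨
      ∃ b, p = a ++ auxWord h h' ++ b ∧ d = b ++ q := by
  rw [List.append_assoc] at e
  rcases List.append_eq_append_iff.1 e with ⟨r, hr, hq⟩ | ⟨r, hr, hq⟩
  · exact Or.inl ⟨r, hr, by rw [hq, List.append_assoc]⟩
  · match r, hr, hq with
    | [], hr, hq => exact Or.inl ⟨[], by simpa using hr.symm, by simpa using hq.symm⟩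
    | [x], hr, hq =>
      exfalso
      simp only [auxWord, List.cons_append, List.cons.injEq] at hq
      rw [hr, ← hq.1] at hp
      obtain ⟨w, -, hx⟩ := isPath_append.1 hp
      have := hx.2
      simp [term, src] at this
    | x :: y :: b, hr, hq =>
      simp only [auxWord, List.cons_append, List.cons.injEq, List.nil_append] at hq
      refine Or.inr ⟨b, ?_, hq.2.2⟩
      rw [hr, ← hq.1, ← hq.2.1]
      simp [auxWord]

theorem IsTurn.ne_nil {τ : Word T R H} (hτ : IsTurn τ) : τ ≠ [] := by
  obtain ⟨x, χ, y, -, -, -, rfl⟩ := hτ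
  simp

/-- The end of an auxiliary edge inside a path is a vertex of `Γ`. -/
theorem isPath_of_auxWord_append {u v : V ⊕ S} {a b : Word T R H} {h h' : H}
    (hh : G.IsAux h h') (hp : G.IsPath u (a ++ auxWord h h' ++ b) v) :
    G.IsPath u a (Sum.inl (G.foot h)) ∧ G.IsPath (Sum.inl (G.foot h')) b v := by
  obtain ⟨w, h1, h2⟩ := isPath_append.1 hp
  obtain ⟨w', h3, h4⟩ := isPath_append.1 h1
  have h5 := isPath_auxWord (G := G.toGraph1) hh.2
  have e : w' = Sum.inl (G.foot h) := h4.start_unique h5 (by simp [auxWord])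
  subst e
  have e : w = Sum.inl (G.foot h') := h4.end_unique h5
  subst e
  exact ⟨h3, h2⟩

/-- Initial subpaths of strongly legal paths are strongly legal. -/
theorem StronglyLegal.prefix {p q : Word T R H} (h : f.StronglyLegal (p ++ q)) {u v : V}
    (hp : G.IsPath (Sum.inl u) p (Sum.inl v)) : f.StronglyLegal p := by
  refine ⟨⟨u, v, hp⟩, h.isReduced.left, h.legal.infix ⟨[], q, by simp⟩, ?_⟩
  intro a τ b hab hτ hleg
  obtain ⟨γ, k, k', δ, a₁, b₁, hk, h1, h2, h3, h4⟩ := h.2.2.2 a τ (b ++ G.rhat q)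
    (by rw [rhat_append hp, hab]; simp) hτ hleg
  have hτpos := List.length_pos_iff.2 hτ.ne_nil
  rcases auxWord_cut hp h1 with ⟨β, rfl, -⟩ | ⟨β, rfl, rfl⟩
  · have e := congrArg List.length hab
    have e' := congrArg List.length h3
    rw [rhat_append hp] at e'
    simp only [List.length_append] at e e'
    omega
  · obtain ⟨-, hβ⟩ := isPath_of_auxWord_append hk hp
    rw [rhat_append hβ, ← List.append_assoc] at h4
    exact ⟨γ, k, k', β, a₁, b₁, hk, rfl, h2, h3, List.append_cancel_right h4⟩

/-- Terminal subpaths of strongly legal paths are strongly legal. -/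
theorem StronglyLegal.suffix {p q : Word T R H} (h : f.StronglyLegal (p ++ q)) {u v : V}
    (hp : G.IsPath (Sum.inl u) p (Sum.inl v)) : f.StronglyLegal q := by
  obtain ⟨⟨u', v', hpath⟩, -⟩ := id h
  have hq : ∃ u v : V, G.IsPath (Sum.inl u) q (Sum.inl v) := by
    obtain ⟨w, h1, h2⟩ := isPath_append.1 hpath
    by_cases hne : p = []
    · subst hne
      have : Sum.inl u' = w := h1
      subst this
      exact ⟨u', v', h2⟩
    · have e := hp.start_unique h1 hne
      rw [← e] at h1
      rw [h1.end_unique hp] at h2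
      exact ⟨v, v', h2⟩
  refine ⟨hq, h.isReduced.right, h.legal.infix ⟨p, [], by simp⟩, ?_⟩
  intro a τ b hab hτ hleg
  obtain ⟨γ, k, k', δ, a₁, b₁, hk, h1, h2, h3, h4⟩ := h.2.2.2 (G.rhat p ++ a) τ b
    (by rw [rhat_append hp, hab]; simp) hτ hleg
  have hτpos := List.length_pos_iff.2 hτ.ne_nil
  rcases auxWord_cut hp h1 with ⟨β, rfl, h5⟩ | ⟨β, rfl, rfl⟩
  · rw [rhat_append hp, List.append_assoc] at h3
    exact ⟨β, k, k', δ, a₁, b₁, hk, h5, h2, List.append_cancel_left h3, h4⟩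
  · obtain ⟨h6, hβ⟩ := isPath_of_auxWord_append hk hp
    have e := congrArg List.length h3
    have e' := congrArg List.length h2
    rw [List.append_assoc, rhat_append (v := G.foot k) (u := u), rhat_auxWord_append] at e
    · simp only [List.length_append] at e e'
      omega
    · exact h6

theorem StronglyLegal.exists_isPath {p : Word T R H} (h : f.StronglyLegal p) :
    ∃ u v : V, G.IsPath (Sum.inl u) p (Sum.inl v) := h.1

/-- For reduced paths in `Γ`, legal means strongly legal. -/
theorem Legal.stronglyLegal {p : Word T R H} (h : f.Legal p) (hr : IsReduced p) (hΓ : InΓ p)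
    {u v : V} (hp : G.IsPath (Sum.inl u) p (Sum.inl v)) : f.StronglyLegal p := by
  refine ⟨⟨u, v, hp⟩, hr, h, fun a τ b hab _ hleg => absurd (h.infix ⟨a, b, ?_⟩) hleg⟩
  rw [← hab, rhat_of_inΓ hΓ]

end SelfMap

namespace IsBetaTrainTrack

variable {G : Complex V T R S H} {f : SelfMap G} {n : ℕ}
  {α : FreeGroup (Fin n) ≃* FreeGroup (Fin n)} {m : Marking G f n α}

theorem stronglyLegal_tighten_iter (hf : IsBetaTrainTrack m) {γ : Word T R H}
    (h : f.StronglyLegal γ) (t : ℕ) : f.StronglyLegal (tighten (f.iter t γ)) := by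
  induction t with
  | zero => rwa [SelfMap.iter_zero, h.isReduced.tighten_eq]
  | succ t ih =>
    have e : tighten (f.iter (t + 1) γ) = tighten (f.iter 1 (tighten (f.iter t γ))) := by
      rw [add_comm, SelfMap.iter_add]
      exact tighten_congr (SelfMap.mk_iter_congr 1 (mk_tighten _).symm)
    rw [e]
    exact hf.map_stronglyLegal _ ih

/-- A path which is homotopic into the relative part and crosses the train track part is not
legal. -/
theorem inX_of_legal (hf : IsBetaTrainTrack m) {p q : Word T R H} {u v : V}
    (h : f.Legal p) (hpq : G.Homotopic (Sum.inl u) (Sum.inl v) p q) (hq : InX q) : InX p := by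
  have h1 := h 1 le_rfl (f.iter 1 p) (List.infix_refl _) _ _
    ⟨_, SelfMap.inX_iter 1 hq, SelfMap.homotopic_iter_inl 1 hpq⟩
  rw [← relLength_eq_zero] at h1 ⊢
  have := hf.relLength_le_iter 1 p
  omega

theorem not_legal_backtracking (hf : IsBetaTrainTrack m) {y : Letter T R H} (hy : IsTrain y) :
    ¬ f.Legal [y, rev y] := by
  intro h
  obtain ⟨v, hv⟩ := exists_init_eq_inl (G := G.toGraph1) hy.ne_half
  have hp : G.IsPath (Sum.inl v) [y, rev y] (Sum.inl v) :=
    ⟨hv, init_rev _, (term_rev y).trans hv⟩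
  have h1 := hf.inX_of_legal h (Homotopic.of_red (q := []) hp
    (Relation.ReflTransGen.single (FreeGroup.Red.Step.not (L₁ := []) (L₂ := [])))) inX_nil
  exact h1 y (by simp) hy

/-- The retraction of a strongly legal path is reduced. -/
theorem isReduced_retr (hf : IsBetaTrainTrack m) {γ : Word T R H} (h : f.StronglyLegal γ) :
    IsReduced (G.retr γ) := by
  obtain ⟨u, v, hp⟩ := h.exists_isPath
  obtain ⟨bs, hbs, rfl⟩ := exists_properBlocks hp h.isReduced
  rw [retr_blocks hp fun β hβ => (hbs β hβ).isBlock]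
  induction bs using List.reverseRecOn generalizing v with
  | nil => exact FreeGroup.IsReduced.nil
  | append_singleton bs β ih =>
    have hβ : G.IsProperBlock β := hbs β (by simp)
    have hbs' : ∀ β ∈ bs, G.IsProperBlock β := fun β hβ => hbs β (by simp [hβ])
    simp only [List.flatMap_append, List.flatMap_singleton] at hp h ⊢
    obtain ⟨w, h1, h2⟩ := isPath_append.1 hp
    obtain ⟨a, b, h3⟩ := hβ.isBlock.exists_path
    have e := h2.start_unique h3 (blockPath_ne_nil β)
    subst e
    have ih' := ih _ hbs' (h.prefix h1) h1
    refine ih'.append (hf.isReduced_blockRetr hβ) ?_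
    rcases List.eq_nil_or_concat bs with rfl | ⟨bs, β', rfl⟩
    · simp
    have hβ' : G.IsProperBlock β' := hbs' β' (by simp)
    obtain ⟨y₁, q₁, q₁', e1, e1', e1''⟩ := hf.block_last hβ'
    obtain ⟨y₂, q₂, q₂', e2, e2', e2''⟩ := hf.block_first hβ
    simp only [List.concat_eq_append, List.flatMap_append, List.flatMap_singleton, e1', e2',
      ← List.append_assoc, List.getLast?_append_of_ne_nil, List.getLast?_singleton,
      List.head?_cons, Option.mem_def, Option.some.injEq, ne_eq, not_false_eq_true,
      forall_eq', List.cons_ne_self]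
    rintro rfl
    simp only [List.concat_eq_append, List.flatMap_append, List.flatMap_singleton] at h h1
    obtain ⟨w', h4, h5⟩ := isPath_append.1 h1
    obtain ⟨a', b', h6⟩ := hβ'.isBlock.exists_path
    have e := h5.start_unique h6 (blockPath_ne_nil β')
    subst e
    by_cases hT : IsTrain y₁
    · -- a backtracking turn is not legal, hence it would have to be the tip of an INP
      obtain ⟨-, h, h', -, p₁, q₁, hh, -, hface, -⟩ := h.2.2.2
        (G.rhat (bs.flatMap blockPath) ++ q₁) [y₁, rev y₁] q₂
        (by rw [rhat_append h1, rhat_append h4, e1, e2]; simp)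
        ⟨y₁, [], rev y₁, hT, hT, inX_nil, rfl⟩ (hf.not_legal_backtracking hT)
      have := hf.isReduced_face hh
      rw [hface] at this
      exact FreeGroup.IsReduced.ne_rev (a := p₁) (b := q₁) (by simpa using this) rfl
    · have hT' : ¬ IsTrain (rev y₁) := hT
      obtain rfl := e1''.resolve_left hT
      obtain rfl := e2''.resolve_left hT'
      exact FreeGroup.IsReduced.ne_rev (b := []) (by simpa [blockPath] using h.isReduced) rfl

/-- The turn at which a strongly legal path enters an auxiliary edge is legal if the auxiliary
edge is replaced by its INP. -/
theorem legal_turn (hf : IsBetaTrainTrack m) {g p z q : Word T R H} {k k' : H}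
    {x y : Letter T R H} {u v : V} (h : f.StronglyLegal (g ++ auxWord k k'))
    (hg : G.IsPath (Sum.inl u) g (Sum.inl v)) (hk : G.IsAux k k') (hx : G.face k k' = x :: q)
    (hgz : G.rhat g = p ++ y :: z) (hy : IsTrain y) (hz : InX z) : f.Legal (y :: (z ++ [x])) := by
  by_contra hleg
  have hxT : IsTrain x := hf.isTrain_of_face hk hx
  obtain ⟨a, i, i', b, p₁, q₁, hi, h1, h2, h3, h4⟩ := h.2.2.2 p (y :: (z ++ [x])) q
    (by rw [rhat_append hg, rhat_auxWord, hgz, hx]; simp) ⟨y, z, x, hy, hxT, hz, rfl⟩ hleg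
  -- otherwise the turn would lie in a single INP, whereas it ends just behind the initial edge
  -- of the last one
  rcases SelfMap.auxWord_cut hg h1 with ⟨c, rfl, -⟩ | ⟨c, rfl, rfl⟩
  · rw [rhat_append hg, hgz] at h3
    have := congrArg List.length h3
    simp at this
  · obtain ⟨-, hc⟩ := SelfMap.isPath_of_auxWord_append hi hg
    rw [rhat_append hc, rhat_auxWord, hx] at h4
    have := congrArg List.length h4
    simp at this
    omega

end IsBetaTrainTrack

/-! ### The induced map on reduced paths of `Γ` -/

namespace SelfMap

variable {G : Complex V T R S H} (f : SelfMap G)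

/-- The reduced path of `Γ` which is homotopic in `G²` to the image of `p` under `f^t`. -/
noncomputable def image (t : ℕ) (p : Word T R H) : Word T R H := tighten (G.retr (f.iter t p))

theorem isReduced_image (t : ℕ) (p : Word T R H) : IsReduced (f.image t p) := isReduced_tighten _

theorem image_nil (t : ℕ) : f.image t [] = [] := by
  rw [image, iter_nil, retr_nil, tighten_nil]

variable {f}

theorem image_append (t : ℕ) {u v : V} {p : Word T R H}
    (hp : G.IsPath (Sum.inl u) p (Sum.inl v)) (q : Word T R H) :
    f.image t (p ++ q) = tighten (f.image t p ++ f.image t q) := by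
  rw [image, iter_append, retr_append (isPath_iter_inl t hp), image, image, tighten_append_tighten]

theorem image_invRev (t : ℕ) {u v : V} {p : Word T R H}
    (hp : G.IsPath (Sum.inl u) p (Sum.inl v)) : f.image t (invRev p) = invRev (f.image t p) := by
  rw [image, iter_invRev, retr_invRev (isPath_iter_inl t hp), tighten_invRev, image]

theorem image_tighten_left (t : ℕ) {u v : V} {p : Word T R H}
    (hp : G.IsPath (Sum.inl u) p (Sum.inl v)) :
    G.Homotopic (Sum.inl (f.onV^[t] u)) (Sum.inl (f.onV^[t] v)) (f.iter t p) (f.image t p) := by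
  have h := homotopic_retr (isPath_iter_inl (f := f) t hp)
  exact h.trans (Homotopic.tighten h.right)

end SelfMap

section Injectivity

variable {G : Complex V T R S H} {f : SelfMap G} {n : ℕ}
  {α : FreeGroup (Fin n) ≃* FreeGroup (Fin n)}

/-- Since `f` induces an automorphism of the fundamental group, it is injective on homotopy classes
of paths with given endpoints. -/
theorem Marking.homotopic_of_iter_one (m : Marking G f n α) {u v : V} {p q : Word T R H}
    (hp : G.IsPath (Sum.inl u) p (Sum.inl v)) (hq : G.IsPath (Sum.inl u) q (Sum.inl v))
    (h : G.Homotopic (Sum.inl (f.onV u)) (Sum.inl (f.onV v)) (f.iter 1 p) (f.iter 1 q)) :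
    G.Homotopic (Sum.inl u) (Sum.inl v) p q := by
  obtain ⟨c, hc⟩ := m.connected (Sum.inl u)
  obtain ⟨d, hd⟩ := m.connected (Sum.inl v)
  have hP := (hc.append hp).append hd.invRev
  have hQ := (hc.append hq).append hd.invRev
  have hc' : G.IsPath (Sum.inl (f.onV m.base)) (f.iter 1 c) (Sum.inl (f.onV u)) :=
    SelfMap.isPath_iter_inl 1 hc
  have hd' : G.IsPath (Sum.inl (f.onV v)) (f.iter 1 (invRev d)) (Sum.inl (f.onV m.base)) :=
    SelfMap.isPath_iter_inl 1 hd.invRev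
  have h1 : G.Homotopic (Sum.inl m.base) (Sum.inl m.base)
      (m.tail ++ f.iter 1 (c ++ p ++ invRev d) ++ invRev m.tail)
      (m.tail ++ f.iter 1 (c ++ q ++ invRev d) ++ invRev m.tail) := by
    simp only [SelfMap.iter_append]
    exact (((h.append_left hc').append_right hd').append_left m.tail_path).append_right
      m.tail_path.invRev
  rw [← m.θ_eq_iff _ _ h1.left h1.right, m.conj _ hP, m.conj _ hQ, EmbeddingLike.apply_eq_iff_eq,
    m.θ_eq_iff _ _ hP hQ] at h1
  exact (h1.cancel_right hd.invRev (hc.append hp) (hc.append hq)).cancel_left hc hp hq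

theorem Marking.homotopic_of_iter (m : Marking G f n α) (t : ℕ) {u v : V} {p q : Word T R H}
    (hp : G.IsPath (Sum.inl u) p (Sum.inl v)) (hq : G.IsPath (Sum.inl u) q (Sum.inl v))
    (h : G.Homotopic (Sum.inl (f.onV^[t] u)) (Sum.inl (f.onV^[t] v)) (f.iter t p) (f.iter t q)) :
    G.Homotopic (Sum.inl u) (Sum.inl v) p q := by
  induction t with
  | zero => exact h
  | succ t ih =>
    refine ih (m.homotopic_of_iter_one (SelfMap.isPath_iter_inl t hp)
      (SelfMap.isPath_iter_inl t hq) ?_)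
    rw [← Function.iterate_succ_apply' f.onV, ← Function.iterate_succ_apply' f.onV,
      ← SelfMap.iter_add, ← SelfMap.iter_add, add_comm 1 t]
    exact h

end Injectivity

namespace IsBetaTrainTrack

variable {G : Complex V T R S H} {f : SelfMap G} {n : ℕ}
  {α : FreeGroup (Fin n) ≃* FreeGroup (Fin n)} {m : Marking G f n α}

theorem image_congr (hf : IsBetaTrainTrack m) (t : ℕ) {u v : V} {p q : Word T R H}
    (h : G.Homotopic (Sum.inl u) (Sum.inl v) p q) : f.image t p = f.image t q :=
  tighten_congr (hf.retr_homotopic _ _ _ _ (SelfMap.homotopic_iter_inl t h))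

theorem image_of_homotopic (hf : IsBetaTrainTrack m) {t : ℕ} {u v : V} {p q : Word T R H}
    (h : G.Homotopic (Sum.inl u) (Sum.inl v) (f.iter t p) q) :
    f.image t p = tighten (G.retr q) :=
  tighten_congr (hf.retr_homotopic _ _ _ _ h)

theorem image_add (hf : IsBetaTrainTrack m) (s t : ℕ) {u v : V} {p : Word T R H}
    (hp : G.IsPath (Sum.inl u) p (Sum.inl v)) : f.image s (f.image t p) = f.image (s + t) p := by
  rw [← hf.image_congr s (SelfMap.image_tighten_left t hp), SelfMap.image, ← SelfMap.iter_add]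
  rfl

theorem image_retr (hf : IsBetaTrainTrack m) (t : ℕ) {u v : V} {p : Word T R H}
    (hp : G.IsPath (Sum.inl u) p (Sum.inl v)) : f.image t (G.retr p) = f.image t p :=
  (hf.image_congr t (homotopic_retr hp)).symm

/-- No cancellation is needed to retract the image of a strongly legal path. -/
theorem image_stronglyLegal (hf : IsBetaTrainTrack m) (t : ℕ) {γ : Word T R H}
    (h : f.StronglyLegal γ) : f.image t γ = G.retr (tighten (f.iter t γ)) := by
  obtain ⟨u, v, hp⟩ := h.exists_isPath
  rw [← (hf.isReduced_retr (hf.stronglyLegal_tighten_iter h t)).tighten_eq]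
  exact hf.image_of_homotopic (Homotopic.tighten (SelfMap.isPath_iter_inl t hp))

theorem _root_.BetaTrainTrack.Marking.homotopic_of_image_eq (m : Marking G f n α) (t : ℕ) {u v : V} {p q : Word T R H}
    (hp : G.IsPath (Sum.inl u) p (Sum.inl v)) (hq : G.IsPath (Sum.inl u) q (Sum.inl v))
    (h : f.image t p = f.image t q) : G.Homotopic (Sum.inl u) (Sum.inl v) p q := by
  refine m.homotopic_of_iter t hp hq ((SelfMap.image_tighten_left t hp).trans ?_)
  rw [h]
  exact (SelfMap.image_tighten_left t hq).symm

/-- Reduced paths of `Γ` are determined by their endpoints and their images. -/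
theorem eq_of_image_eq (hf : IsBetaTrainTrack m) (t : ℕ) {u v : V} {p q : Word T R H}
    (hp : G.IsPath (Sum.inl u) p (Sum.inl v)) (hq : G.IsPath (Sum.inl u) q (Sum.inl v))
    (hpΓ : InΓ p) (hqΓ : InΓ q) (hpr : IsReduced p) (hqr : IsReduced q)
    (h : f.image t p = f.image t q) : p = q := by
  have := hf.retr_homotopic _ _ _ _ (m.homotopic_of_image_eq t hp hq h)
  rw [retr_of_inΓ hpΓ, retr_of_inΓ hqΓ] at this
  exact hpr.eq_of_mk hqr this

end IsBetaTrainTrack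

/-! ### Iterates fixing the Nielsen paths -/

/-- The exponent `s` is a common period of all INPs, and `f^s` stretches the relative length by a
factor of at least `M`; the INPs and the pre-INPs have at most `L` edges. -/
structure SelfMap.IsNielsenExponent {G : Complex V T R S H} (f : SelfMap G) (s L M : ℕ) :
    Prop where
  one_le : 1 ≤ s
  onV_foot : ∀ h h', G.IsAux h h' → f.onV^[s] (G.foot h) = G.foot h
  mk_face : ∀ h h', G.IsAux h h' → FreeGroup.mk (f.iter s (G.face h h')) = FreeGroup.mk (G.face h h')
  expand : ∀ p, M * relLength p ≤ relLength (f.iter s p)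
  length_face : ∀ h h', (G.face h h').length ≤ L
  length_retr : ∀ h h', (G.retr (auxWord h h')).length ≤ L

namespace IsBetaTrainTrack

variable {G : Complex V T R S H} {f : SelfMap G} {n : ℕ}
  {α : FreeGroup (Fin n) ≃* FreeGroup (Fin n)} {m : Marking G f n α}

theorem mk_iter_mul {t : ℕ} {p : Word T R H} (h : FreeGroup.mk (f.iter t p) = FreeGroup.mk p)
    (k : ℕ) : FreeGroup.mk (f.iter (k * t) p) = FreeGroup.mk p := by
  induction k with
  | zero => rw [zero_mul, SelfMap.iter_zero]
  | succ k ih => rw [add_mul, one_mul, SelfMap.iter_add, SelfMap.mk_iter_congr _ h, ih]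

theorem iterate_mul_fixed {φ : V → V} {t : ℕ} {v : V} (h : φ^[t] v = v) (k : ℕ) :
    φ^[k * t] v = v := by
  induction k with
  | zero => simp
  | succ k ih => rw [add_mul, one_mul, Function.iterate_add_apply, h, ih]

/-- Exponents with the required properties exist, with arbitrarily large stretching. -/
theorem exists_isNielsenExponent [Finite T] [Finite H] (hf : IsBetaTrainTrack m) :
    ∃ L, ∀ M, ∃ s, f.IsNielsenExponent s L M := by
  classical
  cases nonempty_fintype H
  have hper : ∀ e : H × H, ∃ t : ℕ, 1 ≤ t ∧ (G.IsAux e.1 e.2 →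
      f.onV^[t] (G.foot e.1) = G.foot e.1 ∧
      FreeGroup.mk (f.iter t (G.face e.1 e.2)) = FreeGroup.mk (G.face e.1 e.2)) := by
    rintro ⟨h, h'⟩
    by_cases hh : G.IsAux h h'
    · obtain ⟨-, -, -, -, -, u, v, hp, t, ht, hu, -, hmk⟩ := hf.face_inp h h' hh
      obtain ⟨x, q, hx, -⟩ := hf.face_eq_cons hh
      have e := hp.start_unique (G.face_path h h' hh) (by rw [hx]; simp)
      rw [Sum.inl.injEq] at e
      subst e
      exact ⟨t, ht, fun _ => ⟨hu, hmk⟩⟩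
    · exact ⟨1, le_rfl, fun h => absurd h hh⟩
  choose τ hτ1 hτ using hper
  obtain ⟨L₁, hL₁⟩ := (Set.finite_range fun e : H × H => (G.face e.1 e.2).length).bddAbove
  obtain ⟨L₂, hL₂⟩ :=
    (Set.finite_range fun e : H × H => (G.retr (auxWord e.1 e.2)).length).bddAbove
  refine ⟨max L₁ L₂, fun M => ?_⟩
  obtain ⟨t₀, ht₀⟩ := hf.exists_expansion M
  have hpos : 1 ≤ ∏ e, τ e := Finset.one_le_prod' fun e _ => hτ1 e
  have hdvd : ∀ e, ∃ k, (t₀ + 1) * ∏ e, τ e = k * τ e := fun e => by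
    obtain ⟨k, hk⟩ := Finset.dvd_prod_of_mem τ (Finset.mem_univ e)
    exact ⟨(t₀ + 1) * k, by rw [hk]; ring⟩
  refine ⟨(t₀ + 1) * ∏ e, τ e, ?_, ?_, ?_, ?_, ?_, ?_⟩
  · exact Nat.one_le_iff_ne_zero.2 (by positivity)
  · intro h h' hh
    obtain ⟨k, hk⟩ := hdvd (h, h')
    rw [hk]
    exact iterate_mul_fixed (hτ (h, h') hh).1 k
  · intro h h' hh
    obtain ⟨k, hk⟩ := hdvd (h, h')
    rw [hk]
    exact mk_iter_mul (hτ (h, h') hh).2 k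
  · exact ht₀ _ (by nlinarith)
  · exact fun h h' => (hL₁ ⟨(h, h'), rfl⟩).trans (le_max_left _ _)
  · exact fun h h' => (hL₂ ⟨(h, h'), rfl⟩).trans (le_max_right _ _)

variable {s L M : ℕ}

/-- The map induced by `f^s` fixes the pre-INPs. -/
theorem image_auxWord (hf : IsBetaTrainTrack m) (hs : f.IsNielsenExponent s L M) {h h' : H}
    (hh : G.IsAux h h') : f.image s (auxWord h h') = G.retr (auxWord h h') := by
  have hp := G.face_path h h' hh
  rw [hf.image_congr s (Homotopic.aux_face hh)]
  have h1 := SelfMap.isPath_iter_inl (f := f) s hp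
  rw [hs.onV_foot h h' hh, hs.onV_foot h' h hh.symm] at h1
  rw [hf.image_of_homotopic (Homotopic.of_mk h1 hp (hs.mk_face h h' hh)),
    ← tighten_congr (hf.retr_homotopic _ _ _ _ (Homotopic.aux_face hh)),
    (hf.retr_aux h h' hh).2.tighten_eq]

theorem image_retr_auxWord (hf : IsBetaTrainTrack m) (hs : f.IsNielsenExponent s L M) {h h' : H}
    (hh : G.IsAux h h') : f.image s (G.retr (auxWord h h')) = G.retr (auxWord h h') := by
  rw [hf.image_retr s (isPath_auxWord hh.2), hf.image_auxWord hs hh]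

theorem stronglyLegal_of_isTrain (hf : IsBetaTrainTrack m) {x : Letter T R H} (hx : IsTrain x) :
    f.StronglyLegal [x] := by
  obtain ⟨e, b⟩ := x
  obtain ⟨e, rfl⟩ := hx
  exact hf.train_stronglyLegal e b

theorem exists_isPath_of_isTrain {x : Letter T R H} (hx : IsTrain x) :
    ∃ u v : V, G.IsPath (Sum.inl u) [x] (Sum.inl v) := by
  obtain ⟨u, hu⟩ := exists_init_eq_inl (G := G.toGraph1) hx.ne_half
  obtain ⟨v, hv⟩ := exists_term_eq_inl (G := G.toGraph1) hx.ne_half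
  exact ⟨u, v, hu, hv⟩

/-- The image of an edge of the train track part has an initial piece of large relative length which
ends with an edge of the train track part. -/
theorem exists_stretched (hf : IsBetaTrainTrack m) (hs : f.IsNielsenExponent s L M)
    (hM : 1 ≤ M) {x : Letter T R H} (hx : IsTrain x) : ∃ a y z, tighten (f.iter s [x]) = a ++ y :: z ∧
      IsTrain y ∧ M ≤ relLength (a ++ [y]) := by
  obtain ⟨u, v, hp⟩ := exists_isPath_of_isTrain (G := G) hx
  have h1 : relLength (tighten (f.iter s [x])) = relLength (f.iter s [x]) :=
    RelReduced.relLength_tighten ((hf.stronglyLegal_of_isTrain hx).legal s hs.one_le)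
      (SelfMap.isPath_iter_inl s hp)
  have h2 := hs.expand [x]
  rw [relLength_singleton_of_isTrain hx, mul_one] at h2
  obtain ⟨a, y, z, e, hy, hz⟩ := exists_last_train (p := tighten (f.iter s [x])) (by
    rw [← relLength_eq_zero]; omega)
  refine ⟨a, y, z, e, hy, ?_⟩
  have h3 := congrArg relLength e
  rw [relLength_append, relLength_cons, relLength_eq_zero.2 hz] at h3
  rw [relLength_append]
  omega

theorem prefix_of_relLength_lt {p c a z : Word T R H} {y : Letter T R H}
    (h : p ++ c = a ++ y :: z) (hlt : relLength p < relLength (a ++ [y])) :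
    ∃ d, a ++ [y] = p ++ (d ++ [y]) ∧ c = d ++ y :: z := by
  rcases List.append_eq_append_iff.1 h with ⟨r, hr, hc⟩ | ⟨r, hr, hc⟩
  · exact ⟨r, by rw [hr, List.append_assoc], hc⟩
  · cases r with
    | nil => exact ⟨[], by simp [hr], by simpa using hc.symm⟩
    | cons x r =>
      simp only [List.cons_append, List.cons.injEq] at hc
      obtain ⟨rfl, rfl⟩ := hc
      have := relLength_le_of_prefix (p := a ++ [y]) (q := p) ⟨r, by simp [hr]⟩
      omega

/-- Since an INP is homotopic into the relative part, it does not occur in a tightened relatively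
reduced path. -/
theorem not_relReduced_of_tighten_eq_face (hf : IsBetaTrainTrack m) {h h' : H}
    (hh : G.IsAux h h') {w a b : Word T R H} {u v : V ⊕ S} (hp : G.IsPath u w v)
    (hw : G.RelReduced w) (e : tighten w = a ++ G.face h h' ++ b) : False := by
  obtain ⟨w₁, w₃, rfl, h1, -⟩ := exists_split_of_tighten e
  obtain ⟨w₁, w₂, rfl, -, h2⟩ := exists_split_of_tighten h1
  rw [List.append_assoc] at hp
  obtain ⟨i, -, h3⟩ := isPath_append.1 hp
  obtain ⟨j, h4, -⟩ := isPath_append.1 h3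
  obtain ⟨x, q, hx, hT⟩ := hf.face_eq_cons hh
  have h5 := h4.tighten
  rw [h2] at h5
  have e1 := h5.start_unique (G.face_path h h' hh) (by rw [hx]; simp)
  subst e1
  have e2 := h5.end_unique (G.face_path h h' hh)
  subst e2
  have h6 := hw w₂ ⟨w₁, w₃, by simp⟩ _ _ ⟨_, inX_auxWord h h',
    (Homotopic.of_mk h4 h5 (by rw [← h2, mk_tighten])).trans (Homotopic.aux_face hh).symm⟩
  have h7 := h6.tighten
  rw [h2, hx] at h7
  exact h7 x (by simp) hT

/-- The two branches of an INP, stretched by `f^s`: they run along the INP up to its tip, and then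
together along a path `C` whose relative length is large. -/
theorem exists_branches (hf : IsBetaTrainTrack m) (hs : f.IsNielsenExponent s L M) (hM : L < M)
    {h h' : H} (hh : G.IsAux h h') {x x' : Letter T R H} {q q' : Word T R H}
    (hx : G.face h h' = x :: q) (hx' : G.face h h' = q' ++ [x']) :
    ∃ A B C Z Z' y, G.face h h' = A ++ B ∧ A ≠ [] ∧ B ≠ [] ∧ IsTrain y ∧
      tighten (f.iter s [x]) = A ++ (C ++ [y]) ++ Z ∧
      tighten (f.iter s [rev x']) = invRev B ++ (C ++ [y]) ++ Z' ∧
      M ≤ relLength (C ++ [y]) + L := by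
  obtain ⟨-, ⟨x₀, hx₀, hxT⟩, ⟨x₁, hx₁, hxT'⟩, ⟨η₁, η₂, hη, hη₁, hη₂⟩, hleg, -⟩ := hf.face_inp h h' hh
  rw [hx] at hx₀
  rw [hx'] at hx₁
  simp only [List.head?_cons, Option.mem_def, Option.some.injEq, List.getLast?_concat] at hx₀ hx₁
  subst hx₀ hx₁
  have hfleg : ¬ f.Legal (G.face h h') := by simpa [SelfMap.iter_zero] using hleg 0
  obtain ⟨η₁', rfl⟩ : ∃ η₁', η₁ = x :: η₁' := by
    cases η₁ with
    | nil => rw [hη] at hfleg; exact absurd (by simpa using hη₂) hfleg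
    | cons a η₁ =>
      rw [hx] at hη
      simp only [List.cons_append, List.cons.injEq] at hη
      exact ⟨η₁, by rw [hη.1]⟩
  obtain ⟨η₂', rfl⟩ : ∃ η₂', η₂ = η₂' ++ [x'] := by
    rcases List.eq_nil_or_concat η₂ with rfl | ⟨η₂, a, rfl⟩
    · rw [hη] at hfleg; exact absurd (by simpa using hη₁) hfleg
    · rw [hx', List.concat_eq_append, ← List.append_assoc] at hη
      have := List.append_inj_right' hη rfl
      simp only [List.cons.injEq, and_true] at this
      exact ⟨η₂, by rw [this]; simp⟩
  have hp := G.face_path h h' hh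
  rw [hη] at hp
  obtain ⟨w, hp₁, hp₂⟩ := isPath_append.1 hp
  have hr₁ := hη₁ s hs.one_le
  have hr₂ := hη₂ s hs.one_le
  have hq₁ := SelfMap.isPath_iter (f := f) s hp₁
  have hq₂ := SelfMap.isPath_iter (f := f) s hp₂
  obtain ⟨A, c, B, h1, h2, h3⟩ := exists_cancellation (isReduced_tighten (f.iter s (x :: η₁')))
    (isReduced_tighten (f.iter s (η₂' ++ [x'])))
  have hAB : G.face h h' = A ++ B := by
    refine (hf.isReduced_face hh).eq_of_mk h3 ?_
    rw [← hs.mk_face h h' hh, hη, SelfMap.iter_append, ← tighten_eq_of_cancellation h1 h2 h3,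
      mk_tighten, mk_append, mk_append, mk_tighten, mk_tighten]
  -- the tip of the image is not an endpoint: no branch has an INP in its tightened image
  have hA : A ≠ [] := by
    rintro rfl
    refine hf.not_relReduced_of_tighten_eq_face hh hq₂ hr₂ (a := invRev c) (b := []) ?_
    rw [h2, hAB]; simp
  have hB : B ≠ [] := by
    rintro rfl
    refine hf.not_relReduced_of_tighten_eq_face hh.symm hq₁.invRev hr₁.invRev (a := invRev c)
      (b := []) ?_
    rw [tighten_invRev, h1, G.face_rev h h' hh, hAB]; simp [FreeGroup.invRev_append]
  have hlen : ∀ D E, G.face h h' = D ++ E → relLength D ≤ L ∧ relLength E ≤ L := by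
    intro D E e
    have e1 := relLength_le_length (G.face h h')
    have e2 := hs.length_face h h'
    rw [congrArg relLength e, relLength_append] at e1
    omega
  obtain ⟨hAL, hBL⟩ := hlen A B hAB
  -- cancellation between the images of the two branches of the INP leaves `A` and `B`; since
  -- these have at most `L` edges, `A` is an initial piece of the stretched initial edge
  obtain ⟨a, y, z, e1, hy, hM₁⟩ := hf.exists_stretched hs (by omega) hxT
  obtain ⟨z₁, e2⟩ := RelReduced.tighten_append (w₁ := f.iter s [x]) (w₂ := f.iter s η₁')
    (by rw [← SelfMap.iter_append]; exact hr₁) (by rw [← SelfMap.iter_append]; exact hq₁) e1 hy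
  rw [← SelfMap.iter_append, List.singleton_append, h1] at e2
  obtain ⟨d, e3, e4⟩ := prefix_of_relLength_lt e2 (by omega)
  -- likewise, `B` reversed is an initial piece of the image of the final edge, reversed
  obtain ⟨a', y', z', e1', hy', hM₁'⟩ := hf.exists_stretched hs (by omega) (x := rev x') hxT'
  have einv : invRev (η₂' ++ [x']) = [rev x'] ++ invRev η₂' := by
    rw [invRev_append_singleton]; rfl
  obtain ⟨z₁', e2'⟩ := RelReduced.tighten_append (w₁ := f.iter s [rev x'])
    (w₂ := f.iter s (invRev η₂'))
    (by rw [← SelfMap.iter_append, ← einv, SelfMap.iter_invRev]; exact hr₂.invRev)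
    (by rw [← SelfMap.iter_append, ← einv, SelfMap.iter_invRev]; exact hq₂.invRev) e1' hy'
  rw [← SelfMap.iter_append, ← einv, SelfMap.iter_invRev, tighten_invRev, h2,
    FreeGroup.invRev_append, FreeGroup.invRev_invRev] at e2'
  obtain ⟨d', e3', e4'⟩ := prefix_of_relLength_lt e2' (by rw [relLength_invRev]; omega)
  have hd : M ≤ relLength (d ++ [y]) + L := by
    have := congrArg relLength e3
    rw [relLength_append (p := A)] at this
    omega
  have hd' : M ≤ relLength (d' ++ [y']) + L := by
    have := congrArg relLength e3'
    rw [relLength_append (p := invRev B), relLength_invRev] at this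
    omega
  have e5 : tighten (f.iter s [x]) = A ++ (d ++ [y]) ++ z := by
    rw [e1, ← e3]; simp
  have e5' : tighten (f.iter s [rev x']) = invRev B ++ (d' ++ [y']) ++ z' := by
    rw [e1', ← e3']; simp
  -- what remains of the two stretched edges starts with the cancelled path `c`
  have e6 : (d ++ [y]) ++ z₁ = (d' ++ [y']) ++ z₁' := by
    rw [e4] at e4'; simpa using e4'
  rcases List.append_eq_append_iff.1 e6 with ⟨r, hr, -⟩ | ⟨r, hr, -⟩
  · exact ⟨A, B, d, z, r ++ z', y, hAB, hA, hB, hy, e5, by rw [e5', hr]; simp, hd⟩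
  · exact ⟨A, B, d', r ++ z, z', y', hAB, hA, hB, hy', by rw [e5, hr]; simp, e5', hd'⟩

/-- The initial edge of an INP is a fixed direction. -/
theorem exists_tighten_iter_eq_cons (hf : IsBetaTrainTrack m) (hs : f.IsNielsenExponent s L M)
    (hM : L < M) {h h' : H} (hh : G.IsAux h h') {x : Letter T R H} {q : Word T R H}
    (hx : G.face h h' = x :: q) : ∃ q', tighten (f.iter s [x]) = x :: q' := by
  obtain ⟨q', x', hx', -⟩ := hf.face_eq_append hh
  obtain ⟨A, B, C, Z, -, y, hAB, hA, -, -, e, -⟩ := hf.exists_branches hs hM hh hx hx'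
  cases A with
  | nil => exact absurd rfl hA
  | cons a A =>
    rw [hx] at hAB
    simp only [List.cons_append, List.cons.injEq] at hAB
    rw [e, hAB.1]
    exact ⟨_, rfl⟩

theorem exists_tighten_iter_eq_append (hf : IsBetaTrainTrack m)
    (hs : f.IsNielsenExponent s L M) (hM : L < M) {h h' : H} (hh : G.IsAux h h')
    {x : Letter T R H} {q : Word T R H} (hx : G.face h h' = q ++ [x]) :
    ∃ q', tighten (f.iter s [x]) = q' ++ [x] := by
  obtain ⟨q', hq'⟩ := hf.exists_tighten_iter_eq_cons hs hM hh.symm (x := rev x) (q := invRev q)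
    (by rw [G.face_rev h h' hh, hx, invRev_append_singleton])
  refine ⟨invRev q', ?_⟩
  rw [← invRev_singleton, SelfMap.iter_invRev, tighten_invRev] at hq'
  rw [← FreeGroup.invRev_invRev (L₁ := tighten (f.iter s [x])), hq', invRev_cons_rev, rev_rev]

end IsBetaTrainTrack

theorem Complex.retr_cons {G : Complex V T R S H} {x : Letter T R H}
    (hx : ∀ h, x.1 ≠ Edge.half h) (q : Word T R H) : G.retr (x :: q) = x :: G.retr q := by
  obtain ⟨u, hu⟩ := exists_init_eq_inl (G := G.toGraph1) hx
  obtain ⟨v, hv⟩ := exists_term_eq_inl (G := G.toGraph1) hx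
  have h : G.IsPath (Sum.inl u) [x] (Sum.inl v) := ⟨hu, hv⟩
  rw [← List.singleton_append, retr_append h, retr_of_inΓ (p := [x]) (by simpa [InΓ] using hx)]
  rfl

/-! ### Cancellation at turns -/

theorem IsTrain.ne_rev_of_not {x y : Letter T R H} (hx : IsTrain x) (hy : ¬ IsTrain y) :
    y ≠ rev x ∧ x ≠ rev y := by
  refine ⟨?_, ?_⟩ <;> rintro rfl
  · exact hy hx
  · exact hy hx

namespace IsBetaTrainTrack

variable {G : Complex V T R S H} {f : SelfMap G} {n : ℕ}
  {α : FreeGroup (Fin n) ≃* FreeGroup (Fin n)} {m : Marking G f n α} {s L M : ℕ}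

theorem isReduced_turn (hf : IsBetaTrainTrack m) {x y : Letter T R H} {z : Word T R H}
    (hx : IsTrain x) (hy : IsTrain y) (hz : InX z) (hr : IsReduced z)
    (h : f.Legal (y :: (z ++ [x]))) : IsReduced (y :: (z ++ [x])) := by
  have h1 : IsReduced (z ++ [x]) := by
    refine hr.append FreeGroup.IsReduced.singleton ?_
    intro a ha b hb
    simp only [List.head?_cons, Option.mem_def, Option.some.injEq] at hb
    subst hb
    exact (hx.ne_rev_of_not (hz a (List.mem_of_getLast? ha))).2
  have h2 : IsReduced ([y] ++ (z ++ [x])) := by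
    refine FreeGroup.IsReduced.singleton.append h1 ?_
    intro a ha b hb
    simp only [List.getLast?_singleton, Option.mem_def, Option.some.injEq] at ha
    subst ha
    cases z with
    | nil =>
      simp only [List.nil_append, List.head?_cons, Option.mem_def, Option.some.injEq] at hb
      subst hb
      rintro rfl
      exact hf.not_legal_backtracking hy h
    | cons c z =>
      simp only [List.cons_append, List.head?_cons, Option.mem_def, Option.some.injEq] at hb
      subst hb
      exact (hy.ne_rev_of_not (hz c (by simp))).1
  exact h2

/-- The images of two adjacent legal paths do not cancel at an edge of the train track part which
remains at the junction. -/
theorem _root_.BetaTrainTrack.SelfMap.tighten_iter_append_of_head {p q r : Word T R H} {x : Letter T R H}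
    {u v : V ⊕ S} (hs : 1 ≤ s) (h : f.Legal (p ++ q)) (hp : G.IsPath u (p ++ q) v)
    (hx : IsTrain x) (hq : tighten (f.iter s q) = x :: r) :
    tighten (f.iter s (p ++ q)) = tighten (f.iter s p) ++ tighten (f.iter s q) := by
  obtain ⟨a, c, b, h1, h2, h3⟩ := exists_cancellation (isReduced_tighten (f.iter s p))
    (isReduced_tighten (f.iter s q))
  have hc : InX c := RelReduced.inX_of_cancel (by rw [← SelfMap.iter_append]; exact h s hs)
    (by rw [← SelfMap.iter_append]; exact SelfMap.isPath_iter s hp) h1 h2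
  have hc0 : c = [] := by
    rcases List.eq_nil_or_concat c with rfl | ⟨c, a, rfl⟩
    · rfl
    · rw [hq, List.concat_eq_append, invRev_append_singleton] at h2
      simp only [List.cons_append, List.cons.injEq] at h2
      rw [List.concat_eq_append, inX_append, inX_cons] at hc
      exact absurd ((isTrain_rev a).1 (h2.1 ▸ hx)) hc.2.1
  subst hc0
  rw [SelfMap.iter_append, ← tighten_append_tighten, tighten_eq_of_cancellation h1 h2 h3, h1, h2]
  simp

theorem _root_.BetaTrainTrack.SelfMap.tighten_iter_append_of_last {p q r : Word T R H} {x : Letter T R H}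
    {u v : V ⊕ S} (hs : 1 ≤ s) (h : f.Legal (p ++ q)) (hp : G.IsPath u (p ++ q) v)
    (hx : IsTrain x) (hq : tighten (f.iter s p) = r ++ [x]) :
    tighten (f.iter s (p ++ q)) = tighten (f.iter s p) ++ tighten (f.iter s q) := by
  obtain ⟨a, c, b, h1, h2, h3⟩ := exists_cancellation (isReduced_tighten (f.iter s p))
    (isReduced_tighten (f.iter s q))
  have hc : InX c := RelReduced.inX_of_cancel (by rw [← SelfMap.iter_append]; exact h s hs)
    (by rw [← SelfMap.iter_append]; exact SelfMap.isPath_iter s hp) h1 h2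
  have hc0 : c = [] := by
    rcases List.eq_nil_or_concat c with rfl | ⟨c, b, rfl⟩
    · rfl
    · rw [hq, List.concat_eq_append, ← List.append_assoc] at h1
      have := List.append_inj_right' h1 rfl
      simp only [List.cons.injEq, and_true] at this
      rw [List.concat_eq_append, inX_append, inX_cons] at hc
      exact absurd (this ▸ hx) hc.2.1
  subst hc0
  rw [SelfMap.iter_append, ← tighten_append_tighten, tighten_eq_of_cancellation h1 h2 h3, h1, h2]
  simp

/-- At a legal turn into the initial edge of an INP the images do not cancel. -/
theorem isReduced_image_turn (hf : IsBetaTrainTrack m) (hs : f.IsNielsenExponent s L M)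
    (hM : L < M) {h h' : H} (hh : G.IsAux h h') {x y : Letter T R H} {q z : Word T R H}
    (hx : G.face h h' = x :: q) (hy : IsTrain y) (hz : InX z) (hzΓ : InΓ z) (hr : IsReduced z)
    (hleg : f.Legal (y :: (z ++ [x]))) {u v : V ⊕ S} (hp : G.IsPath u (y :: (z ++ [x])) v) :
    f.StronglyLegal (y :: z) ∧ IsReduced (f.image s (y :: z) ++ [x]) := by
  have hxT : IsTrain x := hf.isTrain_of_face hh hx
  obtain ⟨a, ha⟩ := exists_init_eq_inl (G := G.toGraph1) hy.ne_half
  obtain rfl : Sum.inl a = u := ha.symm.trans hp.1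
  have hΓ : InΓ (y :: (z ++ [x])) := by
    have := inΓ_append.2 ⟨inΓ_append.2 ⟨inΓ_singleton_of_isTrain hy, hzΓ⟩,
      inΓ_singleton_of_isTrain hxT⟩
    simpa using this
  obtain ⟨b, hb, hb'⟩ := IsPath.exists_cut_of_inΓ (p := y :: z) (q := [x])
    (by simpa using hp) (hΓ.infix ⟨[], [x], by simp⟩)
  obtain ⟨v', hv'⟩ := exists_term_eq_inl (G := G.toGraph1) hxT.ne_half
  obtain rfl : Sum.inl v' = v := hv'.symm.trans hb'.2
  have hSL := hleg.stronglyLegal (hf.isReduced_turn hxT hy hz hr hleg) hΓ hp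
  obtain ⟨q', hq'⟩ := hf.exists_tighten_iter_eq_cons hs hM hh hx
  have e : y :: (z ++ [x]) = (y :: z) ++ [x] := rfl
  rw [e] at hSL hp hleg
  have h1 := SelfMap.tighten_iter_append_of_head hs.one_le hleg hp hxT hq'
  have h2 := hf.stronglyLegal_tighten_iter hSL s
  rw [h1] at h2
  have hW := (SelfMap.isPath_iter_inl (f := f) s hb).tighten
  have h3 := hf.isReduced_retr h2
  rw [retr_append hW, hq'] at h3
  obtain ⟨q'', hq''⟩ := iterate_rhat_cons (G := G) hxT.ne_half q' G.depth
  rw [retr, retr, hq''] at h3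
  refine ⟨hSL.prefix hb, ?_⟩
  rw [hf.image_stronglyLegal s (hSL.prefix hb)]
  refine FreeGroup.IsReduced.left (b := q'') ?_
  simpa [retr] using h3

/-- At a legal turn from the final edge of an INP to the initial edge of an INP the images do not
cancel. -/
theorem isReduced_image_turn' (hf : IsBetaTrainTrack m) (hs : f.IsNielsenExponent s L M)
    (hM : L < M) {h h' k k' : H} (hh : G.IsAux h h') (hk : G.IsAux k k') {x y : Letter T R H}
    {q q' z : Word T R H} (hx : G.face h h' = x :: q) (hyf : G.face k k' = q' ++ [y])
    (hy : IsTrain y) (hz : InX z) (hzΓ : InΓ z) (hr : IsReduced z)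
    (hleg : f.Legal (y :: (z ++ [x]))) {u v : V ⊕ S} (hp : G.IsPath u (y :: (z ++ [x])) v) :
    IsReduced (y :: (f.image s z ++ [x])) := by
  obtain ⟨h1, h2⟩ := hf.isReduced_image_turn hs hM hh hx hy hz hzΓ hr hleg hp
  obtain ⟨r, hr'⟩ := hf.exists_tighten_iter_eq_append hs hM hk hyf
  obtain ⟨a, b, hab⟩ := h1.exists_isPath
  obtain ⟨w, w', hw, hw', hw''⟩ := IsPath.exists_cut_after (p := []) hab hy
  obtain rfl : a = w := Sum.inl.inj hw
  have h3 := SelfMap.tighten_iter_append_of_last (p := [y]) (q := z) hs.one_le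
    (hleg.infix ⟨[], [x], by simp⟩) hab hy hr'
  have h4 := (SelfMap.isPath_iter_inl (f := f) s hw').tighten
  have h5 := (SelfMap.isPath_iter_inl (f := f) s hw'')
  have h6 := hf.image_stronglyLegal s h1
  rw [← List.singleton_append, h3, retr_append h4] at h6
  have h7 : G.retr (tighten (f.iter s z)) = f.image s z := by
    have h8 := SelfMap.isReduced_image (f := f) s ([y] ++ z)
    rw [h6] at h8
    rw [← h8.right.tighten_eq]
    exact (hf.image_of_homotopic (Homotopic.tighten h5)).symm
  rw [hr'] at h4
  obtain ⟨c, c', hc, hc', -⟩ := IsPath.exists_cut_after h4 hy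
  rw [hr', retr_append hc, retr_of_inΓ (inΓ_singleton_of_isTrain hy), h7] at h6
  have e : y :: z = [y] ++ z := rfl
  rw [e, h6] at h2
  refine FreeGroup.IsReduced.right (a := G.retr r) ?_
  simpa using h2

/-- A path either runs in `X` and in `Γ`, or it has a last block which is an edge of the train
track part or an auxiliary edge. -/
theorem exists_last_block {bs : List (Letter T R H ⊕ (H × H))} (hbs : ∀ β ∈ bs, G.IsProperBlock β) :
    (InX (bs.flatMap blockPath) ∧ InΓ (bs.flatMap blockPath)) ∨
    ∃ (bs' : List (Letter T R H ⊕ (H × H))) (β : Letter T R H ⊕ (H × H)) (z : Word T R H),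
      bs.flatMap blockPath = bs'.flatMap blockPath ++ (blockPath β ++ z) ∧ InX z ∧ InΓ z ∧
      (∀ β ∈ bs', G.IsProperBlock β) ∧
      ((∃ y, IsTrain y ∧ β = Sum.inl y) ∨ ∃ h h', G.IsAux h h' ∧ β = Sum.inr (h, h')) := by
  induction bs using List.reverseRecOn with
  | nil => exact Or.inl ⟨inX_nil, inΓ_nil⟩
  | append_singleton bs β ih =>
    have hβ : G.IsProperBlock β := hbs β (by simp)
    have hbs' : ∀ β ∈ bs, G.IsProperBlock β := fun β hβ => hbs β (by simp [hβ])
    simp only [List.flatMap_append, List.flatMap_singleton]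
    rcases β with y | ⟨h, h'⟩
    · by_cases hy : IsTrain y
      · exact Or.inr ⟨bs, Sum.inl y, [], by simp, inX_nil, inΓ_nil, hbs', Or.inl ⟨y, hy, rfl⟩⟩
      · have hyX : InX ([y] : Word T R H) := by simpa [InX] using hy
        have hyΓ : InΓ ([y] : Word T R H) := fun a ha => by
          rw [List.mem_singleton.1 ha]; exact hβ
        rcases ih hbs' with ⟨h1, h2⟩ | ⟨bs', β, z, e, hz, hzΓ, h3, h4⟩
        · exact Or.inl ⟨inX_append.2 ⟨h1, hyX⟩, inΓ_append.2 ⟨h2, hyΓ⟩⟩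
        · exact Or.inr ⟨bs', β, z ++ [y], by rw [e]; simp [blockPath], inX_append.2 ⟨hz, hyX⟩,
            inΓ_append.2 ⟨hzΓ, hyΓ⟩, h3, h4⟩
    · exact Or.inr ⟨bs, Sum.inr (h, h'), [], by simp, inX_nil, inΓ_nil, hbs',
        Or.inr ⟨h, h', hβ, rfl⟩⟩

/-- If a strongly legal path runs into an auxiliary edge, then its image does not cancel against
the initial edge of the INP. The proof inspects the last turn, and it proceeds by induction if this
turn starts at an auxiliary edge. -/
theorem isReduced_image_append (hf : IsBetaTrainTrack m) (hs : f.IsNielsenExponent s L M)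
    (hM : L < M) {x₀ : Letter T R H} (hx₀ : IsTrain x₀) (N : ℕ) : ∀ {g : Word T R H},
    g.length ≤ N → (∃ g', g = x₀ :: g') → ∀ {u v : V}, G.IsPath (Sum.inl u) g (Sum.inl v) →
    ∀ {k k' : H} {x : Letter T R H} {q : Word T R H}, G.IsAux k k' → G.face k k' = x :: q →
    f.StronglyLegal (g ++ auxWord k k') → IsReduced (f.image s g ++ [x]) := by
  induction N with
  | zero =>
    rintro g hg ⟨g', rfl⟩
    simp at hg
  | succ N ih =>
    rintro g hg ⟨g', hg'⟩ u v hp k k' x q hk hx hSL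
    have hg_SL := hSL.prefix hp
    obtain ⟨bs, hbs, hbs'⟩ := exists_properBlocks hp hg_SL.isReduced
    have hxT : IsTrain x := hf.isTrain_of_face hk hx
    rcases exists_last_block hbs with ⟨h1, -⟩ | ⟨bs', β, z, e, hz, hzΓ, hpr, hβ⟩
    · rw [← hbs', hg', inX_cons] at h1
      exact absurd hx₀ h1.1
    rw [← hbs'] at e
    have hrz : IsReduced z := by
      have := hg_SL.isReduced
      rw [e] at this
      exact this.right.right
    set g₀ := bs'.flatMap blockPath with hg₀
    have hpath := hp
    rw [e] at hpath
    have hβp : G.IsProperBlock β := by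
      rcases hβ with ⟨y, hy, rfl⟩ | ⟨i, i', hi, rfl⟩
      · exact hy.ne_half
      · exact hi
    obtain ⟨w, hw, hw'⟩ := isPath_append.1 hpath
    obtain ⟨w₁, hw₁, hw₂⟩ := isPath_append.1 hw'
    obtain ⟨a, b, hab⟩ := hβp.isBlock.exists_path
    obtain rfl := hw₁.start_unique hab (blockPath_ne_nil β)
    obtain rfl := hw₁.end_unique hab
    obtain ⟨y, c, c', hy1, hy2, hy3⟩ := hf.block_last hβp
    have hyT : IsTrain y := by
      rcases hβ with ⟨y', hy', rfl⟩ | ⟨i, i', hi, rfl⟩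
      · rcases hy3 with h | h
        · exact h
        · rw [Sum.inl.injEq] at h; exact h ▸ hy'
      · rcases hy3 with h | h
        · exact h
        · simp at h
    have hrh : G.rhat g = (G.rhat g₀ ++ c) ++ y :: z := by
      rw [e, rhat_append hw, rhat_append hab, hy1, rhat_of_inΓ hzΓ]; simp
    have hleg := hf.legal_turn hSL hp hk hx hrh hyT hz
    have hturn : ∃ w, G.IsPath w (y :: (z ++ [x])) (G.term x) := by
      have h1 := (homotopic_rhat hp).right
      rw [hrh] at h1
      obtain ⟨w, -, h2⟩ := isPath_append.1 h1
      have h3 := G.face_path k k' hk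
      rw [hx] at h3
      have h4 : G.IsPath (Sum.inl v) [x] (G.term x) := by
        obtain ⟨⟨u', v', h5⟩, -⟩ := hSL
        obtain ⟨w', h6, h7⟩ := isPath_append.1 h5
        have h8 := h7.start_unique (isPath_auxWord (G := G.toGraph1) hk.2) (by simp [auxWord])
        subst h8
        have h9 := hp.start_unique h6 (by rw [hg']; simp)
        rw [← h9] at h6
        rw [hp.end_unique h6]
        exact ⟨h3.1, rfl⟩
      exact ⟨w, h2.append h4⟩
    obtain ⟨w₃, hturn⟩ := hturn
    -- either the turn starts at an edge of the train track part, or at a fixed pre-INP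
    rcases hβ with ⟨y', hy', rfl⟩ | ⟨i, i', hi, rfl⟩
    · obtain rfl : y' = y := by
        have : ([y'] : Word T R H) = c' ++ [y] := hy2
        have := congrArg List.getLast? this
        simpa using this
      obtain ⟨h1, h2⟩ := hf.isReduced_image_turn hs hM hk hx hyT hz hzΓ hrz hleg hturn
      have e' : g = g₀ ++ (y' :: z) := e
      -- the last edges in the train track part of the two images agree
      have hyz : G.IsPath (Sum.inl a) (y' :: z) (Sum.inl v) := hab.append hw₂
      have hne : ¬ InX (tighten (f.iter s (y' :: z))) := by
        rw [← relLength_eq_zero, RelReduced.relLength_tighten (h1.legal s hs.one_le)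
          (SelfMap.isPath_iter_inl s hyz)]
        have := hf.relLength_le_iter s (y' :: z)
        rw [relLength_cons, relLength_singleton_of_isTrain hyT] at this
        omega
      obtain ⟨a₀, y₁, z₁, h3, hy₁, -⟩ := exists_last_train hne
      have h4 := SelfMap.isPath_iter_inl (f := f) s hp
      rw [e', SelfMap.iter_append] at h4
      have h5 := hg_SL.legal s hs.one_le
      rw [e', SelfMap.iter_append] at h5
      obtain ⟨z', h6⟩ := RelReduced.tighten_append' h5 h4 h3 hy₁
      rw [← SelfMap.iter_append, ← e'] at h6
      have h7 := (SelfMap.isPath_iter_inl (f := f) s hyz).tighten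
      have h8 := (SelfMap.isPath_iter_inl (f := f) s hp).tighten
      rw [hf.image_stronglyLegal s h1] at h2
      rw [h3] at h7 h2
      rw [hf.image_stronglyLegal s hg_SL, h6]
      have hred := hf.isReduced_retr (hf.stronglyLegal_tighten_iter hg_SL s)
      rw [h6] at h8 hred
      obtain ⟨_, _, h9, -, -⟩ := IsPath.exists_cut_after h7 hy₁
      obtain ⟨_, _, h10, -, -⟩ := IsPath.exists_cut_after h8 hy₁
      rw [retr_append h9, retr_cons hy₁.ne_half] at h2
      rw [retr_append h10, retr_cons hy₁.ne_half] at hred ⊢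
      rw [List.append_assoc] at h2 ⊢
      refine FreeGroup.IsReduced.glue (FreeGroup.IsReduced.left (b := G.retr z₁) ?_) h2.right
      simpa using hred
    · have hne : g₀ ≠ [] := by
        intro h0
        rw [h0, hg'] at e
        simp only [blockPath, auxWord, List.nil_append, List.cons_append, List.cons.injEq] at e
        exact absurd (e.1 ▸ hx₀) (by rintro ⟨_, h⟩; simp at h)
      have hg₀' : ∃ g'', g₀ = x₀ :: g'' := by
        obtain ⟨d, g'', hd⟩ := List.exists_cons_of_ne_nil hne
        rw [hd, hg'] at e
        simp only [List.cons_append, List.cons.injEq] at e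
        exact ⟨g'', by rw [hd, e.1]⟩
      obtain ⟨x₁, q₁, hx₁, hx₁T⟩ := hf.face_eq_cons hi
      obtain ⟨q₂, hq₂⟩ := hf.retr_auxWord_eq_cons hi hx₁ hx₁T
      have h1 : IsReduced (f.image s g₀ ++ [x₁]) := by
        refine ih ?_ hg₀' hw hi hx₁ ?_
        · rw [e] at hg; simp [blockPath, auxWord] at hg; omega
        · have := hg_SL
          rw [e, ← List.append_assoc] at this
          exact this.prefix (hw.append hab)
      have hface : G.face i i' = c ++ [y] := by rw [← hy1, blockPath, rhat_auxWord]
      have h2 := hf.isReduced_image_turn' hs hM hk hi hx hface hyT hz hzΓ hrz hleg hturn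
      have hρ : G.retr (auxWord i i') = c' ++ [y] := hy2
      have h3 : IsReduced (G.retr (auxWord i i') ++ (f.image s z ++ [x])) := by
        have := (hf.retr_aux i i' hi).2
        rw [hρ] at this ⊢
        simpa using FreeGroup.IsReduced.glue this h2
      have h4 : IsReduced (f.image s g₀ ++ (G.retr (auxWord i i') ++ (f.image s z ++ [x]))) := by
        rw [hq₂] at h3 ⊢
        exact FreeGroup.IsReduced.glue h1 h3
      have h5 : f.image s g = f.image s g₀ ++ (G.retr (auxWord i i') ++ f.image s z) := by
        rw [e, SelfMap.image_append s hw, SelfMap.image_append s hab, blockPath,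
          hf.image_auxWord hs hi, FreeGroup.IsReduced.tighten_eq (p := _ ++ f.image s z),
          FreeGroup.IsReduced.tighten_eq]
        · refine FreeGroup.IsReduced.left (b := [x]) ?_
          simpa using h4
        · refine FreeGroup.IsReduced.left (b := [x]) ?_
          simpa using h3
      rw [h5]
      simpa using h4

end IsBetaTrainTrack

/-! ### Initial subpaths of pre-INPs -/

/-- A cut of a concatenation of words lies between two of them or in the interior of one. -/
theorem flatMap_cut {β γ : Type*} (F : β → List γ) {bs : List β} {p q : List γ}
    (h : bs.flatMap F = p ++ q) :
    (∃ b₁ b₂, bs = b₁ ++ b₂ ∧ p = b₁.flatMap F ∧ q = b₂.flatMap F) ∨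
    ∃ b₁ b b₂ s s', bs = b₁ ++ b :: b₂ ∧ s ≠ [] ∧ s' ≠ [] ∧ F b = s ++ s' ∧
      p = b₁.flatMap F ++ s ∧ q = s' ++ b₂.flatMap F := by
  induction bs generalizing p with
  | nil =>
    simp only [List.flatMap_nil, List.nil_eq, List.append_eq_nil_iff] at h
    exact Or.inl ⟨[], [], rfl, h.1, h.2⟩
  | cons b bs ih =>
    rw [List.flatMap_cons] at h
    rcases List.append_eq_append_iff.1 h with ⟨r, hp, hr⟩ | ⟨r, hb, hq⟩
    · rcases ih hr with ⟨b₁, b₂, rfl, rfl, rfl⟩ | ⟨b₁, c, b₂, s, s', rfl, hs, hs', h1, rfl, rfl⟩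
      · exact Or.inl ⟨b :: b₁, b₂, rfl, by simpa using hp, rfl⟩
      · exact Or.inr ⟨b :: b₁, c, b₂, s, s', rfl, hs, hs', h1, by simpa using hp, rfl⟩
    · by_cases hr : r = []
      · subst hr
        exact Or.inl ⟨[b], bs, rfl, by simpa using hb.symm, by simpa using hq⟩
      · by_cases hp : p = []
        · subst hp
          exact Or.inl ⟨[], b :: bs, rfl, rfl, by rw [List.flatMap_cons]; simpa using h.symm⟩
        · exact Or.inr ⟨[], b, bs, p, r, rfl, hp, hr, hb, by simp, hq⟩

namespace Graph1

variable {G : Graph1 V T R S H}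

theorem eq_half_of_term_eq_inr {x : Letter T R H} {σ : S} (h : G.term x = Sum.inr σ) :
    ∃ i, x = (Edge.half i, false) ∧ G.star i = σ := by
  obtain ⟨e | e | i, _ | _⟩ := x <;> simp [term, src, tgt] at h
  exact ⟨i, rfl, h⟩

theorem eq_half_of_init_eq_inr {x : Letter T R H} {σ : S} (h : G.init x = Sum.inr σ) :
    ∃ i, x = (Edge.half i, true) ∧ G.star i = σ := by
  obtain ⟨e | e | i, _ | _⟩ := x <;> simp [init, src, tgt] at h
  exact ⟨i, rfl, h⟩

end Graph1

namespace IsBetaTrainTrack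

variable {G : Complex V T R S H} {f : SelfMap G} {n : ℕ}
  {α : FreeGroup (Fin n) ≃* FreeGroup (Fin n)} {m : Marking G f n α} {s L M : ℕ}

theorem retr_auxWord_eq_retr_face (hf : IsBetaTrainTrack m) {h h' : H} (hh : G.IsAux h h') :
    G.retr (auxWord h h') = G.retr (G.face h h') := by
  obtain ⟨k, hk⟩ := Nat.exists_eq_succ_of_ne_zero (hf.depth_ne_zero hh)
  have h1 : G.retr (auxWord h h') = G.rhat^[k] (G.face h h') := by
    rw [retr, hk, Function.iterate_succ_apply, rhat_auxWord]
  have h2 : G.retr (G.face h h') = G.rhat (G.rhat^[k] (G.face h h')) := by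
    rw [retr, hk, Function.iterate_succ_apply']
  rw [h2, ← h1, rhat_of_inΓ (hf.retr_aux h h' hh).1]

theorem _root_.BetaTrainTrack.Complex.relLength_le_length_retr {u v : V} {p : Word T R H}
    (hp : G.IsPath (Sum.inl u) p (Sum.inl v)) : relLength p ≤ (G.retr p).length := by
  have key : ∀ bs : List (Letter T R H ⊕ (H × H)),
      relLength (bs.flatMap blockPath) ≤ (bs.flatMap G.blockRetr).length := by
    intro bs
    induction bs with
    | nil => simp
    | cons β bs ih =>
      rw [List.flatMap_cons, List.flatMap_cons, relLength_append, List.length_append]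
      refine add_le_add ?_ ih
      rcases β with x | ⟨h, h'⟩
      · exact relLength_le_length _
      · rw [blockPath, relLength_eq_zero.2 (inX_auxWord h h')]
        exact Nat.zero_le _
  obtain ⟨bs, hbs, rfl⟩ := exists_blocks hp
  rw [retr_blocks hp hbs]
  exact key bs

theorem head_eq_of_prefix (hf : IsBetaTrainTrack m) {h h' : H} (hh : G.IsAux h h')
    {x : Letter T R H} {q c : Word T R H} (hx : G.face h h' = x :: q) (hc : c ≠ [])
    (hcp : c <+: G.retr (auxWord h h')) : ∃ c', c = x :: c' := by
  obtain ⟨q', hq'⟩ := hf.retr_auxWord_eq_cons hh hx (hf.isTrain_of_face hh hx)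
  obtain ⟨y, c', rfl⟩ := List.exists_cons_of_ne_nil hc
  obtain ⟨r, hr⟩ := hcp
  rw [hq', List.cons_append, List.cons.injEq] at hr
  exact ⟨c', by rw [hr.1]⟩

/-- The image of a path `r(g) c`, where `g` is an initial subpath of the stretched edge `x` and `c`
is an initial piece of a pre-INP, follows the stretched edge for a long time. -/
theorem image_retr_append_prefix (hf : IsBetaTrainTrack m) (hs : f.IsNielsenExponent s L M)
    (hM : L < M) {x : Letter T R H} (hx : IsTrain x) {g c : Word T R H} {u v : V}
    (hg : G.IsPath (Sum.inl u) g (Sum.inl v)) (hgx : ∃ g', g = x :: g')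
    (hgR : g <+: tighten (f.iter s [x]))
    (hc : c = [] ∨ ∃ k k' y q c', G.IsAux k k' ∧ G.face k k' = y :: q ∧
      g ++ auxWord k k' <+: tighten (f.iter s [x]) ∧ f.image s c = y :: c') :
    ∃ p, p <+: f.image s (G.retr g ++ c) ∧ p <+: G.retr (tighten (f.iter s [x])) ∧
      M ≤ p.length := by
  have hSL := hf.stronglyLegal_tighten_iter (hf.stronglyLegal_of_isTrain hx) s
  obtain ⟨a, y, z, e, hy, hMy⟩ := hf.exists_stretched hs (by omega) hx
  obtain ⟨g', rfl⟩ := hgx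
  have hg_SL : f.StronglyLegal (x :: g') := by
    obtain ⟨r, hr⟩ := hgR
    rw [← hr] at hSL
    exact hSL.prefix hg
  have h1 := SelfMap.isPath_iter_inl (f := f) s hg
  obtain ⟨z', e'⟩ := RelReduced.tighten_append (w₁ := f.iter s [x]) (w₂ := f.iter s g')
    (by rw [← SelfMap.iter_append]; exact hg_SL.legal s hs.one_le)
    (by rw [← SelfMap.iter_append]; exact h1) e hy
  rw [← SelfMap.iter_append, List.singleton_append] at e'
  obtain ⟨u', v', hx'⟩ := exists_isPath_of_isTrain (G := G) hx
  have h2 := (SelfMap.isPath_iter_inl (f := f) s hx').tighten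
  have h3 := h1.tighten
  rw [e] at h2
  rw [e'] at h3
  obtain ⟨w, w', h4, h5, h6⟩ := IsPath.exists_cut_after h2 hy
  obtain ⟨w₁, w₁', h7, h8, h9⟩ := IsPath.exists_cut_after h3 hy
  have h10 : a ++ y :: z = (a ++ [y]) ++ z := by simp
  have h10' : a ++ y :: z' = (a ++ [y]) ++ z' := by simp
  have e1 : G.retr (tighten (f.iter s [x])) = G.retr (a ++ [y]) ++ G.retr z := by
    rw [e, h10, retr_append (h4.append h5)]
  have e2 : f.image s (x :: g') = G.retr (a ++ [y]) ++ G.retr z' := by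
    rw [hf.image_stronglyLegal s hg_SL, e', h10', retr_append (h7.append h8)]
  have hlen : M ≤ (G.retr (a ++ [y])).length :=
    hMy.trans (relLength_le_length_retr (h4.append h5))
  refine ⟨G.retr (a ++ [y]), ?_, ⟨_, e1.symm⟩, hlen⟩
  rw [SelfMap.image_append s (homotopic_retr hg).right, hf.image_retr s hg]
  rcases hc with rfl | ⟨k, k', y', q, c', hk, hface, hgk, hc⟩
  · rw [SelfMap.image_nil, List.append_nil,
      (f.isReduced_image s (x :: g')).tighten_eq, e2]
    exact List.prefix_append _ _
  · have hgk_SL : f.StronglyLegal (x :: g' ++ auxWord k k') := by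
      obtain ⟨r, hr⟩ := hgk
      have hSL' := hSL
      rw [← hr] at hSL
      obtain ⟨⟨a, b, hab⟩, -⟩ := id hSL
      obtain ⟨h11, h12⟩ := SelfMap.isPath_of_auxWord_append hk hab
      exact hSL.prefix (h11.append (isPath_auxWord hk.2))
    have h13 := hf.isReduced_image_append hs hM hx _ le_rfl ⟨g', rfl⟩ hg hk hface hgk_SL
    have h14 := SelfMap.isReduced_image (f := f) s c
    rw [hc] at h14 ⊢
    rw [(h13.glue h14).tighten_eq, e2, List.append_assoc]
    exact List.prefix_append _ _

/-- The same for every initial piece of `r(g) t`, where `t` runs along a pre-INP. The images of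
initial pieces of shorter pre-INPs are supposed to be controlled. -/
theorem image_prefix_of_branch (hf : IsBetaTrainTrack m) (hs : f.IsNielsenExponent s L M)
    (hM : L < M) {x : Letter T R H} (hx : IsTrain x) {ℓ : ℕ}
    (ih : ∀ h h', G.IsAux h h' → (G.retr (auxWord h h')).length < ℓ → ∀ c, c ≠ [] →
      c <+: G.retr (auxWord h h') → ∀ y q, G.face h h' = y :: q → ∃ c', f.image s c = y :: c')
    {g t d : Word T R H} {u v : V} (hg : G.IsPath (Sum.inl u) g (Sum.inl v))
    (hgx : ∃ g', g = x :: g') (hgR : g <+: tighten (f.iter s [x])) (hgℓ : (G.retr g).length ≤ ℓ)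
    (ht : t = [] ∨ ∃ h h' k k', G.IsAux h h' ∧ G.IsAux k k' ∧ t <+: G.retr (auxWord h h') ∧
      t <+: G.retr (auxWord k k') ∧ g ++ auxWord k k' <+: tighten (f.iter s [x]) ∧
      (G.retr g).length + (G.retr (auxWord h h')).length ≤ ℓ)
    (hd : d <+: G.retr g ++ t) (hd0 : d ≠ []) :
    ∃ p, p <+: f.image s d ∧ p <+: G.retr (tighten (f.iter s [x])) ∧ M ≤ p.length := by
  have hred : IsReduced g := by
    have := isReduced_tighten (f.iter s [x])
    obtain ⟨r, hr⟩ := hgR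
    rw [← hr] at this
    exact this.left
  obtain ⟨bs, hbs, hgbs⟩ := exists_properBlocks hg hred
  have hretr : G.retr g = bs.flatMap G.blockRetr := by
    rw [hgbs] at hg ⊢
    exact retr_blocks hg fun β hβ => (hbs β hβ).isBlock
  have hcase : d <+: G.retr g ∨ ∃ t₁, t₁ ≠ [] ∧ t₁ <+: t ∧ d = G.retr g ++ t₁ := by
    obtain ⟨r, hr⟩ := hd
    rcases List.append_eq_append_iff.1 hr with ⟨a, ha, -⟩ | ⟨a, ha, ha'⟩
    · exact Or.inl ⟨a, ha.symm⟩
    · by_cases h0 : a = []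
      · subst h0; exact Or.inl ⟨[], by simpa using ha⟩
      · exact Or.inr ⟨a, h0, ⟨r, ha'.symm⟩, ha⟩
  -- the piece `d` ends either in `r(g)`, between or inside of blocks, or in `t`
  rcases hcase with ⟨r, hr⟩ | ⟨t₁, ht₁, ht₁t, rfl⟩
  · have hpre : ∀ b₁ b₂, bs = b₁ ++ b₂ → ∃ w : V,
        G.IsPath (Sum.inl u) (b₁.flatMap blockPath) (Sum.inl w) := by
      intro b₁ b₂ e
      rw [hgbs, e, List.flatMap_append] at hg
      obtain ⟨w, h1, h2⟩ := isPath_append.1 hg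
      cases b₂ with
      | nil => exact ⟨v, by rw [show w = Sum.inl v from h2] at h1; exact h1⟩
      | cons β b₂ =>
        rw [List.flatMap_cons] at h2
        obtain ⟨w', h3, h4⟩ := isPath_append.1 h2
        obtain ⟨a, b, h5⟩ := (hbs β (by simp [e])).isBlock.exists_path
        obtain rfl := h3.start_unique h5 (blockPath_ne_nil β)
        exact ⟨a, h1⟩
    have hstart : ∀ b₁ b₂, bs = b₁ ++ b₂ → b₁ ≠ [] → ∃ g', b₁.flatMap blockPath = x :: g' := by
      intro b₁ b₂ e hne
      obtain ⟨g', hg'⟩ := hgx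
      rw [hg', e, List.flatMap_append] at hgbs
      have hne' : b₁.flatMap (blockPath (T := T) (R := R) (H := H)) ≠ [] := by
        obtain ⟨β, b₁, rfl⟩ := List.exists_cons_of_ne_nil hne
        simp [blockPath_ne_nil]
      obtain ⟨a, c, hac⟩ := List.exists_cons_of_ne_nil hne'
      rw [hac, List.cons_append, List.cons.injEq] at hgbs
      exact ⟨c, by rw [hac, hgbs.1]⟩
    rw [hretr] at hr
    rcases flatMap_cut _ hr.symm with ⟨b₁, b₂, hb, rfl, -⟩ |
      ⟨b₁, β, b₂, c, c', hb, hc, hc', hβ, rfl, -⟩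
    · obtain ⟨w, hw⟩ := hpre b₁ b₂ hb
      have := hf.image_retr_append_prefix hs hM hx hw
        (hstart b₁ b₂ hb (by rintro rfl; exact hd0 rfl))
        (by refine List.IsPrefix.trans ?_ hgR; rw [hgbs, hb]; simp) (c := []) (Or.inl rfl)
      rwa [List.append_nil, retr_blocks hw fun β hβ => (hbs β (by simp [hb, hβ])).isBlock] at this
    · obtain ⟨w, hw⟩ := hpre b₁ (β :: b₂) hb
      rcases β with y | ⟨h, h'⟩
      · have := congrArg List.length hβ
        have h1 := List.length_pos_iff.2 hc
        have h2 := List.length_pos_iff.2 hc'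
        simp [blockRetr] at this
        omega
      have hh : G.IsAux h h' := hbs (Sum.inr (h, h')) (by simp [hb])
      have hβ' : G.retr (auxWord h h') = c ++ c' := hβ
      have hne : b₁ ≠ [] := by
        rintro rfl
        obtain ⟨g', hg'⟩ := hgx
        rw [hg', hb] at hgbs
        simp only [List.nil_append, List.flatMap_cons, blockPath, auxWord, List.cons_append,
          List.cons.injEq] at hgbs
        exact hx.ne_half h (by rw [hgbs.1])
      obtain ⟨y, q, hyq, hyT⟩ := hf.face_eq_cons hh
      obtain ⟨g₁, hg₁⟩ := hstart b₁ _ hb hne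
      have hr₁ := retr_blocks hw fun β hβ => (hbs β (by simp [hb, hβ])).isBlock
      have hlt : (G.retr (auxWord h h')).length < ℓ := by
        have h1 : 0 < (b₁.flatMap G.blockRetr).length := by
          rw [← hr₁, hg₁, retr_cons hx.ne_half]; simp
        have h2 := hgℓ
        rw [hretr, hb] at h2
        simp only [List.flatMap_append, List.flatMap_cons, List.length_append] at h2
        have h3 : G.blockRetr (Sum.inr (h, h')) = G.retr (auxWord h h') := rfl
        rw [h3] at h2
        omega
      obtain ⟨c'', hc''⟩ := ih h h' hh hlt c hc ⟨c', hβ'.symm⟩ y q hyq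
      have := hf.image_retr_append_prefix hs hM hx hw ⟨g₁, hg₁⟩
        (by refine List.IsPrefix.trans ?_ hgR; rw [hgbs, hb]; simp) (c := c)
        (Or.inr ⟨h, h', y, q, c'', hh, hyq, by
          refine List.IsPrefix.trans ?_ hgR
          rw [hgbs, hb]; simp [blockPath], hc''⟩)
      rwa [hr₁] at this
  · rcases ht with rfl | ⟨h, h', k, k', hh, hk, htρ, htρ', hgk, hlen⟩
    · exact absurd (List.prefix_nil.1 ht₁t) ht₁
    · obtain ⟨y, q, hyq, hyT⟩ := hf.face_eq_cons hh
      obtain ⟨y', q', hyq', -⟩ := hf.face_eq_cons hk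
      obtain ⟨c₁, hc₁⟩ := hf.head_eq_of_prefix hh hyq ht₁ (ht₁t.trans htρ)
      obtain ⟨c₂, hc₂⟩ := hf.head_eq_of_prefix hk hyq' ht₁ (ht₁t.trans htρ')
      rw [hc₁, List.cons.injEq] at hc₂
      obtain ⟨rfl, -⟩ := hc₂
      have hpos : 0 < (G.retr g).length := by
        obtain ⟨g', rfl⟩ := hgx
        rw [retr_cons hx.ne_half]; simp
      obtain ⟨c'', hc''⟩ := ih h h' hh (by omega) t₁ ht₁ (ht₁t.trans htρ) y q hyq
      exact hf.image_retr_append_prefix hs hM hx hg hgx hgR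
        (Or.inr ⟨k, k', y, q', c'', hk, hyq', hgk, hc''⟩)

/-- The three pre-INPs of three auxiliary half-edges with a common auxiliary vertex form a
tripod. -/
theorem exists_tripod (hf : IsBetaTrainTrack m) {i j k : H} (hij : G.IsAux i j)
    (hik : G.IsAux i k) (hkj : G.IsAux k j) : ∃ t c t',
    G.retr (auxWord i k) = t ++ c ∧ G.retr (auxWord k j) = invRev c ++ t' ∧
      G.retr (auxWord i j) = t ++ t' := by
  obtain ⟨t, c, t', h1, h2, h3⟩ := exists_cancellation (hf.retr_aux i k hik).2
    (hf.retr_aux k j hkj).2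
  refine ⟨t, c, t', h1, h2, (hf.retr_aux i j hij).2.eq_of_mk h3 ?_⟩
  have hp := (isPath_auxWord (G := G.toGraph1) hik.2).append
    (isPath_auxWord (G := G.toGraph1) hkj.2)
  have hred : FreeGroup.Red (auxWord i k ++ auxWord k j : Word T R H) (auxWord i j) :=
    Relation.ReflTransGen.single
      (FreeGroup.Red.Step.not (L₁ := [(Edge.half i, false)]) (L₂ := [(Edge.half j, true)]))
  have := hf.retr_homotopic _ _ _ _ (Homotopic.of_red hp hred)
  rw [retr_append (isPath_auxWord hik.2)] at this
  rw [← this, ← tighten_eq_of_cancellation h1 h2 h3, mk_tighten]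

/-- A pre-INP consists of two parts `P` and `Q⁻¹`, such that the images of the two extremal edges
of the INP run along `P` and `Q` respectively, and then together along a long path. Moreover the
images of the initial pieces of `P` and `Q` follow the images of the extremal edges. -/
theorem exists_retr_branches (hf : IsBetaTrainTrack m) (hs : f.IsNielsenExponent s L M)
    (hM : L < M) {h h' : H} (hh : G.IsAux h h') {x x' : Letter T R H} {q q' : Word T R H}
    (hx : G.face h h' = x :: q) (hx' : G.face h h' = q' ++ [x'])
    (ih : ∀ k k', G.IsAux k k' → (G.retr (auxWord k k')).length < (G.retr (auxWord h h')).length →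
      ∀ c, c ≠ [] → c <+: G.retr (auxWord k k') → ∀ y q, G.face k k' = y :: q →
      ∃ c', f.image s c = y :: c') :
    ∃ P Q c ζ ζ', G.retr (auxWord h h') = P ++ invRev Q ∧
      G.retr (tighten (f.iter s [x])) = P ++ c ++ ζ ∧
      G.retr (tighten (f.iter s [rev x'])) = Q ++ c ++ ζ' ∧ M ≤ c.length + L ∧
      (∀ d, d <+: P → d ≠ [] → ∃ p, p <+: f.image s d ∧
        p <+: G.retr (tighten (f.iter s [x])) ∧ M ≤ p.length) ∧
      (∀ d, d <+: Q → d ≠ [] → ∃ p, p <+: f.image s d ∧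
        p <+: G.retr (tighten (f.iter s [rev x'])) ∧ M ≤ p.length) := by
  have hxT := hf.isTrain_of_face hh hx
  have hxT' : IsTrain (rev x') := hf.isTrain_of_face hh.symm (q := invRev q')
    (by rw [G.face_rev h h' hh, hx', invRev_append_singleton])
  obtain ⟨A, B, C, Z, Z', y, hAB, hA, hB, hy, hR, hR', hC⟩ := hf.exists_branches hs hM hh hx hx'
  have hface := G.face_path h h' hh
  rw [hAB] at hface
  obtain ⟨w, hAp, hBp⟩ := isPath_append.1 hface
  obtain ⟨A', rfl⟩ : ∃ A', A = x :: A' := by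
    obtain ⟨a, A, rfl⟩ := List.exists_cons_of_ne_nil hA
    rw [hx, List.cons_append, List.cons.injEq] at hAB
    exact ⟨A, by rw [hAB.1]⟩
  obtain ⟨B', rfl⟩ : ∃ B', B = B' ++ [x'] := by
    rcases List.eq_nil_or_concat B with rfl | ⟨B, b, rfl⟩
    · exact absurd rfl hB
    · rw [hx', List.concat_eq_append, ← List.append_assoc] at hAB
      have := List.append_inj_right' hAB rfl
      simp only [List.cons.injEq, and_true] at this
      exact ⟨B, by rw [this]; simp⟩
  obtain ⟨u₀, u₁, hxp⟩ := exists_isPath_of_isTrain (G := G) hxT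
  obtain ⟨u₀', u₁', hxp'⟩ := exists_isPath_of_isTrain (G := G) hxT'
  have hRp := (SelfMap.isPath_iter_inl (f := f) s hxp).tighten
  have hRp' := (SelfMap.isPath_iter_inl (f := f) s hxp').tighten
  have hRr := isReduced_tighten (f.iter s [x])
  have hRr' := isReduced_tighten (f.iter s [rev x'])
  have hface_red := hf.isReduced_face hh
  have hρ := hf.retr_auxWord_eq_retr_face hh
  rw [hAB] at hρ hface_red
  have hpre : x :: A' <+: tighten (f.iter s [x]) := ⟨C ++ [y] ++ Z, by rw [hR]; simp⟩
  have hpre' : invRev (B' ++ [x']) <+: tighten (f.iter s [rev x']) :=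
    ⟨C ++ [y] ++ Z', by rw [hR']; simp⟩
  rw [hR] at hRp hRr
  rw [hR'] at hRp' hRr'
  obtain ⟨w₁, hw₁, hZp⟩ := isPath_append.1 hRp
  obtain ⟨w₂, hw₂, hCp⟩ := isPath_append.1 hw₁
  obtain ⟨w₁', hw₁', -⟩ := isPath_append.1 hRp'
  obtain ⟨w₂', hw₂', hCp'⟩ := isPath_append.1 hw₁'
  obtain rfl : w₂ = w := by
    have e := hw₂.start_unique hAp (by simp)
    rw [e] at hw₂
    exact hw₂.end_unique hAp
  obtain ⟨_, b, hCp₁, hCp₂, hCp₃⟩ := IsPath.exists_cut_after hCp hy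
  obtain rfl : w₁ = Sum.inl b := hCp₃.symm
  rcases w₂ with w | σ
  · -- the branches separate at a vertex of `Γ`
    have hAp0 := hAp
    rw [← hAp.start_unique hw₂ (by simp)] at hw₁ hw₂
    have hBinv := hBp.invRev
    rw [← hBinv.start_unique hw₂' (by simp)] at hw₁' hw₂'
    obtain rfl := hw₂'.end_unique hBinv
    obtain rfl := hCp'.end_unique hCp
    rw [retr_append hAp] at hρ
    have hlen : (G.retr (x :: A')).length ≤ (G.retr (auxWord h h')).length := by
      rw [hρ]; simp
    have hlen' : (G.retr (invRev (B' ++ [x']))).length ≤ (G.retr (auxWord h h')).length := by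
      rw [hρ, retr_invRev hBp]; simp
    refine ⟨G.retr (x :: A'), G.retr (invRev (B' ++ [x'])), G.retr (C ++ [y]), G.retr Z,
      G.retr Z', ?_, ?_, ?_, ?_, ?_, ?_⟩
    · rw [hρ, retr_invRev hBp, FreeGroup.invRev_invRev]
    · rw [hR, retr_append hw₁, retr_append hw₂]
    · rw [hR', retr_append hw₁', retr_append hw₂']
    · exact hC.trans (Nat.add_le_add_right (relLength_le_length_retr hCp) L)
    · exact fun d hd hd0 => hf.image_prefix_of_branch hs hM hxT ih hAp ⟨A', rfl⟩ hpre hlen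
        (t := []) (Or.inl rfl) (by simpa using hd) hd0
    · exact fun d hd hd0 => hf.image_prefix_of_branch hs hM hxT' ih hBinv
        ⟨invRev B', invRev_append_singleton _ _⟩ hpre' hlen' (t := []) (Or.inl rfl)
        (by simpa using hd) hd0
  · -- the branches separate at an auxiliary vertex
    obtain ⟨g, i, rfl, hi⟩ : ∃ g i, A' = g ++ [(Edge.half i, false)] ∧ G.star i = σ := by
      rcases List.eq_nil_or_concat A' with rfl | ⟨g, a, rfl⟩
      · obtain ⟨w', hw'⟩ := exists_term_eq_inl (G := G.toGraph1) hxT.ne_half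
        rw [show G.term x = Sum.inr σ from hAp.2] at hw'
        simp at hw'
      · rw [List.concat_eq_append, ← List.cons_append] at hAp
        obtain ⟨_, -, h1⟩ := isPath_append.1 hAp
        obtain ⟨i, rfl, hi⟩ := eq_half_of_term_eq_inr h1.2
        exact ⟨g, i, by simp, hi⟩
    obtain ⟨g', j, rfl, hj⟩ : ∃ g' j, B' = (Edge.half j, true) :: g' ∧ G.star j = σ := by
      cases B' with
      | nil =>
        obtain ⟨w', hw'⟩ := exists_init_eq_inl (G := G.toGraph1) (x := x') hxT'.ne_half
        rw [show G.init x' = Sum.inr σ from hBp.1] at hw'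
        simp at hw'
      | cons a g' =>
        obtain ⟨j, rfl, hj⟩ := eq_half_of_init_eq_inr (show G.init a = Sum.inr σ from hBp.1)
        exact ⟨g', j, rfl, hj⟩
    obtain ⟨C₁, k, hC₁, hk⟩ : ∃ C₁ k, C ++ [y] = (Edge.half k, true) :: C₁ ∧ G.star k = σ := by
      obtain ⟨a, C₁, hC₁⟩ := List.exists_cons_of_ne_nil (l := C ++ [y]) (by simp)
      rw [hC₁] at hCp
      obtain ⟨k, rfl, hk⟩ := eq_half_of_init_eq_inr (show G.init a = Sum.inr σ from hCp.1)
      exact ⟨C₁, k, hC₁, hk⟩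
    have eA : x :: (g ++ [(Edge.half i, false)]) = (x :: g) ++ [(Edge.half i, false)] := by simp
    have eB : invRev ((Edge.half j, true) :: g' ++ [x']) =
        invRev (g' ++ [x']) ++ [(Edge.half j, false)] := by
      rw [List.cons_append, invRev_cons_rev]; rfl
    have hij : G.IsAux i j := by
      refine ⟨?_, by rw [hi, hj]⟩
      rintro rfl
      exact FreeGroup.IsReduced.ne_rev (a := x :: g) (x := (Edge.half i, false))
        (y := (Edge.half i, true)) (b := g' ++ [x']) (by simpa using hface_red) rfl
    have hik : G.IsAux i k := by
      refine ⟨?_, by rw [hi, hk]⟩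
      rintro rfl
      rw [hC₁] at hRr
      exact FreeGroup.IsReduced.ne_rev (a := x :: g) (x := (Edge.half i, false))
        (y := (Edge.half i, true)) (b := C₁ ++ Z) (by simpa using hRr) rfl
    have hkj : G.IsAux k j := by
      refine ⟨?_, by rw [hk, hj]⟩
      rintro rfl
      rw [hC₁, eB] at hRr'
      exact FreeGroup.IsReduced.ne_rev (a := invRev (g' ++ [x'])) (x := (Edge.half k, false))
        (y := (Edge.half k, true)) (b := C₁ ++ Z') (by simpa using hRr') rfl
    obtain ⟨t, c, t', ht, ht', htt'⟩ := hf.exists_tripod hij hik hkj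
    have hjk' : G.retr (auxWord j k) = invRev t' ++ c := by
      rw [retr_auxWord_symm hkj, ht']; simp [FreeGroup.invRev_append]
    have hji' : G.retr (auxWord j i) = invRev t' ++ invRev t := by
      rw [retr_auxWord_symm hij, htt']; simp [FreeGroup.invRev_append]
    -- the pre-INP turns from the leg `t` of the tripod into the leg `t'`, whereas both stretched
    -- edges turn into the leg `c`
    have hmid : G.face h h' = (x :: g) ++ auxWord i j ++ (g' ++ [x']) := by
      rw [hAB]; simp [auxWord]
    have hfp := G.face_path h h' hh
    rw [hmid] at hfp
    obtain ⟨hgp, hgp'⟩ := SelfMap.isPath_of_auxWord_append hij hfp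
    have hgi := hgp'.invRev
    have eR : tighten (f.iter s [x]) = (x :: g) ++ auxWord i k ++ (C₁ ++ Z) := by
      rw [hR, hC₁]; simp [auxWord]
    have eR' : tighten (f.iter s [rev x']) =
        invRev (g' ++ [x']) ++ auxWord j k ++ (C₁ ++ Z') := by
      rw [hR', hC₁, eB]; simp [auxWord]
    have hC₁p : G.IsPath (Sum.inl (G.foot k)) C₁ (Sum.inl b) := by
      rw [hC₁] at hCp
      exact hCp.2
    have hρ' : G.retr (auxWord h h') =
        G.retr (x :: g) ++ (t ++ t') ++ G.retr (g' ++ [x']) := by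
      rw [hf.retr_auxWord_eq_retr_face hh, hmid, List.append_assoc, retr_append hgp,
        retr_append (isPath_auxWord hij.2), htt']
      simp
    have hlen := congrArg List.length hρ'
    simp only [List.length_append] at hlen
    have htt'l : (G.retr (auxWord i j)).length = t.length + t'.length := by
      rw [htt', List.length_append]
    have htt'l' : (G.retr (auxWord j i)).length = t.length + t'.length := by
      rw [hji', List.length_append]; simp [add_comm]
    have hgl : (G.retr (invRev (g' ++ [x']))).length = (G.retr (g' ++ [x'])).length := by
      rw [retr_invRev hgp', FreeGroup.invRev_length]
    have hrC : relLength (C ++ [y]) ≤ (G.retr C₁).length := by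
      rw [hC₁, relLength_cons, relLength_eq_zero.2 (by
        rintro a ha ⟨e, he⟩
        rw [List.mem_singleton.1 ha] at he
        simp at he), zero_add]
      exact relLength_le_length_retr hC₁p
    refine ⟨G.retr (x :: g) ++ t, G.retr (invRev (g' ++ [x'])) ++ invRev t',
      c ++ G.retr C₁, G.retr Z, G.retr Z', ?_, ?_, ?_, ?_, ?_, ?_⟩
    · rw [hρ', retr_invRev hgp']; simp [FreeGroup.invRev_append]
    · rw [eR, List.append_assoc, retr_append hgp, retr_append (isPath_auxWord hik.2),
        retr_append hC₁p, ht]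
      simp
    · rw [eR', List.append_assoc, retr_append hgi, retr_append (isPath_auxWord (hkj.2.symm)),
        retr_append hC₁p, hjk']
      simp
    · rw [List.length_append]; omega
    · refine fun d hd hd0 => hf.image_prefix_of_branch hs hM hxT ih hgp ⟨g, rfl⟩
        (by rw [eR, List.append_assoc]; exact List.prefix_append _ _) (by omega) (t := t)
        (Or.inr ⟨i, j, i, k, hij, hik, ⟨t', htt'.symm⟩, ⟨c, ht.symm⟩, ?_, by omega⟩) hd hd0
      rw [eR]; exact List.prefix_append _ _
    · refine fun d hd hd0 => hf.image_prefix_of_branch hs hM hxT' ih hgi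
        ⟨invRev g', invRev_append_singleton _ _⟩
        (by rw [eR', List.append_assoc]; exact List.prefix_append _ _) (by omega) (t := invRev t')
        (Or.inr ⟨j, i, j, k, hij.symm, hkj.symm, ⟨invRev t, hji'.symm⟩, ⟨c, hjk'.symm⟩, ?_,
          by omega⟩) hd hd0
      rw [eR']; exact List.prefix_append _ _

/-- `image_of_prefix`, by induction on the length of the pre-INP: the pre-INPs which the two branches
cross are shorter. -/
theorem image_prefix_of_retr_auxWord_aux (hf : IsBetaTrainTrack m)
    (hs : f.IsNielsenExponent s L M) (hM : 2 * L < M) (ℓ : ℕ) : ∀ {h h' : H}, G.IsAux h h' →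
    (G.retr (auxWord h h')).length < ℓ → ∀ c d, G.retr (auxWord h h') = c ++ d → c ≠ [] →
    ∀ x q, G.face h h' = x :: q →
      (∃ c', f.image s c = x :: c') ∧ (d ≠ [] → L < (f.image s c).length) := by
  induction ℓ with
  | zero => intro h h' _ h0; omega
  | succ ℓ ihℓ =>
    intro h h' hh hℓ c d hcd hc x q hx
    by_cases hd : d = []
    · subst hd
      rw [List.append_nil] at hcd
      refine ⟨?_, fun h => absurd rfl h⟩
      rw [← hcd, hf.image_retr_auxWord hs hh]
      exact hf.head_eq_of_prefix hh hx (by rw [hcd]; exact hc) (List.prefix_rfl)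
    obtain ⟨q', x', hx', -⟩ := hf.face_eq_append hh
    have hxT := hf.isTrain_of_face hh hx
    obtain ⟨P, Q, e, ζ, ζ', hρ, hR, hR', he, hP, hQ⟩ := hf.exists_retr_branches hs (by omega) hh
      hx hx' fun k k' hk hlt c hc hcp y q hy => by
        obtain ⟨r, hr⟩ := hcp
        exact (ihℓ hk (by omega) c r hr.symm hc y q hy).1
    obtain ⟨r₁, hr₁⟩ := hf.exists_tighten_iter_eq_cons hs (by omega) hh hx
    have hRx : ∃ r, G.retr (tighten (f.iter s [x])) = x :: r :=
      ⟨_, by rw [hr₁, retr_cons hxT.ne_half]⟩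
    obtain ⟨r, hr⟩ := hRx
    have key : ∀ p : Word T R H, p <+: f.image s c → p <+: G.retr (tighten (f.iter s [x])) →
        L < p.length → (∃ c', f.image s c = x :: c') ∧ (d ≠ [] → L < (f.image s c).length) := by
      rintro p ⟨b, hb⟩ ⟨b', hb'⟩ hp
      refine ⟨?_, fun _ => ?_⟩
      · obtain ⟨y, p, rfl⟩ := List.exists_cons_of_ne_nil (l := p) (by rintro rfl; simp at hp)
        rw [hr, List.cons_append, List.cons.injEq] at hb'
        rw [← hb, List.cons_append, hb'.1]
        exact ⟨_, rfl⟩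
      · rw [← hb, List.length_append]; omega
    have hLρ := hs.length_retr h h'
    rw [hcd] at hρ
    rcases List.append_eq_append_iff.1 hρ with ⟨b, hb, hb'⟩ | ⟨b, hb, hb'⟩
    · obtain ⟨p, h1, h2, h3⟩ := hP c ⟨b, hb.symm⟩ hc
      exact key p h1 h2 (by omega)
    · -- the complementary piece is an initial piece of the other branch
      have hQd : Q = invRev d ++ invRev b := by
        rw [← FreeGroup.invRev_append, ← hb', FreeGroup.invRev_invRev]
      obtain ⟨p, ⟨p', hp'⟩, ⟨p'', hp''⟩, h3⟩ := hQ (invRev d) ⟨invRev b, hQd.symm⟩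
        (by rw [Ne, invRev_eq_nil]; exact hd)
      have hQL : Q.length ≤ L := by
        have := congrArg List.length hρ
        rw [← hcd] at this
        simp only [List.length_append, FreeGroup.invRev_length] at this
        omega
      -- the stretched edges continue with `e₁` behind `P` and `Q`, so that the cancellation of the
      -- pre-INP against the image of the complementary piece stops in front of `e₁`
      obtain ⟨e₁, e₂, rfl, he₁⟩ : ∃ e₁ e₂, e = e₁ ++ e₂ ∧ e₁.length = M - L :=
        ⟨e.take (M - L), e.drop (M - L), (List.take_append_drop _ _).symm, by
          rw [List.length_take]; omega⟩
      have hpp : Q ++ e₁ <+: p := by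
        refine List.prefix_of_prefix_length_le (l₃ := G.retr (tighten (f.iter s [rev x'])))
          ⟨e₂ ++ ζ', by rw [hR']; simp⟩ ⟨p'', hp''⟩ ?_
        rw [List.length_append]; omega
      obtain ⟨p₀, rfl⟩ := hpp
      have hpath := (homotopic_retr (isPath_auxWord (G := G.toGraph1) hh.2)).right
      have hΓ := (hf.retr_aux h h' hh).1
      rw [hcd] at hpath hΓ
      obtain ⟨w, hcp, hdp⟩ := IsPath.exists_cut_of_inΓ hpath (hΓ.infix ⟨[], d, by simp⟩)
      have himg : f.image s c = P ++ (e₁ ++ (p₀ ++ p')) := by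
        have h4 : f.image s c = f.image s (c ++ d ++ invRev d) :=
          hf.image_congr s (Homotopic.of_mk hcp (hpath.append hdp.invRev)
            (by simp only [mk_append, mk_invRev]; group))
        rw [h4, SelfMap.image_append s hpath, ← hcd, hf.image_retr_auxWord hs hh, ← hp']
        have hρ' : G.retr (auxWord h h') = P ++ invRev Q := by rw [hcd, hρ]
        refine tighten_eq_of_cancellation hρ' (by rw [FreeGroup.invRev_invRev]; simp) ?_
        have hne : e₁ ≠ [] := by
          rintro rfl; simp at he₁; omega
        have h5 : IsReduced (P ++ e₁) := by
          have := hf.isReduced_retr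
            (hf.stronglyLegal_tighten_iter (hf.stronglyLegal_of_isTrain hxT) s)
          rw [hR] at this
          refine FreeGroup.IsReduced.left (b := e₂ ++ ζ) ?_
          simpa using this
        have h6 : IsReduced (e₁ ++ (p₀ ++ p')) := by
          have := f.isReduced_image s (invRev d)
          rw [← hp'] at this
          refine FreeGroup.IsReduced.right (a := Q) ?_
          simpa using this
        rw [← List.append_assoc]
        exact h5.glue_append h6 hne
      refine key (P ++ e₁) ?_ ⟨e₂ ++ ζ, by rw [hR]; simp⟩ (by rw [List.length_append]; omega)
      rw [himg, ← List.append_assoc]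
      exact List.prefix_append _ _

/-- The image of an initial piece of a pre-INP starts with the initial edge of the INP, and it is
long unless the piece is the whole pre-INP. -/
theorem image_of_prefix (hf : IsBetaTrainTrack m) (hs : f.IsNielsenExponent s L M)
    (hM : 2 * L < M) {h h' : H} (hh : G.IsAux h h') {c d : Word T R H}
    (hcd : G.retr (auxWord h h') = c ++ d) (hc : c ≠ []) {x : Letter T R H} {q : Word T R H}
    (hx : G.face h h' = x :: q) :
    (∃ c', f.image s c = x :: c') ∧ (d ≠ [] → L < (f.image s c).length) :=
  hf.image_prefix_of_retr_auxWord_aux hs hM _ hh (Nat.lt_succ_self _) c d hcd hc x q hx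

theorem image_of_suffix (hf : IsBetaTrainTrack m) (hs : f.IsNielsenExponent s L M)
    (hM : 2 * L < M) {h h' : H} (hh : G.IsAux h h') {c d : Word T R H}
    (hcd : G.retr (auxWord h h') = c ++ d) (hd : d ≠ []) {x : Letter T R H} {q : Word T R H}
    (hx : G.face h h' = q ++ [x]) :
    (∃ d', f.image s d = d' ++ [x]) ∧ (c ≠ [] → L < (f.image s d).length) := by
  have hpath := (homotopic_retr (isPath_auxWord (G := G.toGraph1) hh.2)).right
  have hΓ := (hf.retr_aux h h' hh).1
  have hrev := retr_auxWord_symm hh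
  rw [hcd] at hpath hΓ hrev
  obtain ⟨w, hcp, hdp⟩ := IsPath.exists_cut_of_inΓ hpath (hΓ.infix ⟨[], d, by simp⟩)
  rw [FreeGroup.invRev_append] at hrev
  obtain ⟨⟨c', hc'⟩, h2⟩ := hf.image_of_prefix hs hM hh.symm hrev
    (by rwa [Ne, invRev_eq_nil]) (x := rev x) (q := invRev q)
    (by rw [G.face_rev h h' hh, hx, invRev_append_singleton])
  rw [SelfMap.image_invRev s hdp] at hc' h2
  refine ⟨⟨invRev c', ?_⟩, fun hc => ?_⟩
  · rw [← FreeGroup.invRev_invRev (L₁ := f.image s d), hc', invRev_cons_rev, rev_rev]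
  · have := h2 (by rwa [Ne, invRev_eq_nil])
    rwa [FreeGroup.invRev_length] at this

end IsBetaTrainTrack

/-! ### Pre-INPs in the retraction of a strongly legal path in the relative part -/

namespace IsBetaTrainTrack

variable {G : Complex V T R S H} {f : SelfMap G} {n : ℕ}
  {α : FreeGroup (Fin n) ≃* FreeGroup (Fin n)} {m : Marking G f n α} {s L M : ℕ}

/-- Reduced paths in the relative part are determined by their retractions. -/
theorem eq_of_retr_eq (hf : IsBetaTrainTrack m) {p q : Word T R H} {u v u' v' : V}
    (hp : G.IsPath (Sum.inl u) p (Sum.inl v)) (hq : G.IsPath (Sum.inl u') q (Sum.inl v'))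
    (hpX : InX p) (hqX : InX q) (hpr : IsReduced p) (hqr : IsReduced q)
    (h : G.retr p = G.retr q) (hne : G.retr p ≠ []) : p = q := by
  have h1 := homotopic_retr hp
  have h2 := homotopic_retr hq
  rw [← h] at h2
  have e1 := h1.right.start_unique h2.right hne
  rw [← e1] at h2 hq
  have e2 := h1.right.end_unique h2.right
  rw [← e2] at h2 hq
  have h3 : G.Homotopic (Sum.inl u) (Sum.inl u) (p ++ invRev q) [] :=
    ((h1.trans h2.symm).append_right hq.invRev).trans
      (Homotopic.of_mk (hq.append hq.invRev) rfl
        (by simp only [mk_append, mk_invRev, mk_nil, mul_inv_cancel]))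
  have h4 := hf.X_inj _ _ h3.left (inX_append.2 ⟨hpX, inX_invRev.2 hqX⟩) h3
  rw [mk_append, mk_invRev, mul_inv_eq_one] at h4
  exact hpr.eq_of_mk hqr h4

theorem retr_auxWord_ne_nil (hf : IsBetaTrainTrack m) {h h' : H} (hh : G.IsAux h h') :
    G.retr (auxWord h h') ≠ [] := by
  obtain ⟨x, q, hx, hT⟩ := hf.face_eq_cons hh
  obtain ⟨q', hq'⟩ := hf.retr_auxWord_eq_cons hh hx hT
  rw [hq']; simp

theorem isReduced_auxWord {h h' : H} (hh : G.IsAux h h') :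
    IsReduced (auxWord h h' : Word T R H) := by
  have : IsReduced ([(Edge.half h, false)] ++ [(Edge.half h', true)] : Word T R H) := by
    refine FreeGroup.IsReduced.singleton.append FreeGroup.IsReduced.singleton ?_
    intro a ha b hb
    simp only [List.getLast?_singleton, Option.mem_def, Option.some.injEq, List.head?_cons]
      at ha hb
    subst ha hb
    intro e
    simp only [rev, Prod.mk.injEq, Edge.half.injEq] at e
    exact hh.1 e.1.symm
  exact this

/-- Different auxiliary edges have different pre-INPs. -/
theorem eq_of_retr_auxWord_eq (hf : IsBetaTrainTrack m) {h h' k k' : H} (hh : G.IsAux h h')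
    (hk : G.IsAux k k') (e : G.retr (auxWord h h') = G.retr (auxWord k k')) :
    h = k ∧ h' = k' := by
  have := hf.eq_of_retr_eq (isPath_auxWord hh.2) (isPath_auxWord hk.2) (inX_auxWord h h')
    (inX_auxWord k k') (isReduced_auxWord hh) (isReduced_auxWord hk) e
    (hf.retr_auxWord_ne_nil hh)
  simpa [auxWord] using this

/-- Behind an auxiliary edge of a strongly legal path in the relative part, the image of an initial
piece of the retraction does not cancel against the pre-INP of this auxiliary edge, and it is long
unless the piece is the retraction of a subpath. The word `z` collects the edges of `Γ` between the
auxiliary edge and the remaining blocks. -/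
theorem image_prefix_in_X (hf : IsBetaTrainTrack m) (hs : f.IsNielsenExponent s L M)
    (hM : 2 * L < M) (bs : List (Letter T R H ⊕ (H × H))) : ∀ {h h' : H} {y : Letter T R H}
    {q z ρ : Word T R H}, G.IsAux h h' → G.face h h' = q ++ [y] →
    (∀ β ∈ bs, G.IsProperBlock β) → InX z → InΓ z →
    f.StronglyLegal (auxWord h h' ++ (z ++ bs.flatMap blockPath)) →
    InX (bs.flatMap blockPath) → ρ <+: bs.flatMap G.blockRetr →
    (∃ ρ' x, ρ = ρ' ++ [x] ∧ IsTrain x) →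
    IsReduced (y :: f.image s (z ++ ρ)) ∧
      ((∃ b₁ b₂, bs = b₁ ++ b₂ ∧ ρ = b₁.flatMap G.blockRetr) ∨
        L < (f.image s (z ++ ρ)).length) := by
  induction bs with
  | nil =>
    rintro h h' y q z ρ - - - - - - - hρ ⟨ρ', x, rfl, -⟩
    simp at hρ
  | cons β bs ih =>
    rintro h h' y q z ρ hh hy hbs hz hzΓ hSL hX ⟨r, hr⟩ hlast
    have hbs' : ∀ β ∈ bs, G.IsProperBlock β := fun β hβ => hbs β (by simp [hβ])
    rw [List.flatMap_cons] at hSL hX hr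
    rw [inX_append] at hX
    obtain ⟨⟨u, v, hpath⟩, -⟩ := id hSL
    obtain ⟨-, hp⟩ := SelfMap.isPath_of_auxWord_append (a := []) hh hpath
    rcases β with a | ⟨k, k'⟩
    · -- an edge of the relative part
      have haΓ : InΓ ([a] : Word T R H) := fun b hb => by
        rw [List.mem_singleton.1 hb]; exact hbs (Sum.inl a) (by simp)
      obtain ⟨ρ', x, hρ', hxT⟩ := hlast
      have haT : ¬ IsTrain a := hX.1 a (by simp [blockPath])
      obtain ⟨c, hc⟩ : ∃ c, ρ = a :: c := by
        cases ρ with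
        | nil => simp at hρ'
        | cons b c =>
          simp only [blockRetr, List.cons_append, List.nil_append, List.cons.injEq] at hr
          exact ⟨c, by rw [hr.1]⟩
      subst hc
      have hr' : c ++ r = bs.flatMap G.blockRetr := by
        simpa [blockRetr] using hr
      have hlast' : ∃ c' x, c = c' ++ [x] ∧ IsTrain x := by
        cases ρ' with
        | nil =>
          simp only [List.nil_append, List.cons.injEq] at hρ'
          exact absurd (hρ'.1 ▸ hxT) haT
        | cons b ρ' =>
          simp only [List.cons_append, List.cons.injEq] at hρ'
          exact ⟨ρ', x, hρ'.2, hxT⟩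
      have := ih (z := z ++ [a]) (ρ := c) hh hy hbs' (inX_append.2 ⟨hz, hX.1⟩)
        (inΓ_append.2 ⟨hzΓ, haΓ⟩) (by simpa [blockPath] using hSL) hX.2 ⟨r, hr'⟩ hlast'
      rw [List.append_assoc, List.singleton_append] at this
      refine ⟨this.1, this.2.imp ?_ id⟩
      rintro ⟨b₁, b₂, rfl, rfl⟩
      exact ⟨Sum.inl a :: b₁, b₂, rfl, by simp [blockRetr]⟩
    · have hk : G.IsAux k k' := hbs (Sum.inr (k, k')) (by simp)
      obtain ⟨x, q₁, hx, hxT⟩ := hf.face_eq_cons hk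
      obtain ⟨q₂, y₂, hy₂, hy₂T⟩ := hf.face_eq_append hk
      have hyT : IsTrain y := by
        obtain ⟨q', y', e, hT⟩ := hf.face_eq_append hh
        rw [hy] at e
        have := List.append_inj_right' e rfl
        simp only [List.cons.injEq, and_true] at this
        exact this ▸ hT
      simp only [blockPath] at hp hSL hX
      rw [← List.append_assoc] at hp
      obtain ⟨hzp, hbp⟩ := SelfMap.isPath_of_auxWord_append hk hp
      have haux := isPath_auxWord (G := G.toGraph1) hh.2
      have hzr : IsReduced z := hSL.isReduced.right.left
      have hSL₁ : f.StronglyLegal ((auxWord h h' ++ z) ++ auxWord k k') := by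
        have e : auxWord h h' ++ (z ++ (auxWord k k' ++ bs.flatMap blockPath)) =
          ((auxWord h h' ++ z) ++ auxWord k k') ++ bs.flatMap blockPath := by simp
        rw [e] at hSL
        exact hSL.prefix ((haux.append hzp).append (isPath_auxWord hk.2))
      have hleg := hf.legal_turn hSL₁ (haux.append hzp) hk hx (p := q) (y := y) (z := z)
        (by rw [rhat_auxWord_append, hy, rhat_of_inΓ hzΓ]; simp) hyT hz
      have hturn : ∃ w, G.IsPath w (y :: (z ++ [x])) (G.term x) := by
        have h1 := G.face_path h h' hh
        rw [hy] at h1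
        obtain ⟨w, -, h2⟩ := isPath_append.1 h1
        have h3 := G.face_path k k' hk
        rw [hx] at h3
        exact ⟨w, h2.append (hzp.append (w := Sum.inl (G.foot k)) ⟨h3.1, rfl⟩)⟩
      obtain ⟨w, hturn⟩ := hturn
      have hred := hf.isReduced_image_turn' hs (by omega) hk hh hx hy hyT hz hzΓ hzr hleg hturn
      have hr' : ρ ++ r = G.retr (auxWord k k') ++ bs.flatMap G.blockRetr := hr
      rcases List.append_eq_append_iff.1 hr' with ⟨d, hd, -⟩ | ⟨ρ₁, hρ₁, hρ₁'⟩
      · have hρ0 : ρ ≠ [] := by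
          obtain ⟨ρ', x, rfl, -⟩ := hlast
          simp
        obtain ⟨⟨c', hc'⟩, h2⟩ := hf.image_of_prefix hs hM hk hd hρ0 hx
        have h3 : IsReduced ((y :: f.image s z) ++ x :: c') := by
          have := f.isReduced_image s ρ
          rw [hc'] at this
          exact FreeGroup.IsReduced.glue (by simpa using hred) this
        have h4 : f.image s (z ++ ρ) = f.image s z ++ x :: c' := by
          rw [SelfMap.image_append s hzp, hc']
          exact (FreeGroup.IsReduced.right (a := [y]) (by simpa using h3)).tighten_eq
        refine ⟨by rw [h4]; simpa using h3, ?_⟩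
        by_cases hd0 : d = []
        · subst hd0
          exact Or.inl ⟨[Sum.inr (k, k')], bs, rfl, by
            rw [List.append_nil] at hd; simp [blockRetr, hd]⟩
        · have := h2 hd0
          rw [hc'] at this
          right
          rw [h4, List.length_append]
          omega
      · by_cases hρ0 : ρ₁ = []
        · subst hρ0
          rw [List.append_nil] at hρ₁
          obtain ⟨c', hc'⟩ := hf.retr_auxWord_eq_cons hk hx hxT
          have h3 : IsReduced ((y :: f.image s z) ++ x :: c') := by
            have := (hf.retr_aux k k' hk).2
            rw [hc'] at this
            exact FreeGroup.IsReduced.glue (by simpa using hred) this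
          have h4 : f.image s (z ++ ρ) = f.image s z ++ x :: c' := by
            rw [SelfMap.image_append s hzp, hρ₁, hf.image_retr_auxWord hs hk, hc']
            exact (FreeGroup.IsReduced.right (a := [y]) (by simpa using h3)).tighten_eq
          exact ⟨by rw [h4]; simpa using h3, Or.inl ⟨[Sum.inr (k, k')], bs, rfl, by
            simp [blockRetr, hρ₁]⟩⟩
        have hlast' : ∃ c' x, ρ₁ = c' ++ [x] ∧ IsTrain x := by
          obtain ⟨ρ', x, hρ', hxT⟩ := hlast
          rcases List.eq_nil_or_concat ρ₁ with rfl | ⟨c, b, rfl⟩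
          · exact absurd rfl hρ0
          · rw [hρ', List.concat_eq_append, ← List.append_assoc] at hρ₁
            have := List.append_inj_right' hρ₁ rfl
            simp only [List.cons.injEq, and_true] at this
            exact ⟨c, b, by simp, this ▸ hxT⟩
        have hSL₂ : f.StronglyLegal (auxWord k k' ++ ([] ++ bs.flatMap blockPath)) := by
          have e : auxWord h h' ++ (z ++ (auxWord k k' ++ bs.flatMap blockPath)) =
            (auxWord h h' ++ z) ++ (auxWord k k' ++ ([] ++ bs.flatMap blockPath)) := by simp
          rw [e] at hSL
          exact hSL.suffix (haux.append hzp)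
        obtain ⟨h1, h2⟩ := ih (z := []) hk hy₂ hbs' inX_nil inΓ_nil hSL₂ hX.2
          ⟨r, hρ₁'.symm⟩ hlast'
        rw [List.nil_append] at h1 h2
        obtain ⟨c, hc⟩ := hf.retr_auxWord_eq_cons hk hx hxT
        obtain ⟨c', hc'⟩ := hf.retr_auxWord_eq_append hk hy₂ hy₂T
        have hkr := (hf.retr_aux k k' hk).2
        have h3 : IsReduced (G.retr (auxWord k k') ++ f.image s ρ₁) := by
          rw [hc'] at hkr ⊢
          simpa using hkr.glue h1
        have h4 : IsReduced ((y :: f.image s z) ++ (G.retr (auxWord k k') ++ f.image s ρ₁)) := by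
          rw [hc] at h3 ⊢
          exact FreeGroup.IsReduced.glue (by simpa using hred) h3
        have h5 : f.image s (z ++ ρ) =
            f.image s z ++ (G.retr (auxWord k k') ++ f.image s ρ₁) := by
          rw [SelfMap.image_append s hzp, hρ₁,
            SelfMap.image_append s (homotopic_retr (isPath_auxWord hk.2)).right,
            hf.image_retr_auxWord hs hk, h3.tighten_eq]
          exact (FreeGroup.IsReduced.right (a := [y]) (by simpa using h4)).tighten_eq
        refine ⟨by rw [h5]; simpa using h4, ?_⟩
        rcases h2 with ⟨b₁, b₂, rfl, rfl⟩ | h2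
        · exact Or.inl ⟨Sum.inr (k, k') :: b₁, b₂, rfl, by rw [hρ₁]; rfl⟩
        · right
          rw [h5, List.length_append, List.length_append]
          omega

/-- Every pre-INP which occurs in the retraction of a strongly legal path `χ` in the relative part
is contained in the pre-INP of an auxiliary edge of `χ`. -/
theorem exists_block_of_preINP (hf : IsBetaTrainTrack m) (hs : f.IsNielsenExponent s L M)
    (hM : 2 * L < M) {bs : List (Letter T R H ⊕ (H × H))} (hbs : ∀ β ∈ bs, G.IsProperBlock β)
    (hSL : f.StronglyLegal (bs.flatMap blockPath)) (hX : InX (bs.flatMap blockPath))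
    {p r : Word T R H} {i i' : H} (hi : G.IsAux i i')
    (e : bs.flatMap G.blockRetr = p ++ G.retr (auxWord i i') ++ r) :
    ∃ b₁ k k' b₂, bs = b₁ ++ Sum.inr (k, k') :: b₂ ∧
      (b₁.flatMap G.blockRetr).length ≤ p.length ∧
      p.length + (G.retr (auxWord i i')).length ≤
        (b₁.flatMap G.blockRetr).length + (G.retr (auxWord k k')).length := by
  obtain ⟨x₀, q₀, hx₀, hx₀T⟩ := hf.face_eq_cons hi
  obtain ⟨c₀, hc₀⟩ := hf.retr_auxWord_eq_cons hi hx₀ hx₀T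
  have hinl : ∀ a, Sum.inl a ∈ bs → ¬ IsTrain a := by
    intro a ha
    obtain ⟨b₁, b₂, rfl⟩ := List.append_of_mem ha
    exact hX a (by simp [blockPath])
  -- the auxiliary edge in whose pre-INP the given pre-INP starts
  obtain ⟨b₁, k, k', b₂, c, d, rfl, hd, hcd, hp, hrest⟩ : ∃ b₁ k k' b₂ c d,
      bs = b₁ ++ Sum.inr (k, k') :: b₂ ∧ d ≠ [] ∧ G.retr (auxWord k k') = c ++ d ∧
      p = b₁.flatMap G.blockRetr ++ c ∧
      G.retr (auxWord i i') ++ r = d ++ b₂.flatMap G.blockRetr := by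
    rw [List.append_assoc] at e
    rcases flatMap_cut _ e with ⟨b₁, b₂, hb, hp, hr⟩ |
      ⟨b₁, β, b₂, c, d, hb, hc, hd, hβ, hp, hr⟩
    · rcases b₂ with _ | ⟨a | ⟨k, k'⟩, b₂⟩
      · rw [hc₀] at hr; simp at hr
      · rw [hc₀] at hr
        simp only [List.cons_append, List.flatMap_cons, blockRetr, List.nil_append,
          List.cons.injEq] at hr
        exact absurd (hr.1 ▸ hx₀T) (hinl a (by simp [hb]))
      · have hk : G.IsAux k k' := hbs (Sum.inr (k, k')) (by simp [hb])
        exact ⟨b₁, k, k', b₂, [], _, hb, hf.retr_auxWord_ne_nil hk, rfl, by simpa using hp, hr⟩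
    · rcases β with a | ⟨k, k'⟩
      · have := congrArg List.length hβ
        have h1 := List.length_pos_iff.2 hc
        have h2 := List.length_pos_iff.2 hd
        simp [blockRetr] at this
        omega
      · exact ⟨b₁, k, k', b₂, c, d, hb, hd, hβ, hp, hr⟩
  have hk : G.IsAux k k' := hbs (Sum.inr (k, k')) (by simp)
  refine ⟨b₁, k, k', b₂, rfl, by rw [hp]; simp, ?_⟩
  -- otherwise the pre-INP consists of the terminal piece `d` of this block and of an initial piece
  -- `ρ` of the remaining ones
  by_contra hlt
  rw [hp, hcd] at hlt
  simp only [List.length_append, not_le] at hlt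
  obtain ⟨ρ, hρ, hρ'⟩ : ∃ ρ, G.retr (auxWord i i') = d ++ ρ ∧
      b₂.flatMap G.blockRetr = ρ ++ r := by
    rcases List.append_eq_append_iff.1 hrest with ⟨a, ha, -⟩ | ⟨a, ha, ha'⟩
    · have := congrArg List.length ha
      rw [List.length_append] at this
      omega
    · exact ⟨a, ha, ha'⟩
  have hρ0 : ρ ≠ [] := by
    rintro rfl
    rw [hρ] at hlt; simp [add_assoc] at hlt
  obtain ⟨q₁, x₁, hx₁, hx₁T⟩ := hf.face_eq_append hi
  obtain ⟨q₁', hq₁'⟩ := hf.retr_auxWord_eq_append hi hx₁ hx₁T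
  have hlast : ∃ c' x, ρ = c' ++ [x] ∧ IsTrain x := by
    rcases List.eq_nil_or_concat ρ with h0 | ⟨a, b, rfl⟩
    · exact absurd h0 hρ0
    · rw [hq₁', List.concat_eq_append, ← List.append_assoc] at hρ
      have := List.append_inj_right' hρ rfl
      simp only [List.cons.injEq, and_true] at this
      exact ⟨a, b, by simp, this ▸ hx₁T⟩
  obtain ⟨q, y, hy, hyT⟩ := hf.face_eq_append hk
  simp only [List.flatMap_append, List.flatMap_cons] at hSL hX
  obtain ⟨⟨u, v, hpath⟩, -⟩ := id hSL
  rw [← List.append_assoc] at hpath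
  obtain ⟨hp₁, hp₂⟩ := SelfMap.isPath_of_auxWord_append hk hpath
  have hSL' : f.StronglyLegal (auxWord k k' ++ ([] ++ b₂.flatMap blockPath)) := hSL.suffix hp₁
  rw [inX_append, inX_append] at hX
  have hbs₂ : ∀ β ∈ b₂, G.IsProperBlock β := fun β hβ => hbs β (by simp [hβ])
  obtain ⟨h1, h2⟩ := hf.image_prefix_in_X hs hM b₂ hk hy hbs₂
    inX_nil inΓ_nil hSL' hX.2.2 ⟨r, hρ'.symm⟩ hlast
  rw [List.nil_append] at h1 h2
  obtain ⟨⟨d', hd'⟩, h3⟩ := hf.image_of_suffix hs hM hk hcd hd hy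
  have hdp : ∃ w w' : V, G.IsPath (Sum.inl w) d (Sum.inl w') := by
    have h4 := (homotopic_retr (isPath_auxWord (G := G.toGraph1) hi.2)).right
    have h5 := (hf.retr_aux i i' hi).1
    rw [hρ] at h4 h5
    obtain ⟨w', h6, -⟩ := IsPath.exists_cut_of_inΓ h4 (h5.infix ⟨[], ρ, by simp⟩)
    exact ⟨_, w', h6⟩
  obtain ⟨w, w', hdp⟩ := hdp
  -- the images of these pieces do not cancel, and their product is a fixed, hence short, path
  have h4 : G.retr (auxWord i i') = f.image s d ++ f.image s ρ := by
    rw [← hf.image_retr_auxWord hs hi, hρ, SelfMap.image_append s hdp]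
    refine FreeGroup.IsReduced.tighten_eq ?_
    have h5 := f.isReduced_image s d
    rw [hd'] at h5 ⊢
    simpa using h5.glue h1
  have h5 := hs.length_retr i i'
  rw [h4, List.length_append] at h5
  rcases h2 with ⟨c₁, c₂, rfl, rfl⟩ | h2
  · -- no block is cut, so that the pre-INP is the retraction of a second reduced path in `X`
    have hc : c = [] := by
      by_contra hc
      have := h3 hc
      omega
    subst hc
    rw [List.nil_append] at hcd
    have hw : ∃ v' : V, G.IsPath (Sum.inl (G.foot k)) (auxWord k k' ++ c₁.flatMap blockPath)
        (Sum.inl v') ∧ G.retr (auxWord k k' ++ c₁.flatMap blockPath) = G.retr (auxWord i i') := by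
      rw [List.flatMap_append] at hp₂
      obtain ⟨w₁, h6, h7⟩ := isPath_append.1 hp₂
      obtain ⟨w₁, rfl⟩ : ∃ w : V, w₁ = Sum.inl w := by
        cases c₂ with
        | nil => exact ⟨v, h7⟩
        | cons β c₂ =>
          rw [List.flatMap_cons] at h7
          obtain ⟨_, h8, -⟩ := isPath_append.1 h7
          obtain ⟨a, b, h9⟩ := (hbs₂ β (by simp)).isBlock.exists_path
          exact ⟨a, h8.start_unique h9 (blockPath_ne_nil β)⟩
      refine ⟨w₁, (isPath_auxWord hk.2).append h6, ?_⟩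
      rw [retr_append (isPath_auxWord hk.2),
        retr_blocks h6 fun β hβ => (hbs₂ β (by simp [hβ])).isBlock, hρ, hcd]
    obtain ⟨v', hw, hw'⟩ := hw
    have hred : IsReduced (auxWord k k' ++ c₁.flatMap blockPath) := by
      have := hSL'.isReduced
      rw [List.nil_append, List.flatMap_append, ← List.append_assoc] at this
      exact this.left
    have hX₁ : InX (c₁.flatMap (blockPath (T := T) (R := R) (H := H))) := by
      have := hX.2.2
      rw [List.flatMap_append, inX_append] at this
      exact this.1
    have h6 := hf.eq_of_retr_eq hw (isPath_auxWord hi.2)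
      (inX_append.2 ⟨inX_auxWord k k', hX₁⟩) (inX_auxWord i i') hred (isReduced_auxWord hi) hw'
      (by rw [hw']; exact hf.retr_auxWord_ne_nil hi)
    have h7 := congrArg List.length h6
    rw [List.length_append] at h7
    have h8 : c₁.flatMap (blockPath (T := T) (R := R) (H := H)) = [] := by
      rw [← List.length_eq_zero_iff]
      simp [auxWord] at h7 ⊢
      exact h7
    cases c₁ with
    | nil => exact hρ0 rfl
    | cons β c₁ => simp [blockPath_ne_nil] at h8
  · omega

end IsBetaTrainTrack

/-! ### The relative length of a normalized path, computed in `Γ` -/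

/-- Counting predicates which are related except at the last `d` positions. -/
theorem count_le_of_initial {p q : ℕ → Prop} [DecidablePred p] [DecidablePred q] {N d : ℕ}
    (h : ∀ i, i + d ≤ N → p i → q i) : Nat.count p N ≤ Nat.count q N + d := by
  rcases le_total N d with hd | hd
  · exact (Nat.count_le _).trans (by omega)
  · obtain ⟨k, rfl⟩ := Nat.exists_eq_add_of_le' hd
    rw [Nat.count_add]
    have h1 : Nat.count p k ≤ Nat.count q k := Nat.count_mono_left fun i hi => h i (by omega)
    have h2 : Nat.count q k ≤ Nat.count q (k + d) := Nat.count_monotone q (by omega)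
    have h3 : Nat.count (fun i => p (k + i)) d ≤ d := Nat.count_le _
    omega

/-- Counting predicates which are related except at the first `d` positions. -/
theorem count_le_of_terminal {p q : ℕ → Prop} [DecidablePred p] [DecidablePred q] {N d : ℕ}
    (h : ∀ i, d ≤ i → p i → q i) : Nat.count p N ≤ Nat.count q N + d := by
  rcases le_total N d with hd | hd
  · exact (Nat.count_le _).trans (by omega)
  · obtain ⟨k, rfl⟩ := Nat.exists_eq_add_of_le hd
    rw [Nat.count_add, Nat.count_add]
    have h1 : Nat.count (fun i => p (d + i)) k ≤ Nat.count (fun i => q (d + i)) k :=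
      Nat.count_mono_left fun i hi => h _ (by omega)
    have h3 : Nat.count p d ≤ d := Nat.count_le _
    omega

namespace Complex

variable (G : Complex V T R S H)

/-- The `i`-th edge of `ρ` lies on an isolated pre-INP. -/
def Covered (ρ : Word T R H) (i : ℕ) : Prop :=
  ∃ j h h', G.IsolatedAt ρ j h h' ∧ j ≤ i ∧ i < j + (G.retr (auxWord h h')).length

/-- The `i`-th edge of `ρ` belongs to the train track part and lies on no isolated pre-INP. -/
def Uncovered (ρ : Word T R H) (i : ℕ) : Prop :=
  (∃ x, ρ[i]? = some x ∧ IsTrain x) ∧ ¬ G.Covered ρ i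

open Classical in
/-- The number of edges of the train track part in a path of `Γ` which lie on no isolated pre-INP,
i.e. the relative length of the corresponding normalized path. -/
noncomputable def uncoveredLength (ρ : Word T R H) : ℕ := Nat.count (G.Uncovered ρ) ρ.length

variable {G}

theorem uncoveredLength_le_length (ρ : Word T R H) : G.uncoveredLength ρ ≤ ρ.length := by
  classical exact Nat.count_le _

theorem uncoveredLength_nil : G.uncoveredLength [] = 0 := by
  have := uncoveredLength_le_length (G := G) []
  simpa using this

theorem PreINPAt.append_right {ρ₁ : Word T R H} {j : ℕ} {h h' : H} (hj : G.PreINPAt ρ₁ j h h')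
    (ρ₂ : Word T R H) : G.PreINPAt (ρ₁ ++ ρ₂) j h h' := by
  obtain ⟨hh, p, q, rfl, rfl⟩ := hj
  exact ⟨hh, p, q ++ ρ₂, rfl, by simp⟩

theorem PreINPAt.of_append_right {ρ₁ ρ₂ : Word T R H} {j : ℕ} {h h' : H}
    (hj : G.PreINPAt (ρ₁ ++ ρ₂) j h h')
    (hlen : j + (G.retr (auxWord h h')).length ≤ ρ₁.length) : G.PreINPAt ρ₁ j h h' := by
  obtain ⟨hh, p, q, rfl, e⟩ := hj
  obtain ⟨r, hr⟩ : p ++ G.retr (auxWord h h') <+: ρ₁ :=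
    List.prefix_of_prefix_length_le (l₃ := ρ₁ ++ ρ₂) ⟨q, e.symm⟩ ⟨ρ₂, rfl⟩ (by simpa using hlen)
  exact ⟨hh, p, r, rfl, hr.symm⟩

theorem PreINPAt.append_left {ρ₂ : Word T R H} {j : ℕ} {h h' : H} (hj : G.PreINPAt ρ₂ j h h')
    (ρ₁ : Word T R H) : G.PreINPAt (ρ₁ ++ ρ₂) (ρ₁.length + j) h h' := by
  obtain ⟨hh, p, q, rfl, rfl⟩ := hj
  exact ⟨hh, ρ₁ ++ p, q, by simp, by simp⟩

theorem PreINPAt.of_append_left {ρ₁ ρ₂ : Word T R H} {j : ℕ} {h h' : H}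
    (hj : G.PreINPAt (ρ₁ ++ ρ₂) (ρ₁.length + j) h h') : G.PreINPAt ρ₂ j h h' := by
  obtain ⟨hh, p, q, hp, e⟩ := hj
  obtain ⟨r, rfl⟩ : ρ₁ <+: p :=
    List.prefix_of_prefix_length_le (l₃ := ρ₁ ++ ρ₂) ⟨ρ₂, rfl⟩
      ⟨G.retr (auxWord h h') ++ q, by rw [e]; simp⟩ (by omega)
  refine ⟨hh, r, q, by simpa using hp, ?_⟩
  rw [List.append_assoc, List.append_assoc] at e
  simpa using List.append_cancel_left e

variable {L : ℕ}

/-- Whether an edge lies on an isolated pre-INP depends only on a neighbourhood of this edge. -/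
theorem covered_append_right (hL : ∀ h h', (G.retr (auxWord h h')).length ≤ L)
    {ρ₁ ρ₂ : Word T R H} {i : ℕ} (hi : i + 2 * L ≤ ρ₁.length) :
    G.Covered (ρ₁ ++ ρ₂) i ↔ G.Covered ρ₁ i := by
  refine ⟨?_, ?_⟩ <;> rintro ⟨j, h, h', ⟨h1, h2⟩, h3, h4⟩ <;> have h5 := hL h h'
  · exact ⟨j, h, h', ⟨h1.of_append_right (by omega), fun j' k k' hk => h2 j' k k'
      (hk.append_right ρ₂)⟩, h3, h4⟩
  · refine ⟨j, h, h', ⟨h1.append_right ρ₂, fun j' k k' hk h6 h7 => ?_⟩, h3, h4⟩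
    have := hL k k'
    exact h2 j' k k' (hk.of_append_right (by omega)) h6 h7

theorem covered_append_left (hL : ∀ h h', (G.retr (auxWord h h')).length ≤ L)
    {ρ₁ ρ₂ : Word T R H} {i : ℕ} (hi : 2 * L ≤ i) :
    G.Covered (ρ₁ ++ ρ₂) (ρ₁.length + i) ↔ G.Covered ρ₂ i := by
  refine ⟨?_, ?_⟩ <;> rintro ⟨j, h, h', ⟨h1, h2⟩, h3, h4⟩ <;> have h5 := hL h h'
  · obtain ⟨j, rfl⟩ := Nat.exists_eq_add_of_le (show ρ₁.length ≤ j by omega)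
    refine ⟨j, h, h', ⟨h1.of_append_left, fun j' k k' hk h6 h7 => ?_⟩, by omega, by omega⟩
    have := h2 _ k k' (hk.append_left ρ₁) (by omega) (by omega)
    omega
  · refine ⟨ρ₁.length + j, h, h', ⟨h1.append_left ρ₁, fun j' k k' hk h6 h7 => ?_⟩, by omega,
      by omega⟩
    have := hL k k'
    obtain ⟨j', rfl⟩ := Nat.exists_eq_add_of_le (show ρ₁.length ≤ j' by omega)
    have := h2 j' k k' hk.of_append_left (by omega) (by omega)
    omega

theorem uncovered_append_right (hL : ∀ h h', (G.retr (auxWord h h')).length ≤ L)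
    {ρ₁ ρ₂ : Word T R H} {i : ℕ} (hi : i + (2 * L + 1) ≤ ρ₁.length) :
    G.Uncovered (ρ₁ ++ ρ₂) i ↔ G.Uncovered ρ₁ i := by
  rw [Uncovered, Uncovered, covered_append_right hL (by omega),
    List.getElem?_append_left (by omega)]

theorem uncovered_append_left (hL : ∀ h h', (G.retr (auxWord h h')).length ≤ L)
    {ρ₁ ρ₂ : Word T R H} {i : ℕ} (hi : 2 * L + 1 ≤ i) :
    G.Uncovered (ρ₁ ++ ρ₂) (ρ₁.length + i) ↔ G.Uncovered ρ₂ i := by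
  rw [Uncovered, Uncovered, covered_append_left hL (by omega),
    List.getElem?_append_right (by omega), Nat.add_sub_cancel_left]

/-- The uncovered length is additive up to a bounded error. -/
theorem uncoveredLength_append_le (hL : ∀ h h', (G.retr (auxWord h h')).length ≤ L)
    (ρ₁ ρ₂ : Word T R H) : G.uncoveredLength (ρ₁ ++ ρ₂) ≤
      G.uncoveredLength ρ₁ + G.uncoveredLength ρ₂ + (4 * L + 2) := by
  classical
  rw [uncoveredLength, List.length_append, Nat.count_add]
  have h1 := count_le_of_initial (N := ρ₁.length) (d := 2 * L + 1)
    fun i hi => (uncovered_append_right hL (ρ₂ := ρ₂) hi).1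
  have h2 := count_le_of_terminal (N := ρ₂.length) (d := 2 * L + 1)
    (p := fun k => G.Uncovered (ρ₁ ++ ρ₂) (ρ₁.length + k)) (q := G.Uncovered ρ₂)
    fun i hi => (uncovered_append_left hL (ρ₁ := ρ₁) hi).1
  rw [uncoveredLength, uncoveredLength]
  omega

theorem le_uncoveredLength_append (hL : ∀ h h', (G.retr (auxWord h h')).length ≤ L)
    (ρ₁ ρ₂ : Word T R H) : G.uncoveredLength ρ₁ + G.uncoveredLength ρ₂ ≤
      G.uncoveredLength (ρ₁ ++ ρ₂) + (4 * L + 2) := by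
  classical
  rw [uncoveredLength, uncoveredLength, uncoveredLength, List.length_append, Nat.count_add]
  have h1 := count_le_of_initial (N := ρ₁.length) (d := 2 * L + 1)
    fun i hi => (uncovered_append_right hL (ρ₂ := ρ₂) hi).2
  have h2 := count_le_of_terminal (N := ρ₂.length) (d := 2 * L + 1)
    (q := fun k => G.Uncovered (ρ₁ ++ ρ₂) (ρ₁.length + k)) (p := G.Uncovered ρ₂)
    fun i hi => (uncovered_append_left hL (ρ₁ := ρ₁) hi).2
  omega

/-- The relative length of a normalized path `γ` is the uncovered length of `r(γ)`. -/
theorem IsReplacement.relLength_eq {ρ γ : Word T R H} (h : G.IsReplacement ρ γ) :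
    relLength γ = G.uncoveredLength ρ := by
  classical
  obtain ⟨bs, hρ, rfl, hiso⟩ := h
  have key : ∀ b₁ b₂, bs = b₁ ++ b₂ →
      relLength (b₁.flatMap blockPath) = Nat.count (G.Uncovered ρ) (b₁.flatMap G.blockRetr).length := by
    intro b₁
    induction b₁ using List.reverseRecOn with
    | nil => intro b₂ _; simp
    | append_singleton b₁ β ih =>
      intro b₂ hb
      have hb' : bs = b₁ ++ β :: b₂ := by rw [hb]; simp
      rw [List.flatMap_append, List.flatMap_append, relLength_append, List.length_append,
        Nat.count_add, ih _ hb', List.flatMap_singleton, List.flatMap_singleton]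
      congr 1
      rcases β with x | ⟨h, h'⟩
      · have hx : ρ[(b₁.flatMap G.blockRetr).length]? = some x := by
          rw [hρ, hb', List.flatMap_append, List.flatMap_cons,
            List.getElem?_append_right le_rfl]
          simp [blockRetr]
        have hcov : ¬ G.Covered ρ (b₁.flatMap G.blockRetr).length := by
          rintro ⟨j, k, k', hj, h1, h2⟩
          obtain ⟨c₁, c₂, hc, rfl⟩ := (hiso j k k').1 hj
          rw [hb'] at hc
          rcases List.append_eq_append_iff.1 hc with ⟨a, ha, ha'⟩ | ⟨a, ha, ha'⟩
          · cases a with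
            | nil => simp at ha'
            | cons y a =>
              simp only [List.cons_append, List.cons.injEq] at ha'
              rw [ha, ← ha'.1] at h1
              simp [blockRetr] at h1
          · cases a with
            | nil => simp at ha'
            | cons y a =>
              simp only [List.cons_append, List.cons.injEq] at ha'
              rw [ha, ← ha'.1] at h2
              simp [blockRetr] at h2
        have e : G.Uncovered ρ (b₁.flatMap G.blockRetr).length ↔ IsTrain x := by
          rw [Uncovered, hx]
          refine ⟨?_, fun hT => ⟨⟨x, rfl, hT⟩, hcov⟩⟩
          rintro ⟨⟨x', hx', hT⟩, -⟩
          rw [Option.some.injEq] at hx'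
          exact hx' ▸ hT
        simp only [blockPath, blockRetr, List.length_singleton, Nat.count_one, add_zero, e,
          relLength, List.countP_singleton]
        by_cases hx : IsTrain x <;> simp [hx]
      · rw [blockPath, relLength_eq_zero.2 (inX_auxWord h h')]
        symm
        refine Nat.count_of_forall_not fun i hi hcov => hcov.2 ?_
        exact ⟨_, h, h', (hiso _ h h').2 ⟨b₁, b₂, hb', rfl⟩, by omega, Nat.add_lt_add_left hi _⟩
  rw [key bs [] (by simp), uncoveredLength, ← hρ]

end Complex

theorem append_cons_trichotomy {β : Type*} {b₁ b₂ c₁ c₂ : List β} {x y : β}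
    (h : b₁ ++ x :: b₂ = c₁ ++ y :: c₂) :
    (b₁ = c₁ ∧ x = y) ∨ (∃ d, c₁ = b₁ ++ x :: d) ∨ ∃ d, b₁ = c₁ ++ y :: d := by
  rcases List.append_eq_append_iff.1 h with ⟨a, rfl, ha⟩ | ⟨a, rfl, ha⟩
  · cases a with
    | nil =>
      simp only [List.nil_append, List.cons.injEq] at ha
      exact Or.inl ⟨by simp, ha.1⟩
    | cons z a =>
      simp only [List.cons_append, List.cons.injEq] at ha
      exact Or.inr (Or.inl ⟨a, by rw [ha.1]⟩)
  · cases a with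
    | nil =>
      simp only [List.nil_append, List.cons.injEq] at ha
      exact Or.inl ⟨by simp, ha.1.symm⟩
    | cons z a =>
      simp only [List.cons_append, List.cons.injEq] at ha
      exact Or.inr (Or.inr ⟨a, by rw [ha.1]⟩)

theorem exists_block_at {β γ : Type*} (F : β → List γ) {bs : List β} {i : ℕ}
    (hi : i < (bs.flatMap F).length) : ∃ b₁ b b₂, bs = b₁ ++ b :: b₂ ∧
      (b₁.flatMap F).length ≤ i ∧ i < (b₁.flatMap F).length + (F b).length := by
  induction bs generalizing i with
  | nil => simp at hi
  | cons b bs ih =>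
    rw [List.flatMap_cons, List.length_append] at hi
    by_cases h : i < (F b).length
    · exact ⟨[], b, bs, rfl, by simp, by simpa using h⟩
    · obtain ⟨b₁, c, b₂, rfl, h1, h2⟩ := ih (i := i - (F b).length) (by omega)
      refine ⟨b :: b₁, c, b₂, rfl, ?_, ?_⟩ <;> rw [List.flatMap_cons, List.length_append] <;> omega

theorem mem_of_position {β γ : Type*} (F : β → List γ) {b₁ b₂ c₁ mid c₂ : List β} {b : β}
    (h : b₁ ++ b :: b₂ = c₁ ++ mid ++ c₂) (hb : F b ≠ [])
    (h1 : (c₁.flatMap F).length ≤ (b₁.flatMap F).length)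
    (h2 : (b₁.flatMap F).length < (c₁.flatMap F).length + (mid.flatMap F).length) : b ∈ mid := by
  have hb' := List.length_pos_iff.2 hb
  rw [List.append_assoc] at h
  rcases List.append_eq_append_iff.1 h with ⟨a, rfl, ha⟩ | ⟨a, rfl, ha⟩
  · cases a with
    | nil =>
      cases mid with
      | nil => simp at h2
      | cons c mid =>
        simp only [List.nil_append, List.cons_append, List.cons.injEq] at ha
        simp [ha.1]
    | cons c a =>
      simp only [List.cons_append, List.cons.injEq] at ha
      rw [List.flatMap_append, List.flatMap_cons, ← ha.1] at h1
      simp only [List.length_append] at h1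
      omega
  · rw [List.flatMap_append, List.length_append] at h2
    rcases List.append_eq_append_iff.1 ha with ⟨d, rfl, -⟩ | ⟨d, rfl, hd⟩
    · rw [List.flatMap_append, List.length_append] at h2
      omega
    · cases d with
      | nil => simp at h2
      | cons c d =>
        simp only [List.cons_append, List.cons.injEq] at hd
        simp [hd.1]

namespace IsBetaTrainTrack

variable {G : Complex V T R S H} {f : SelfMap G} {n : ℕ}
  {α : FreeGroup (Fin n) ≃* FreeGroup (Fin n)} {m : Marking G f n α} {s L M : ℕ}

/-! ### Existence of normalized paths -/

theorem length_retr_auxWord_pos (hf : IsBetaTrainTrack m) {h h' : H} (hh : G.IsAux h h') :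
    0 < (G.retr (auxWord h h')).length := List.length_pos_iff.2 (hf.retr_auxWord_ne_nil hh)

/-- Isolated pre-INPs which overlap coincide. -/
theorem isolatedAt_unique (hf : IsBetaTrainTrack m) {ρ : Word T R H} {i j : ℕ} {h h' k k' : H}
    (hi : G.IsolatedAt ρ i h h') (hj : G.IsolatedAt ρ j k k')
    (h1 : i < j + (G.retr (auxWord k k')).length) (h2 : j < i + (G.retr (auxWord h h')).length) :
    i = j ∧ h = k ∧ h' = k' := by
  have h3 := hi.2 j k k' hj.1 h1 h2
  have h4 := hj.2 i h h' hi.1 h2 h1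
  obtain ⟨⟨hh, p, q, hp, e⟩, -⟩ := hi
  obtain ⟨⟨hk, p', q', hp', e'⟩, -⟩ := hj
  refine ⟨by omega, hf.eq_of_retr_auxWord_eq hh hk ?_⟩
  rw [e, List.append_assoc, List.append_assoc] at e'
  have e1 := (List.append_inj e' (by omega)).2
  exact (List.append_inj e1 (by omega)).1

/-- The blocks of the normalized path are found from the left to the right: at every position either
an isolated pre-INP starts, which becomes a block, or the next edge does. The position `p.length` is
never interior to an isolated pre-INP. -/
theorem exists_isReplacement_aux (hf : IsBetaTrainTrack m) (ρ : Word T R H) (N : ℕ) :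
    ∀ p q : Word T R H, ρ = p ++ q → q.length ≤ N →
    (∀ j h h', G.IsolatedAt ρ j h h' → j < p.length →
      j + (G.retr (auxWord h h')).length ≤ p.length) →
    ∃ bs : List (Letter T R H ⊕ (H × H)), q = bs.flatMap G.blockRetr ∧
      ∀ i h h', p.length ≤ i → (G.IsolatedAt ρ i h h' ↔
        ∃ b₁ b₂, bs = b₁ ++ Sum.inr (h, h') :: b₂ ∧
          i = p.length + (b₁.flatMap G.blockRetr).length) := by
  induction N with
  | zero =>
    rintro p q e hq -
    obtain rfl : q = [] := List.length_eq_zero_iff.1 (by omega)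
    refine ⟨[], rfl, fun i h h' hi => ⟨?_, ?_⟩⟩
    · rintro ⟨⟨hh, p', q', rfl, e'⟩, -⟩
      have := hf.length_retr_auxWord_pos hh
      have h1 := congrArg List.length (e.symm.trans e')
      simp at h1
      omega
    · rintro ⟨b₁, b₂, hb, -⟩
      simp at hb
  | succ N ih =>
    intro p q e hq hinv
    by_cases hiso : ∃ h h', G.IsolatedAt ρ p.length h h'
    · obtain ⟨h, h', hiso⟩ := hiso
      obtain ⟨⟨hh, p', q', hp', e'⟩, -⟩ := id hiso
      have hpos := hf.length_retr_auxWord_pos hh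
      rw [e, List.append_assoc] at e'
      obtain ⟨rfl, rfl⟩ := List.append_inj e' hp'.symm
      obtain ⟨bs, hbs, hiff⟩ := ih (p ++ G.retr (auxWord h h')) q' (by rw [e]; simp)
        (by rw [List.length_append] at hq; omega) (by
          intro j k k' hj hlt
          rw [List.length_append] at hlt ⊢
          by_cases hjp : j < p.length
          · have := hinv j k k' hj hjp
            omega
          · by_cases hov : p.length < j + (G.retr (auxWord k k')).length
            · obtain ⟨rfl, rfl, rfl⟩ := hf.isolatedAt_unique hiso hj hov hlt
              exact le_rfl
            · omega)
      refine ⟨Sum.inr (h, h') :: bs, by rw [List.flatMap_cons, ← hbs]; rfl, ?_⟩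
      intro i k k' hi
      rw [List.length_append] at hiff
      by_cases hlt : i < p.length + (G.retr (auxWord h h')).length
      · refine ⟨fun hk => ?_, ?_⟩
        · have := hf.length_retr_auxWord_pos hk.1.1
          obtain ⟨rfl, rfl, rfl⟩ := hf.isolatedAt_unique hiso hk (by omega) hlt
          exact ⟨[], bs, rfl, by simp⟩
        · rintro ⟨b₁, b₂, hb, rfl⟩
          cases b₁ with
          | nil =>
            simp only [List.nil_append, List.cons.injEq, Sum.inr.injEq, Prod.mk.injEq] at hb
            obtain ⟨⟨rfl, rfl⟩, -⟩ := hb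
            simpa using hiso
          | cons β b₁ =>
            simp only [List.cons_append, List.cons.injEq] at hb
            rw [← hb.1, List.flatMap_cons, List.length_append] at hlt
            have : (G.blockRetr (Sum.inr (h, h'))) = G.retr (auxWord h h') := rfl
            rw [this] at hlt
            omega
      · rw [hiff i k k' (by omega)]
        refine ⟨?_, ?_⟩
        · rintro ⟨b₁, b₂, rfl, rfl⟩
          refine ⟨Sum.inr (h, h') :: b₁, b₂, rfl, ?_⟩
          rw [List.flatMap_cons, List.length_append, ← add_assoc]
          rfl
        · rintro ⟨b₁, b₂, hb, rfl⟩
          cases b₁ with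
          | nil =>
            simp only [List.flatMap_nil, List.length_nil, add_zero] at hlt
            omega
          | cons β b₁ =>
            simp only [List.cons_append, List.cons.injEq] at hb
            refine ⟨b₁, b₂, hb.2, ?_⟩
            rw [← hb.1, List.flatMap_cons, List.length_append, ← add_assoc]
            rfl
    · push Not at hiso
      cases q with
      | nil =>
        exact ih p [] e (by simp) hinv
      | cons x q =>
        obtain ⟨bs, hbs, hiff⟩ := ih (p ++ [x]) q (by rw [e]; simp)
          (by rw [List.length_cons] at hq; omega) (by
            intro j k k' hj hlt
            rw [List.length_append, List.length_singleton] at hlt ⊢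
            by_cases hjp : j < p.length
            · have := hinv j k k' hj hjp
              omega
            · obtain rfl : j = p.length := by omega
              exact absurd hj (hiso k k'))
        refine ⟨Sum.inl x :: bs, by rw [List.flatMap_cons, ← hbs]; rfl, ?_⟩
        intro i k k' hi
        rw [List.length_append, List.length_singleton] at hiff
        by_cases hlt : i < p.length + 1
        · obtain rfl : i = p.length := by omega
          refine ⟨fun hk => absurd hk (hiso k k'), ?_⟩
          rintro ⟨b₁, b₂, hb, h1⟩
          cases b₁ with
          | nil => simp at hb
          | cons β b₁ =>
            simp only [List.cons_append, List.cons.injEq] at hb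
            rw [← hb.1, List.flatMap_cons, List.length_append] at h1
            simp [blockRetr] at h1
        · rw [hiff i k k' (by omega)]
          refine ⟨?_, ?_⟩
          · rintro ⟨b₁, b₂, rfl, rfl⟩
            refine ⟨Sum.inl x :: b₁, b₂, rfl, ?_⟩
            rw [List.flatMap_cons, List.length_append, ← add_assoc]
            rfl
          · rintro ⟨b₁, b₂, hb, rfl⟩
            cases b₁ with
            | nil => simp at hb
            | cons β b₁ =>
              simp only [List.cons_append, List.cons.injEq] at hb
              refine ⟨b₁, b₂, hb.2, ?_⟩
              rw [← hb.1, List.flatMap_cons, List.length_append, ← add_assoc]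
              rfl

theorem isPath_of_blockRetr {bs : List (Letter T R H ⊕ (H × H))} (hf : IsBetaTrainTrack m)
    (hbs : ∀ β ∈ bs, G.IsProperBlock β) {u v : V}
    (hp : G.IsPath (Sum.inl u) (bs.flatMap G.blockRetr) (Sum.inl v)) :
    G.IsPath (Sum.inl u) (bs.flatMap blockPath) (Sum.inl v) := by
  induction bs generalizing u with
  | nil => exact hp
  | cons β bs ih =>
    rw [List.flatMap_cons] at hp ⊢
    obtain ⟨w, h1, h2⟩ := isPath_append.1 hp
    have hβ := hbs β (by simp)
    obtain ⟨a, b, h3⟩ := hβ.isBlock.exists_path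
    have h4 := (homotopic_retr h3).right
    rw [← blockRetr_eq hβ.isBlock] at h4
    have hne : G.blockRetr β ≠ [] := by
      obtain ⟨y, q, q', -, e, -⟩ := hf.block_first hβ
      rw [e]; simp
    have e1 := h1.start_unique h4 hne
    rw [e1] at h1 ⊢
    obtain rfl := h1.end_unique h4
    exact h3.append (ih (fun β hβ => hbs β (by simp [hβ])) h2)

/-- Every path is homotopic to a normalized path, whose relative length is the uncovered length of
the homotopic reduced path of `Γ`. -/
theorem exists_isNormalization (hf : IsBetaTrainTrack m) {u v : V} {γ : Word T R H}
    (hp : G.IsPath (Sum.inl u) γ (Sum.inl v)) :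
    ∃ δ, G.IsNormalization u v γ δ ∧
      relLength δ = G.uncoveredLength (tighten (G.retr γ)) := by
  set ρ := tighten (G.retr γ) with hρ
  have hΓ : InΓ ρ := (hf.inΓ_retr hp).tighten
  have hr : IsReduced ρ := isReduced_tighten _
  have hh := (homotopic_retr hp).trans (Homotopic.tighten (homotopic_retr hp).right)
  obtain ⟨bs, hbs, hiff⟩ := hf.exists_isReplacement_aux ρ _ [] ρ rfl le_rfl (by simp)
  have hpr : ∀ β ∈ bs, G.IsProperBlock β := by
    rintro (x | ⟨h, h'⟩) hβ
    · intro h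
      refine hΓ x ?_ h
      rw [hbs, List.mem_flatMap]
      exact ⟨_, hβ, by simp [blockRetr]⟩
    · obtain ⟨b₁, b₂, hb⟩ := List.append_of_mem hβ
      exact ((hiff _ h h' (Nat.zero_le _)).2 ⟨b₁, b₂, hb, rfl⟩).1.1
  have hpath := hh.right
  rw [← hρ, hbs] at hpath
  have hδ := hf.isPath_of_blockRetr hpr hpath
  have hretr : G.retr (bs.flatMap blockPath) = ρ := by
    rw [retr_blocks hδ fun β hβ => (hpr β hβ).isBlock, ← hbs]
  have hrep : G.IsReplacement ρ (bs.flatMap blockPath) := by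
    refine ⟨bs, hbs, rfl, fun i h h' => ?_⟩
    rw [hiff i h h' (Nat.zero_le _)]
    simp
  refine ⟨bs.flatMap blockPath, ⟨⟨hδ, ?_, ?_, ?_⟩, ?_⟩, hrep.relLength_eq⟩
  · rw [hretr]; exact hΓ
  · rw [hretr]; exact hr
  · rw [hretr]; exact hrep
  · refine hh.trans ?_
    have := (homotopic_retr hδ).symm
    rwa [hretr] at this

/-! ### The uncovered length of the retraction of a strongly legal path -/

/-- In the retraction of a strongly legal path in the relative part everything is covered. -/
theorem uncoveredLength_retr_of_inX (hf : IsBetaTrainTrack m) (hs : f.IsNielsenExponent s L M)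
    (hM : 2 * L < M) {χ : Word T R H} (h : f.StronglyLegal χ) (hX : InX χ) :
    G.uncoveredLength (G.retr χ) = 0 := by
  classical
  obtain ⟨u, v, hp⟩ := h.exists_isPath
  obtain ⟨bs, hbs, rfl⟩ := exists_properBlocks hp h.isReduced
  rw [retr_blocks hp fun β hβ => (hbs β hβ).isBlock, uncoveredLength]
  refine Nat.count_of_forall_not fun i hi hcov => ?_
  obtain ⟨⟨x, hx, hT⟩, hcov⟩ := hcov
  obtain ⟨b₁, β, b₂, hb, h1, h2⟩ := exists_block_at _ hi
  have hflat : bs.flatMap G.blockRetr =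
      b₁.flatMap G.blockRetr ++ G.blockRetr β ++ b₂.flatMap G.blockRetr := by
    rw [hb]; simp
  rcases β with a | ⟨k, k'⟩
  · obtain rfl : i = (b₁.flatMap G.blockRetr).length := by
      simp only [blockRetr, List.length_singleton] at h2; omega
    rw [hflat, List.append_assoc, List.getElem?_append_right le_rfl] at hx
    simp only [blockRetr, Nat.sub_self, List.cons_append, List.getElem?_cons_zero,
      Option.some.injEq] at hx
    refine hX a ?_ (hx ▸ hT)
    rw [hb]; simp [blockPath]
  · refine hcov ⟨_, k, k', ⟨⟨hbs (Sum.inr (k, k')) (by simp [hb]), _, _, rfl, hflat⟩, ?_⟩, h1, h2⟩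
    rintro j i i' ⟨hi, p, r, rfl, e⟩ h3 h4
    obtain ⟨c₁, l, l', c₂, hc, h5, h6⟩ := hf.exists_block_of_preINP hs hM hbs h hX hi e
    have hpos := hf.length_retr_auxWord_pos hi
    rcases append_cons_trichotomy (hb.symm.trans hc) with ⟨rfl, e1⟩ | ⟨d, rfl⟩ | ⟨d, rfl⟩
    · simp only [Sum.inr.injEq, Prod.mk.injEq] at e1
      obtain ⟨rfl, rfl⟩ := e1
      exact ⟨h5, h6⟩
    · simp only [List.flatMap_append, List.flatMap_cons, List.length_append] at h5 h6
      have : (G.blockRetr (Sum.inr (k, k'))) = G.retr (auxWord k k') := rfl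
      rw [this] at h5
      omega
    · simp only [List.flatMap_append, List.flatMap_cons, List.length_append] at h3
      have : (G.blockRetr (Sum.inr (l, l'))) = G.retr (auxWord l l') := rfl
      rw [this] at h3
      omega

/-- Upper bound for the uncovered length in terms of the relative length: between two consecutive
edges of the train track part everything is covered. The induction is on a bound `N` for the length
of the path. -/
theorem uncoveredLength_retr_le (hf : IsBetaTrainTrack m) (hs : f.IsNielsenExponent s L M)
    (hM : 2 * L < M) (N : ℕ) : ∀ {σ : Word T R H}, σ.length ≤ N → f.StronglyLegal σ →
    G.uncoveredLength (G.retr σ) ≤ (8 * L + 5) * relLength σ := by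
  induction N with
  | zero =>
    intro σ hσ _
    rw [List.length_eq_zero_iff.1 (Nat.le_zero.1 hσ), retr_nil, uncoveredLength_nil]
    exact Nat.zero_le _
  | succ N ih =>
    intro σ hσ h
    by_cases hX : InX σ
    · rw [hf.uncoveredLength_retr_of_inX hs hM h hX]
      exact Nat.zero_le _
    · obtain ⟨a, y, z, rfl, hy, hz⟩ := exists_last_train hX
      obtain ⟨u, v, hp⟩ := h.exists_isPath
      obtain ⟨w, w', h1, h2, h3⟩ := IsPath.exists_cut_after hp hy
      have hz_SL : f.StronglyLegal z := by
        refine SelfMap.StronglyLegal.suffix (p := a ++ [y]) ?_ (h1.append h2)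
        simpa using h
      have h4 := ih (σ := a) (by simp at hσ; omega) (h.prefix h1)
      have h5 := hf.uncoveredLength_retr_of_inX hs hM hz_SL hz
      rw [retr_append h1, retr_cons hy.ne_half, relLength_append, relLength_cons,
        relLength_singleton_of_isTrain hy]
      have h6 := uncoveredLength_append_le hs.length_retr (G.retr a) (y :: G.retr z)
      have h7 := uncoveredLength_append_le hs.length_retr [y] (G.retr z)
      have h8 := uncoveredLength_le_length (G := G) [y]
      simp only [List.length_singleton, List.singleton_append] at h7 h8
      rw [mul_add, mul_add]
      omega

/-- An edge of the train track part in a strongly legal path remains uncovered in the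
retraction. -/
theorem relLength_le_uncoveredLength (hf : IsBetaTrainTrack m) {σ : Word T R H}
    (h : f.StronglyLegal σ) : relLength σ ≤ G.uncoveredLength (G.retr σ) := by
  classical
  obtain ⟨u, v, hp⟩ := h.exists_isPath
  obtain ⟨bs, hbs, rfl⟩ := exists_properBlocks hp h.isReduced
  rw [retr_blocks hp fun β hβ => (hbs β hβ).isBlock, uncoveredLength]
  set ρ := bs.flatMap G.blockRetr with hρ
  have hne : ∀ β ∈ bs, G.blockRetr β ≠ [] := by
    intro β hβ
    obtain ⟨y, q, q', -, e, -⟩ := hf.block_first (hbs β hβ)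
    rw [e]; simp
  -- the boundary of an isolated pre-INP does not lie in the interior of a block
  have halign : ∀ {j k k'} (p q : Word T R H), ρ = p ++ q → G.IsolatedAt ρ j k k' →
      (p.length = j ∨ p.length = j + (G.retr (auxWord k k')).length) →
      ∃ b₁ b₂, bs = b₁ ++ b₂ ∧ p = b₁.flatMap G.blockRetr ∧ q = b₂.flatMap G.blockRetr := by
    intro j k k' p q e hj hpj
    have hpos := hf.length_retr_auxWord_pos hj.1.1
    rcases flatMap_cut _ e with h1 | ⟨b₁, β, b₂, c, d, hb, hc, hd, hβ, hp, hr⟩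
    · exact h1
    · exfalso
      have hc' := List.length_pos_iff.2 hc
      have hd' := List.length_pos_iff.2 hd
      have hlen := congrArg List.length hβ
      rw [List.length_append] at hlen
      rcases β with x | ⟨l, l'⟩
      · simp [blockRetr] at hlen
        omega
      · have hpre : G.PreINPAt ρ (b₁.flatMap G.blockRetr).length l l' :=
          ⟨hbs (Sum.inr (l, l')) (by simp [hb]), _, b₂.flatMap G.blockRetr, rfl, by
            rw [hρ, hb]; simp [blockRetr]⟩
        have hlen' : (G.retr (auxWord l l')).length = c.length + d.length := hlen
        have hpl := congrArg List.length hp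
        rw [List.length_append] at hpl
        have := hj.2 _ l l' hpre (by omega) (by omega)
        omega
  have key : ∀ b₁ b₂, bs = b₁ ++ b₂ →
      relLength (b₁.flatMap blockPath) ≤ Nat.count (G.Uncovered ρ) (b₁.flatMap G.blockRetr).length := by
    intro b₁
    induction b₁ using List.reverseRecOn with
    | nil => intro b₂ _; simp
    | append_singleton b₁ β ih =>
      intro b₂ hb
      have hb' : bs = b₁ ++ β :: b₂ := by rw [hb]; simp
      rw [List.flatMap_append, List.flatMap_append, relLength_append, List.length_append,
        Nat.count_add, List.flatMap_singleton, List.flatMap_singleton]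
      refine add_le_add (ih _ hb') ?_
      rcases β with x | ⟨h, h'⟩
      · by_cases hT : IsTrain x
        swap
        · rw [blockPath, relLength_eq_zero.2 (by simpa [InX] using hT)]
          exact Nat.zero_le _
        have hx : ρ[(b₁.flatMap G.blockRetr).length]? = some x := by
          rw [hρ, hb', List.flatMap_append, List.flatMap_cons,
            List.getElem?_append_right le_rfl]
          simp [blockRetr]
        have hcov : ¬ G.Covered ρ (b₁.flatMap G.blockRetr).length := by
          rintro ⟨j, k, k', hj, h1, h2⟩
          obtain ⟨⟨hk, p, q, hpj, e⟩, -⟩ := id hj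
          obtain ⟨c₁, c₂, hc, hpc, hqc⟩ := halign p (G.retr (auxWord k k') ++ q)
            (by rw [e]; simp) hj (Or.inl hpj)
          obtain ⟨d₁, d₂, hd, hpd, hqd⟩ := halign (p ++ G.retr (auxWord k k')) q e hj
            (Or.inr (by rw [List.length_append, hpj]))
          have hpos := hf.length_retr_auxWord_pos hk
          obtain ⟨mid, rfl⟩ : ∃ mid, d₁ = c₁ ++ mid := by
            rcases List.append_eq_append_iff.1 (hc.symm.trans hd) with ⟨a, ha, -⟩ | ⟨a, ha, -⟩
            · exact ⟨a, ha⟩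
            · have h3 := congrArg List.length hpd
              have h4 := congrArg List.length hpc
              rw [ha, List.flatMap_append] at h4
              simp only [List.length_append] at h3 h4
              omega
          have hmid : mid.flatMap G.blockRetr = G.retr (auxWord k k') := by
            rw [List.flatMap_append, ← hpc] at hpd
            exact (List.append_cancel_left hpd).symm
          have hxmid : Sum.inl x ∈ mid := by
            refine mem_of_position G.blockRetr (b₁ := b₁) (b₂ := b₂) (c₁ := c₁) (c₂ := d₂) ?_
              (by simp [blockRetr]) ?_ ?_
            · rw [← hb', hd]
            · rw [← hpc, hpj]; exact h1
            · rw [← hpc, hpj, hmid]; exact h2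
          -- the subpath over the pre-INP is homotopic into the relative part
          have hbm : ∀ β ∈ mid, G.IsProperBlock β := fun β hβ => hbs β (by simp [hd, hβ])
          have hinf : mid.flatMap blockPath <:+: bs.flatMap blockPath :=
            ⟨c₁.flatMap blockPath, d₂.flatMap blockPath, by rw [hd]; simp⟩
          have h3 := (homotopic_retr (isPath_auxWord (G := G.toGraph1) hk.2)).right
          rw [← hmid] at h3
          have h4 := hf.isPath_of_blockRetr hbm h3
          have h5 : G.Homotopic (Sum.inl (G.foot k)) (Sum.inl (G.foot k'))
              (mid.flatMap blockPath) (auxWord k k') := by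
            have h6 := homotopic_retr h4
            rw [retr_blocks h4 fun β hβ => (hbm β hβ).isBlock, hmid] at h6
            exact h6.trans (homotopic_retr (isPath_auxWord hk.2)).symm
          have h7 := hf.inX_of_legal (h.legal.infix hinf) h5 (inX_auxWord k k')
          refine h7 x ?_ hT
          rw [List.mem_flatMap]
          exact ⟨_, hxmid, by simp [blockPath]⟩
        have hunc : G.Uncovered ρ (b₁.flatMap G.blockRetr).length := ⟨⟨x, hx, hT⟩, hcov⟩
        have e1 : (G.blockRetr (Sum.inl x)).length = 1 := rfl
        rw [blockPath, relLength_singleton_of_isTrain hT, e1, Nat.count_one,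
          if_pos (by simpa using hunc)]
      · rw [blockPath, relLength_eq_zero.2 (inX_auxWord h h')]
        exact Nat.zero_le _
  have := key bs [] (by simp)
  rwa [← hρ] at this

end IsBetaTrainTrack

/-! ### Bounded cancellation -/

theorem finite_setOf_length_le [Finite T] [Finite R] [Finite H] (N : ℕ) :
    {p : Word T R H | p.length ≤ N}.Finite := by
  have h1 : Finite (Edge T R H) := by
    refine Finite.of_injective
      (fun e : Edge T R H => match e with
        | Edge.train e => (Sum.inl e : T ⊕ (R ⊕ H))
        | Edge.low e => Sum.inr (Sum.inl e)
        | Edge.half h => Sum.inr (Sum.inr h)) ?_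
    rintro (a | a | a) (b | b | b) hab <;> simp_all
  have : Finite (Letter T R H) := inferInstanceAs (Finite (Edge T R H × Bool))
  exact List.finite_length_le (Letter T R H) N

namespace SelfMap

variable {G : Complex V T R S H} {f : SelfMap G}

theorem exists_length_image_singleton_le [Finite T] [Finite R] [Finite H] (f : SelfMap G)
    (t : ℕ) : ∃ Λ, ∀ x : Letter T R H, (f.image t [x]).length ≤ Λ := by
  have h := ((finite_setOf_length_le (T := T) (R := R) (H := H) 1).image
    fun p => (f.image t p).length).bddAbove
  obtain ⟨Λ, hΛ⟩ := h
  exact ⟨Λ, fun x => hΛ ⟨[x], by simp, rfl⟩⟩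

theorem mk_image_eq_flatMap (t : ℕ) {ρ : Word T R H} (hΓ : InΓ ρ) : ∀ {u v : V},
    G.IsPath (Sum.inl u) ρ (Sum.inl v) →
    FreeGroup.mk (f.image t ρ) = FreeGroup.mk (ρ.flatMap fun x => f.image t [x]) := by
  induction ρ with
  | nil => intro u v _; rw [f.image_nil]; rfl
  | cons x ρ ih =>
    intro u v hp
    have hx : InΓ [x] := hΓ.infix ⟨[], ρ, by simp⟩
    obtain ⟨w, h1, h2⟩ := IsPath.exists_cut_of_inΓ (p := [x]) (q := ρ) hp hx
    rw [show x :: ρ = [x] ++ ρ from rfl, f.image_append t h1, mk_tighten, mk_append,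
      ih (hΓ.infix ⟨[x], [], by simp⟩) h2, ← mk_append]
    rfl

/-- A terminal piece of the image of a path of `Γ` is, up to a word of bounded length, the image
of a terminal piece of this path. -/
theorem exists_suffix_of_image {t Λ : ℕ} (hΛ : ∀ x : Letter T R H, (f.image t [x]).length ≤ Λ)
    {u v : V} {ρ A c : Word T R H} (hp : G.IsPath (Sum.inl u) ρ (Sum.inl v)) (hΓ : InΓ ρ)
    (h : f.image t ρ = A ++ c) :
    ∃ (a b e : Word T R H) (w : V), ρ = a ++ b ∧ G.IsPath (Sum.inl w) b (Sum.inl v) ∧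
      e.length ≤ Λ ∧ FreeGroup.mk c = FreeGroup.mk e * FreeGroup.mk (f.image t b) := by
  have h1 : tighten (ρ.flatMap fun x => f.image t [x]) = A ++ c := by
    rw [← tighten_congr (mk_image_eq_flatMap t hΓ hp), (f.isReduced_image t ρ).tighten_eq, h]
  obtain ⟨w₁, w₂, hw, -, h2⟩ := exists_split_of_tighten h1
  have h3 : FreeGroup.mk c = FreeGroup.mk w₂ := by rw [← h2, mk_tighten]
  rcases flatMap_cut _ hw with ⟨a, b, rfl, -, rfl⟩ | ⟨a, x, b, e', e, rfl, -, -, hx, -, rfl⟩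
  · obtain ⟨w, -, hb⟩ := IsPath.exists_cut_of_inΓ hp (inΓ_append.1 hΓ).1
    refine ⟨a, b, [], w, rfl, hb, by simp, ?_⟩
    rw [h3, mk_image_eq_flatMap t (inΓ_append.1 hΓ).2 hb, mk_nil, one_mul]
  · rw [show a ++ x :: b = (a ++ [x]) ++ b by simp] at hp hΓ
    obtain ⟨w, -, hb⟩ := IsPath.exists_cut_of_inΓ hp (inΓ_append.1 hΓ).1
    refine ⟨a ++ [x], b, e, w, by simp, hb, ?_, ?_⟩
    · have := hΛ x
      rw [hx, List.length_append] at this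
      omega
    · rw [h3, mk_append, mk_image_eq_flatMap t (inΓ_append.1 hΓ).2 hb]

theorem length_image_le {t Λ : ℕ} (hΛ : ∀ x : Letter T R H, (f.image t [x]).length ≤ Λ)
    {u v : V} {ρ : Word T R H} (hp : G.IsPath (Sum.inl u) ρ (Sum.inl v)) (hΓ : InΓ ρ) :
    (f.image t ρ).length ≤ Λ * ρ.length := by
  have h1 : f.image t ρ = tighten (ρ.flatMap fun x => f.image t [x]) :=
    (f.isReduced_image t ρ).eq_tighten (mk_image_eq_flatMap t hΓ hp)
  rw [h1]
  refine (tighten_length_le _).trans ?_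
  clear h1 hp hΓ
  induction ρ with
  | nil => simp
  | cons x ρ ih =>
    rw [List.flatMap_cons, List.length_append, List.length_cons, mul_add, mul_one]
    have := hΛ x
    omega

end SelfMap

namespace IsBetaTrainTrack

variable {G : Complex V T R S H} {f : SelfMap G} {n : ℕ}
  {α : FreeGroup (Fin n) ≃* FreeGroup (Fin n)} {m : Marking G f n α} {s L M : ℕ}

/-- Reduced paths of `Γ` whose image is short are short, since paths with the same endpoints are
determined by their images. -/
theorem exists_length_le_of_image [Finite V] [Finite T] [Finite R] [Finite H]
    (hf : IsBetaTrainTrack m) (t N : ℕ) : ∃ C, ∀ (u v : V) (ρ : Word T R H),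
    G.IsPath (Sum.inl u) ρ (Sum.inl v) → InΓ ρ → IsReduced ρ → (f.image t ρ).length ≤ N →
    ρ.length ≤ C := by
  have h : ∀ u v : V, ∃ C, ∀ ρ : Word T R H, G.IsPath (Sum.inl u) ρ (Sum.inl v) → InΓ ρ →
      IsReduced ρ → (f.image t ρ).length ≤ N → ρ.length ≤ C := by
    intro u v
    have hfin : {ρ : Word T R H | G.IsPath (Sum.inl u) ρ (Sum.inl v) ∧ InΓ ρ ∧ IsReduced ρ ∧
        (f.image t ρ).length ≤ N}.Finite := by
      refine Set.Finite.of_finite_image (f := f.image t)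
        ((finite_setOf_length_le N).subset ?_) ?_
      · rintro _ ⟨ρ, hρ, rfl⟩
        exact hρ.2.2.2
      · rintro p hp q hq e
        exact hf.eq_of_image_eq t hp.1 hq.1 hp.2.1 hq.2.1 hp.2.2.1 hq.2.2.1 e
    obtain ⟨C, hC⟩ := (hfin.image List.length).bddAbove
    exact ⟨C, fun ρ h1 h2 h3 h4 => hC ⟨ρ, ⟨h1, h2, h3, h4⟩, rfl⟩⟩
  choose C hC using h
  obtain ⟨B, hB⟩ := (Set.finite_range fun p : V × V => C p.1 p.2).bddAbove
  exact ⟨B, fun u v ρ h1 h2 h3 h4 => (hC u v ρ h1 h2 h3 h4).trans (hB ⟨(u, v), rfl⟩)⟩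

/-- Bounded cancellation between the images of the two parts of a reduced path of `Γ`. -/
theorem exists_bounded_cancellation [Finite V] [Finite T] [Finite R] [Finite H]
    (hf : IsBetaTrainTrack m) (t : ℕ) : ∃ C, ∀ (u w v : V) (ρ₁ ρ₂ A B c : Word T R H),
    G.IsPath (Sum.inl u) ρ₁ (Sum.inl w) → G.IsPath (Sum.inl w) ρ₂ (Sum.inl v) →
    InΓ (ρ₁ ++ ρ₂) → IsReduced (ρ₁ ++ ρ₂) → f.image t ρ₁ = A ++ c →
    f.image t ρ₂ = invRev c ++ B → c.length ≤ C := by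
  obtain ⟨Λ, hΛ⟩ := f.exists_length_image_singleton_le t
  obtain ⟨C, hC⟩ := hf.exists_length_le_of_image t (Λ + Λ)
  refine ⟨Λ + Λ * C, fun u w v ρ₁ ρ₂ A B c h1 h2 hΓ hr e1 e2 => ?_⟩
  obtain ⟨hΓ1, hΓ2⟩ := inΓ_append.1 hΓ
  have e3 : f.image t (invRev ρ₂) = invRev B ++ c := by
    rw [f.image_invRev t h2, e2, FreeGroup.invRev_append, FreeGroup.invRev_invRev]
  obtain ⟨a₁, b₁, x₁, w₁, rfl, hb₁, hx₁, hc₁⟩ := SelfMap.exists_suffix_of_image hΛ h1 hΓ1 e1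
  obtain ⟨a₂, b₂, x₂, w₂, hρ, hb₂, hx₂, hc₂⟩ :=
    SelfMap.exists_suffix_of_image hΛ h2.invRev (inΓ_invRev hΓ2) e3
  have hρ' : ρ₂ = invRev b₂ ++ invRev a₂ := by
    rw [← FreeGroup.invRev_append, ← hρ, FreeGroup.invRev_invRev]
  have hp : G.IsPath (Sum.inl w₁) (b₁ ++ invRev b₂) (Sum.inl w₂) := hb₁.append hb₂.invRev
  have hin : b₁ ++ invRev b₂ <:+: a₁ ++ b₁ ++ ρ₂ := ⟨a₁, invRev a₂, by simp [hρ']⟩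
  have hlen : (f.image t (b₁ ++ invRev b₂)).length ≤ Λ + Λ := by
    have : f.image t (b₁ ++ invRev b₂) = tighten (invRev x₁ ++ x₂) := by
      refine (f.isReduced_image t _).eq_tighten ?_
      rw [f.image_append t hb₁, mk_tighten, f.image_invRev t hb₂]
      rw [hc₁] at hc₂
      simp only [mk_append, mk_invRev]
      have h4 : FreeGroup.mk (f.image t b₁) =
          (FreeGroup.mk x₁)⁻¹ * (FreeGroup.mk x₂ * FreeGroup.mk (f.image t b₂)) := by
        rw [← hc₂]; group
      rw [h4]; group
    rw [this]
    refine (tighten_length_le _).trans ?_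
    rw [List.length_append, FreeGroup.invRev_length]
    omega
  have h5 := hC _ _ _ hp (hΓ.infix hin) (by
    obtain ⟨y, z, e⟩ := hin
    rw [← e] at hr
    exact hr.left.right) hlen
  have h6 : c = tighten (x₁ ++ f.image t b₁) := by
    have hcr : IsReduced c := by
      have := f.isReduced_image t (a₁ ++ b₁)
      rw [e1] at this
      exact this.right
    exact hcr.eq_tighten (by rw [hc₁, mk_append])
  rw [h6]
  refine (tighten_length_le _).trans ?_
  rw [List.length_append]
  have h7 := SelfMap.length_image_le hΛ hb₁ (inΓ_append.1 hΓ1).2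
  rw [List.length_append] at h5
  have h8 : Λ * b₁.length ≤ Λ * C := Nat.mul_le_mul_left _ (by omega)
  omega

/-- Lower bound for the relative length of the image of a concatenation. -/
theorem exists_uncoveredLength_image_append [Finite V] [Finite T] [Finite R] [Finite H]
    (hf : IsBetaTrainTrack m) (hL : ∀ h h', (G.retr (auxWord h h')).length ≤ L) (t : ℕ) :
    ∃ C, ∀ (u w v : V) (ρ₁ ρ₂ : Word T R H),
    G.IsPath (Sum.inl u) ρ₁ (Sum.inl w) → G.IsPath (Sum.inl w) ρ₂ (Sum.inl v) →
    InΓ (ρ₁ ++ ρ₂) → IsReduced (ρ₁ ++ ρ₂) →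
    G.uncoveredLength (f.image t ρ₁) + G.uncoveredLength (f.image t ρ₂) ≤
      G.uncoveredLength (f.image t (ρ₁ ++ ρ₂)) + C := by
  obtain ⟨C, hC⟩ := hf.exists_bounded_cancellation t
  refine ⟨2 * C + 3 * (4 * L + 2), fun u w v ρ₁ ρ₂ h1 h2 hΓ hr => ?_⟩
  obtain ⟨A, c, B, e1, e2, hAB⟩ :=
    exists_cancellation (f.isReduced_image t ρ₁) (f.isReduced_image t ρ₂)
  have hc := hC u w v ρ₁ ρ₂ A B c h1 h2 hΓ hr e1 e2
  rw [f.image_append t h1, tighten_eq_of_cancellation e1 e2 hAB, e1, e2]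
  have h3 := uncoveredLength_append_le hL A c
  have h4 := uncoveredLength_append_le hL (invRev c) B
  have h5 := le_uncoveredLength_append hL A B
  have h6 := G.uncoveredLength_le_length c
  have h7 := G.uncoveredLength_le_length (invRev c)
  rw [FreeGroup.invRev_length] at h7
  omega

end IsBetaTrainTrack

namespace Complex

variable {G : Complex V T R S H} {L : ℕ}

/-! ### Growth of the uncovered length along concatenations of strongly legal paths -/

/-- Initial segments of a path which consist of entire blocks end at vertices of `Γ`. -/
theorem exists_eq_inl_of_blocks {bs : List (Letter T R H ⊕ (H × H))} {w : V ⊕ S} : ∀ {u : V},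
    G.IsPath (Sum.inl u) (bs.flatMap blockPath) w → (∀ β ∈ bs, G.IsBlock β) →
    ∃ w' : V, w = Sum.inl w' := by
  induction bs with
  | nil => exact fun {u} hp _ => ⟨u, hp.symm⟩
  | cons β bs ih =>
    intro u hp hbs
    rw [List.flatMap_cons] at hp
    obtain ⟨w₁, h1, h2⟩ := isPath_append.1 hp
    obtain ⟨u', w₂, h3⟩ := (hbs β (by simp)).exists_path
    have e1 := h1.start_unique h3 (blockPath_ne_nil β)
    rw [e1] at h1
    obtain rfl := h1.end_unique h3
    exact ih h2 fun b hb => hbs b (by simp [hb])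

/-- Multiplication with a short word does not decrease the uncovered length substantially. -/
theorem uncoveredLength_tighten_append_right
    (hL : ∀ h h', (G.retr (auxWord h h')).length ≤ L) {u v : Word T R H} (hu : IsReduced u)
    (hv : IsReduced v) : G.uncoveredLength v ≤
      G.uncoveredLength (tighten (u ++ v)) + u.length + 2 * (4 * L + 2) := by
  obtain ⟨p, c, q, rfl, rfl, hpq⟩ := exists_cancellation hu hv
  rw [tighten_eq_of_cancellation rfl rfl hpq]
  have h1 := uncoveredLength_append_le hL (invRev c) q
  have h2 := le_uncoveredLength_append hL p q
  have h3 := G.uncoveredLength_le_length (invRev c)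
  rw [FreeGroup.invRev_length] at h3
  rw [List.length_append]
  omega

theorem uncoveredLength_tighten_append_left
    (hL : ∀ h h', (G.retr (auxWord h h')).length ≤ L) {u v : Word T R H} (hu : IsReduced u)
    (hv : IsReduced v) : G.uncoveredLength u ≤
      G.uncoveredLength (tighten (u ++ v)) + v.length + 2 * (4 * L + 2) := by
  obtain ⟨p, c, q, rfl, rfl, hpq⟩ := exists_cancellation hu hv
  rw [tighten_eq_of_cancellation rfl rfl hpq]
  have h1 := uncoveredLength_append_le hL p c
  have h2 := le_uncoveredLength_append hL p q
  have h3 := G.uncoveredLength_le_length c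
  rw [List.length_append, FreeGroup.invRev_length]
  omega

end Complex

/-- `p` is a concatenation of `K` strongly legal paths, leading from `u` to `v`. -/
inductive SelfMap.IsChain {G : Complex V T R S H} (f : SelfMap G) :
    ℕ → V → V → Word T R H → Prop
  | nil (u : V) : SelfMap.IsChain f 0 u u []
  | cons {K : ℕ} {u w v : V} {σ p : Word T R H} (hσ : f.StronglyLegal σ)
      (hu : G.IsPath (Sum.inl u) σ (Sum.inl w)) (hp : SelfMap.IsChain f K w v p) :
      SelfMap.IsChain f (K + 1) u v (σ ++ p)

theorem SelfMap.IsChain.isPath {G : Complex V T R S H} {f : SelfMap G} {K : ℕ} {u v : V}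
    {p : Word T R H} (h : f.IsChain K u v p) : G.IsPath (Sum.inl u) p (Sum.inl v) := by
  induction h with
  | nil u => rfl
  | cons _ hu _ ih => exact hu.append ih

namespace IsBetaTrainTrack

variable {G : Complex V T R S H} {f : SelfMap G} {n : ℕ}
  {α : FreeGroup (Fin n) ≃* FreeGroup (Fin n)} {m : Marking G f n α} {s L M : ℕ}

/-- The image of a concatenation of `K` strongly legal paths is homotopic to such a concatenation. -/
theorem isChain_iter (hf : IsBetaTrainTrack m) (t : ℕ) {K : ℕ} {u v : V} {p : Word T R H}
    (h : f.IsChain K u v p) : ∃ q, f.IsChain K (f.onV^[t] u) (f.onV^[t] v) q ∧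
      G.Homotopic (Sum.inl (f.onV^[t] u)) (Sum.inl (f.onV^[t] v)) (f.iter t p) q := by
  induction h with
  | nil u =>
    rw [f.iter_nil]
    exact ⟨[], .nil _, .refl rfl⟩
  | cons hσ hu _ ih =>
    obtain ⟨q, h1, h2⟩ := ih
    refine ⟨_, .cons (hf.stronglyLegal_tighten_iter hσ t) (f.isPath_iter_inl t hu).tighten h1, ?_⟩
    rw [f.iter_append]
    exact Homotopic.append (.tighten (f.isPath_iter_inl t hu)) h2

/-- A terminal segment of the retraction of a strongly legal path is, up to a short initial
segment, the retraction of a strongly legal path. -/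
theorem _root_.BetaTrainTrack.SelfMap.StronglyLegal.exists_retr_suffix
    (hL : ∀ h h', (G.retr (auxWord h h')).length ≤ L) {σ a ω : Word T R H}
    (h : f.StronglyLegal σ) (e : G.retr σ = a ++ ω) :
    ∃ s σ', ω = s ++ G.retr σ' ∧ s.length ≤ L ∧ f.StronglyLegal σ' := by
  obtain ⟨u, v, hp⟩ := h.exists_isPath
  obtain ⟨bs, hbs, rfl⟩ := exists_properBlocks hp h.isReduced
  rw [retr_blocks hp fun β hβ => (hbs β hβ).isBlock] at e
  have key : ∀ b₁ b₂, bs = b₁ ++ b₂ → f.StronglyLegal (b₂.flatMap blockPath) ∧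
      G.retr (b₂.flatMap blockPath) = b₂.flatMap G.blockRetr := by
    rintro b₁ b₂ rfl
    rw [List.flatMap_append] at hp h
    obtain ⟨w, h1, h2⟩ := isPath_append.1 hp
    obtain ⟨w, rfl⟩ := exists_eq_inl_of_blocks h1 fun β hβ => (hbs β (by simp [hβ])).isBlock
    exact ⟨h.suffix h1, retr_blocks h2 fun β hβ => (hbs β (by simp [hβ])).isBlock⟩
  rcases flatMap_cut _ e with ⟨b₁, b₂, hb, -, rfl⟩ | ⟨b₁, β, b₂, s', s, hb, hs', -, hβ, -, rfl⟩
  · obtain ⟨h1, h2⟩ := key b₁ b₂ hb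
    exact ⟨[], _, by rw [h2, List.nil_append], by simp, h1⟩
  · obtain ⟨h1, h2⟩ := key (b₁ ++ [β]) b₂ (by rw [hb]; simp)
    refine ⟨s, _, by rw [h2], ?_, h1⟩
    have hlen := congrArg List.length hβ
    rw [List.length_append] at hlen
    have := List.length_pos_iff.2 hs'
    rcases β with x | ⟨k, k'⟩
    · simp only [blockRetr, List.length_singleton] at hlen
      omega
    · have := hL k k'
      simp only [blockRetr] at hlen
      omega

theorem _root_.BetaTrainTrack.SelfMap.StronglyLegal.exists_retr_prefix
    (hL : ∀ h h', (G.retr (auxWord h h')).length ≤ L) {σ b ω : Word T R H}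
    (h : f.StronglyLegal σ) (e : G.retr σ = ω ++ b) :
    ∃ σ' s, ω = G.retr σ' ++ s ∧ s.length ≤ L ∧ f.StronglyLegal σ' := by
  obtain ⟨u, v, hp⟩ := h.exists_isPath
  obtain ⟨bs, hbs, rfl⟩ := exists_properBlocks hp h.isReduced
  rw [retr_blocks hp fun β hβ => (hbs β hβ).isBlock] at e
  have key : ∀ b₁ b₂, bs = b₁ ++ b₂ → f.StronglyLegal (b₁.flatMap blockPath) ∧
      G.retr (b₁.flatMap blockPath) = b₁.flatMap G.blockRetr := by
    rintro b₁ b₂ rfl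
    rw [List.flatMap_append] at hp h
    obtain ⟨w, h1, h2⟩ := isPath_append.1 hp
    obtain ⟨w, rfl⟩ := exists_eq_inl_of_blocks h1 fun β hβ => (hbs β (by simp [hβ])).isBlock
    exact ⟨h.prefix h1, retr_blocks h1 fun β hβ => (hbs β (by simp [hβ])).isBlock⟩
  rcases flatMap_cut _ e with ⟨b₁, b₂, hb, rfl, -⟩ | ⟨b₁, β, b₂, s, s', hb, -, hs', hβ, rfl, -⟩
  · obtain ⟨h1, h2⟩ := key b₁ b₂ hb
    exact ⟨_, [], by rw [h2, List.append_nil], by simp, h1⟩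
  · obtain ⟨h1, h2⟩ := key b₁ (β :: b₂) hb
    refine ⟨_, s, by rw [h2], ?_, h1⟩
    have hlen := congrArg List.length hβ
    rw [List.length_append] at hlen
    have := List.length_pos_iff.2 hs'
    rcases β with x | ⟨k, k'⟩
    · simp only [blockRetr, List.length_singleton] at hlen
      omega
    · have := hL k k'
      simp only [blockRetr] at hlen
      omega

theorem _root_.BetaTrainTrack.SelfMap.stronglyLegal_nil (f : SelfMap G) (u : V) :
    f.StronglyLegal [] := by
  refine SelfMap.Legal.stronglyLegal (u := u) (v := u) ?_ .nil (by simp [InΓ]) rfl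
  intro t _ σ hσ u v _
  rw [f.iter_nil, List.infix_nil] at hσ
  simp [hσ, InX]

/-- The middle part of the retraction of a strongly legal path is, up to two short segments, the
retraction of a strongly legal path. -/
theorem _root_.BetaTrainTrack.SelfMap.StronglyLegal.exists_retr_infix
    (hL : ∀ h h', (G.retr (auxWord h h')).length ≤ L) {σ a ω b : Word T R H}
    (h : f.StronglyLegal σ) (e : G.retr σ = a ++ ω ++ b) :
    ∃ s₁ σ' s₂, ω = s₁ ++ G.retr σ' ++ s₂ ∧ s₁.length ≤ L ∧ s₂.length ≤ L ∧
      f.StronglyLegal σ' := by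
  rw [List.append_assoc] at e
  obtain ⟨s₁, σ₁, e1, h1, h2⟩ := h.exists_retr_suffix hL e
  rcases List.append_eq_append_iff.1 e1 with ⟨c, rfl, -⟩ | ⟨c, rfl, e2⟩
  · obtain ⟨u, -, -⟩ := h.exists_isPath
    refine ⟨ω, [], [], by simp, ?_, by simp, f.stronglyLegal_nil u⟩
    rw [List.length_append] at h1
    omega
  · obtain ⟨σ', s₂, rfl, h3, h4⟩ := h2.exists_retr_prefix hL e2
    exact ⟨s₁, σ', s₂, by simp, h1, h3, h4⟩

/-- Iterates which are sufficiently expanding multiply the uncovered length of the retraction of a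
strongly legal path by `κ`. -/
theorem mul_uncoveredLength_le_of_stronglyLegal (hf : IsBetaTrainTrack m)
    (hs : f.IsNielsenExponent s L M) (hM : 2 * L < M) {κ t : ℕ}
    (ht : ∀ p : Word T R H, κ * (8 * L + 5) * relLength p ≤ relLength (f.iter t p))
    {σ : Word T R H} (h : f.StronglyLegal σ) :
    κ * G.uncoveredLength (G.retr σ) ≤ G.uncoveredLength (f.image t σ) := by
  obtain ⟨u, v, hp⟩ := h.exists_isPath
  have h1 : relLength (f.iter t σ) ≤ G.uncoveredLength (f.image t σ) := by
    rw [hf.image_stronglyLegal t h]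
    refine le_trans (le_of_eq ?_)
      (hf.relLength_le_uncoveredLength (hf.stronglyLegal_tighten_iter h t))
    rcases Nat.eq_zero_or_pos t with rfl | htpos
    · change relLength σ = relLength (tighten σ)
      rw [h.isReduced.tighten_eq]
    · exact ((h.legal t htpos).relLength_tighten (f.isPath_iter_inl t hp)).symm
  refine le_trans ?_ ((ht σ).trans h1)
  rw [mul_assoc]
  exact Nat.mul_le_mul_left _ (hf.uncoveredLength_retr_le hs hM _ le_rfl h)

/-- The same for subpaths of the retraction, up to a bounded error. -/
theorem exists_mul_uncoveredLength_le_of_infix [Finite T] [Finite R] [Finite H]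
    (hf : IsBetaTrainTrack m) (hs : f.IsNielsenExponent s L M) (hM : 2 * L < M) {κ t : ℕ}
    (ht : ∀ p : Word T R H, κ * (8 * L + 5) * relLength p ≤ relLength (f.iter t p)) :
    ∃ C, ∀ σ a ω b : Word T R H, f.StronglyLegal σ → G.retr σ = a ++ ω ++ b →
      κ * G.uncoveredLength ω ≤ G.uncoveredLength (f.image t ω) + C := by
  obtain ⟨Λ, hΛ⟩ := f.exists_length_image_singleton_le t
  refine ⟨κ * (10 * L + 4) + (2 * (Λ * L) + 4 * (4 * L + 2)), fun σ a ω b h e => ?_⟩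
  have hL := hs.length_retr
  obtain ⟨u, v, hp⟩ := h.exists_isPath
  have hΓ := hf.inΓ_retr hp
  have hpath := (homotopic_retr hp).right
  rw [e] at hΓ hpath
  rw [List.append_assoc] at hpath hΓ
  obtain ⟨hΓa, hΓω⟩ := inΓ_append.1 hΓ
  obtain ⟨u₁, -, hpω⟩ := IsPath.exists_cut_of_inΓ hpath hΓa
  obtain ⟨v₁, hpω, -⟩ := IsPath.exists_cut_of_inΓ hpω (inΓ_append.1 hΓω).1
  replace hΓω := (inΓ_append.1 hΓω).1
  obtain ⟨s₁, σ', s₂, rfl, hs₁, hs₂, hσ'⟩ := h.exists_retr_infix hL e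
  obtain ⟨h1, hΓ₂⟩ := inΓ_append.1 hΓω
  obtain ⟨hΓ₁, hΓσ⟩ := inΓ_append.1 h1
  obtain ⟨w₂, hp12, hp2⟩ := IsPath.exists_cut_of_inΓ hpω h1
  obtain ⟨w₁, hp1, hpσ⟩ := IsPath.exists_cut_of_inΓ hp12 hΓ₁
  obtain ⟨u', v', hσp⟩ := hσ'.exists_isPath
  have h2 := hf.mul_uncoveredLength_le_of_stronglyLegal hs hM ht hσ'
  rw [← hf.image_retr t hσp] at h2
  have h3 := uncoveredLength_append_le hL (s₁ ++ G.retr σ') s₂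
  have h4 := uncoveredLength_append_le hL s₁ (G.retr σ')
  have h5 := G.uncoveredLength_le_length s₁
  have h6 := G.uncoveredLength_le_length s₂
  have h7 : κ * G.uncoveredLength (s₁ ++ G.retr σ' ++ s₂) ≤
      κ * G.uncoveredLength (G.retr σ') + κ * (10 * L + 4) := by
    rw [← mul_add]
    exact Nat.mul_le_mul_left _ (by omega)
  have h8 := uncoveredLength_tighten_append_left hL (f.isReduced_image t (s₁ ++ G.retr σ'))
    (f.isReduced_image t s₂)
  have h9 := uncoveredLength_tighten_append_right hL (f.isReduced_image t s₁)
    (f.isReduced_image t (G.retr σ'))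
  rw [← f.image_append t hp12] at h8
  rw [← f.image_append t hp1] at h9
  have h10 := (SelfMap.length_image_le hΛ hp1 hΓ₁).trans (Nat.mul_le_mul_left Λ hs₁)
  have h11 := (SelfMap.length_image_le hΛ hp2 hΓ₂).trans (Nat.mul_le_mul_left Λ hs₂)
  omega

/-- The growth estimate for concatenations of `K` strongly legal paths. It is proved for terminal
segments of the reduced path of `Γ`, so that the induction on `K` goes through. -/
theorem exists_mul_uncoveredLength_le_of_isChain [Finite V] [Finite T] [Finite R] [Finite H]
    (hf : IsBetaTrainTrack m) (hs : f.IsNielsenExponent s L M) (hM : 2 * L < M) {κ t : ℕ}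
    (ht : ∀ p : Word T R H, κ * (8 * L + 5) * relLength p ≤ relLength (f.iter t p)) :
    ∃ C, ∀ (K : ℕ) (u v : V) (p ω : Word T R H), f.IsChain K u v p →
      ω <:+ tighten (G.retr p) →
      κ * G.uncoveredLength ω ≤ G.uncoveredLength (f.image t ω) + K * C := by
  have hL := hs.length_retr
  obtain ⟨C₁, hC₁⟩ := hf.exists_mul_uncoveredLength_le_of_infix hs hM ht
  obtain ⟨C₂, hC₂⟩ := hf.exists_uncoveredLength_image_append hL t
  refine ⟨C₁ + C₂ + κ * (4 * L + 2), fun K u v p ω h => ?_⟩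
  induction h generalizing ω with
  | nil u =>
    intro hω
    rw [retr_nil, FreeGroup.IsReduced.nil.tighten_eq, List.suffix_nil] at hω
    rw [hω, uncoveredLength_nil]
    omega
  | @cons K u w v σ p hσ hu hp ih =>
    intro hω
    have hc : tighten (G.retr (σ ++ p)) = tighten (G.retr σ ++ tighten (G.retr p)) := by
      refine tighten_congr ?_
      rw [retr_append hu, mk_append, mk_append, mk_tighten]
    obtain ⟨A, c, B, e1, e2, hAB⟩ :=
      exists_cancellation (hf.isReduced_retr hσ) (isReduced_tighten (G.retr p))
    rw [hc, tighten_eq_of_cancellation e1 e2 hAB] at hω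
    rw [Nat.succ_mul]
    obtain ⟨a, ha⟩ := hω
    -- a terminal segment of `A ++ B` is one of `B`, or it contains `B`
    rcases List.append_eq_append_iff.1 ha with ⟨A', rfl, rfl⟩ | ⟨d, rfl, rfl⟩
    · have h1 := hC₁ σ a A' c hσ e1
      have h2 := ih B ⟨invRev c, e2.symm⟩
      have hΓσ := hf.inΓ_retr hu
      have hpσ := (homotopic_retr hu).right
      rw [e1, List.append_assoc] at hΓσ hpσ
      have hΓp := (hf.inΓ_retr hp.isPath).tighten
      have hpp := (homotopic_retr hp.isPath).right.tighten
      rw [e2] at hΓp hpp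
      obtain ⟨hΓa, hΓA⟩ := inΓ_append.1 hΓσ
      obtain ⟨u₁, -, hpA⟩ := IsPath.exists_cut_of_inΓ hpσ hΓa
      obtain ⟨hΓA, -⟩ := inΓ_append.1 hΓA
      obtain ⟨u₂, hpA, hpc⟩ := IsPath.exists_cut_of_inΓ hpA hΓA
      obtain ⟨hΓc, hΓB⟩ := inΓ_append.1 hΓp
      obtain ⟨u₃, hpc', hpB⟩ := IsPath.exists_cut_of_inΓ hpp hΓc
      obtain rfl : u₂ = u₃ := Sum.inl.inj (hpc.invRev.end_unique hpc')
      rw [List.append_assoc] at hAB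
      have h3 := hC₂ u₁ u₂ v A' B hpA hpB (inΓ_append.2 ⟨hΓA, hΓB⟩) hAB.right
      have h4 := uncoveredLength_append_le hL A' B
      have h5 : κ * G.uncoveredLength (A' ++ B) ≤ κ * G.uncoveredLength A' +
          κ * G.uncoveredLength B + κ * (4 * L + 2) := by
        rw [← mul_add, ← mul_add]
        exact Nat.mul_le_mul_left _ h4
      omega
    · have h2 := ih ω ⟨invRev c ++ d, by rw [e2]; simp⟩
      omega

/-- Concatenations of strongly legal paths which are long in comparison with the number of their
pieces grow under all iterates of `f^t`. One factor `κ + 1` is spent on the error term. -/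
theorem mul_uncoveredLength_le_image_mul (hf : IsBetaTrainTrack m) {κ t C : ℕ} (hκ : 1 ≤ κ)
    (hC : ∀ (K : ℕ) (u v : V) (p ω : Word T R H), f.IsChain K u v p →
      ω <:+ tighten (G.retr p) →
      (κ + 1) * G.uncoveredLength ω ≤ G.uncoveredLength (f.image t ω) + K * C)
    {K : ℕ} {u v : V} {p : Word T R H} (h : f.IsChain K u v p)
    (hK : K * C ≤ G.uncoveredLength (tighten (G.retr p))) (k : ℕ) :
    κ * G.uncoveredLength (tighten (G.retr p)) ≤
      G.uncoveredLength (f.image ((k + 1) * t) p) := by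
  induction k with
  | zero =>
    have h1 := hC K u v p _ h List.suffix_rfl
    have h2 : f.image t (tighten (G.retr p)) = f.image t p :=
      (hf.image_congr t ((homotopic_retr h.isPath).trans
        (.tighten (homotopic_retr h.isPath).right))).symm
    rw [h2, add_mul] at h1
    rw [zero_add, one_mul]
    omega
  | succ k ih =>
    obtain ⟨q, h1, h2⟩ := hf.isChain_iter ((k + 1) * t) h
    have e : f.image ((k + 1) * t) p = tighten (G.retr q) := hf.image_of_homotopic h2
    have h3 := hC K _ _ q _ h1 List.suffix_rfl
    rw [← e, hf.image_add t _ h.isPath, show t + (k + 1) * t = (k + 1 + 1) * t by ring,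
      add_mul] at h3
    have h4 : G.uncoveredLength (tighten (G.retr p)) ≤
        κ * G.uncoveredLength (tighten (G.retr p)) := Nat.le_mul_of_pos_left _ hκ
    have h5 : G.uncoveredLength (f.image ((k + 1) * t) p) ≤
        κ * G.uncoveredLength (f.image ((k + 1) * t) p) := Nat.le_mul_of_pos_left _ hκ
    omega

end IsBetaTrainTrack

/-! ### Cutting normalized paths into pieces -/

theorem XTight.infix {p q : Word T R H} (h : XTight q) (hp : p <:+: q) : XTight p := by
  rintro a x b rfl
  obtain ⟨c, d, rfl⟩ := hp
  exact h (c ++ a) x (b ++ d) (by simp)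

/-- A path can be cut in front of any edge of the train track part. -/
theorem exists_cut_at_relLength {N : ℕ} : ∀ {p : Word T R H}, N < relLength p →
    ∃ a y b, p = a ++ y :: b ∧ IsTrain y ∧ relLength a = N := by
  intro p
  induction p generalizing N with
  | nil => intro h; simp [relLength] at h
  | cons x p ih =>
    intro h
    rw [relLength_cons] at h
    by_cases hx : IsTrain x
    · rw [relLength_singleton_of_isTrain hx] at h
      cases N with
      | zero => exact ⟨[], x, p, rfl, hx, rfl⟩
      | succ N =>
        obtain ⟨a, y, b, rfl, hy, ha⟩ := ih (N := N) (by omega)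
        refine ⟨x :: a, y, b, rfl, hy, ?_⟩
        rw [relLength_cons, relLength_singleton_of_isTrain hx, ha, add_comm]
    · have h0 : relLength [x] = 0 := relLength_eq_zero.2 (by simpa [InX] using hx)
      rw [h0, zero_add] at h
      obtain ⟨a, y, b, rfl, hy, ha⟩ := ih h
      refine ⟨x :: a, y, b, rfl, hy, ?_⟩
      rw [relLength_cons, h0, ha, zero_add]

/-- An illegal turn of a path is determined by its position, i.e. by its initial edge in the train
track part. -/
theorem SelfMap.ilt_le_relLength {G : Complex V T R S H} (f : SelfMap G) (p : Word T R H) :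
    f.ilt p ≤ relLength p := by
  unfold SelfMap.ilt
  rw [← Set.ncard_Iio_nat (relLength p)]
  refine Set.ncard_le_ncard_of_injOn (fun s => relLength s.1) ?_ ?_ (Set.finite_Iio _)
  · rintro ⟨a, τ, b⟩ ⟨rfl, y, χ, z, hy, -, -, rfl, -⟩
    simp only [Set.mem_Iio, relLength_append]
    rw [relLength_cons, relLength_singleton_of_isTrain hy]
    omega
  · rintro ⟨a, τ, b⟩ ⟨e, y, χ, z, hy, hz, hχ, rfl, -⟩ ⟨a', τ', b'⟩
      ⟨e', y', χ', z', hy', hz', hχ', rfl, -⟩ h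
    simp only at e e' h ⊢
    rw [e] at e'
    simp only [List.append_assoc, List.cons_append, List.nil_append] at e'
    have ha : a = a' ∧ y :: (χ ++ z :: b) = y' :: (χ' ++ z' :: b') := by
      rcases List.append_eq_append_iff.1 e' with ⟨c, rfl, hc⟩ | ⟨c, rfl, hc⟩
      · cases c with
        | nil => exact ⟨by simp, by simpa using hc⟩
        | cons x c =>
          simp only [List.cons_append, List.cons.injEq] at hc
          rw [relLength_append, relLength_cons, ← hc.1, relLength_singleton_of_isTrain hy] at h
          omega
      · cases c with
        | nil => exact ⟨by simp, by simpa using hc.symm⟩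
        | cons x c =>
          simp only [List.cons_append, List.cons.injEq] at hc
          rw [relLength_append, relLength_cons, ← hc.1, relLength_singleton_of_isTrain hy'] at h
          omega
    obtain ⟨rfl, ha⟩ := ha
    simp only [List.cons.injEq] at ha
    obtain ⟨rfl, ha⟩ := ha
    have hb : χ = χ' ∧ z :: b = z' :: b' := by
      rcases List.append_eq_append_iff.1 ha with ⟨c, rfl, hc⟩ | ⟨c, rfl, hc⟩
      · cases c with
        | nil => exact ⟨by simp, by simpa using hc⟩
        | cons x c =>
          simp only [List.cons_append, List.cons.injEq] at hc
          exact absurd (hc.1 ▸ hz) (hχ' x (by simp))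
      · cases c with
        | nil => exact ⟨by simp, by simpa using hc.symm⟩
        | cons x c =>
          simp only [List.cons_append, List.cons.injEq] at hc
          exact absurd (hc.1 ▸ hz') (hχ x (by simp))
    obtain ⟨rfl, hb⟩ := hb
    simp only [List.cons.injEq] at hb
    obtain ⟨rfl, rfl⟩ := hb
    rfl

namespace IsBetaTrainTrack

variable {G : Complex V T R S H} {f : SelfMap G} {n : ℕ}
  {α : FreeGroup (Fin n) ≃* FreeGroup (Fin n)} {m : Marking G f n α} {s L M : ℕ}

/-- If the auxiliary edges `(h, k)` and `(k, l)` are consecutive, with reduced image under the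
retraction, then their pre-INPs form the pre-INP of `(h, l)`, so that they are not isolated. -/
theorem not_isolatedAt_of_consecutive (hf : IsBetaTrainTrack m) {h k l : H}
    {ρ p q : Word T R H} (hhk : G.IsAux h k) (hkl : G.IsAux k l)
    (e : ρ = p ++ G.retr (auxWord h k) ++ (G.retr (auxWord k l) ++ q)) (hr : IsReduced ρ) :
    ¬ G.IsolatedAt ρ p.length h k := by
  intro hi
  have hpos := hf.length_retr_auxWord_pos hhk
  have hpos' := hf.length_retr_auxWord_pos hkl
  have hred : IsReduced (G.retr (auxWord h k) ++ G.retr (auxWord k l)) := by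
    have e' : ρ = p ++ (G.retr (auxWord h k) ++ G.retr (auxWord k l)) ++ q := by rw [e]; simp
    rw [e'] at hr
    exact hr.left.right
  have hp1 := G.isPath_auxWord hhk.2
  have hp2 := G.isPath_auxWord hkl.2
  have hmk : FreeGroup.mk (auxWord h k ++ auxWord k l : Word T R H) =
      FreeGroup.mk (auxWord h l) := by
    have : FreeGroup.mk (auxWord h k ++ auxWord k l : Word T R H) =
        FreeGroup.mk [(Edge.half h, false)] *
          (FreeGroup.mk [(Edge.half k, true)] * FreeGroup.mk (invRev [(Edge.half k, true)])) *
          FreeGroup.mk [(Edge.half l, true)] := by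
      simp only [← mk_append]
      rfl
    rw [this, mk_invRev, mul_inv_cancel, mul_one, ← mk_append]
    rfl
  by_cases hl : h = l
  · subst hl
    have h1 : FreeGroup.mk (G.retr (auxWord h k) ++ G.retr (auxWord k h)) =
        FreeGroup.mk ([] : Word T R H) := by
      rw [retr_auxWord_symm hhk, mk_append, mk_invRev, mul_inv_cancel, mk_nil]
    have h2 := hred.eq_of_mk .nil h1
    simp only [List.append_eq_nil_iff] at h2
    rw [h2.1] at hpos
    simp at hpos
  · have hhl : G.IsAux h l := ⟨hl, hhk.2.trans hkl.2⟩
    have h1 : G.retr (auxWord h l) = G.retr (auxWord h k) ++ G.retr (auxWord k l) := by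
      refine ((hf.retr_aux h l hhl).2).eq_of_mk hred ?_
      rw [← retr_append hp1]
      exact hf.retr_homotopic _ _ _ _
        (.of_mk (G.isPath_auxWord hhl.2) (hp1.append hp2) hmk.symm)
    have h2 := (hi.2 p.length h l ⟨hhl, p, q, rfl, by rw [e, h1]; simp⟩
      (by rw [h1, List.length_append]; omega) (by omega)).2
    rw [h1, List.length_append] at h2
    omega

/-- Normalized paths have no backtracking in the relative part: at an auxiliary vertex it would merge
two auxiliary edges into one, and then their pre-INPs would not be isolated. -/
theorem xTight_of_normalized (hf : IsBetaTrainTrack m) {u v : V} {γ : Word T R H}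
    (h : G.Normalized u v γ) : XTight γ := by
  obtain ⟨-, hΓ, hr, bs, hρ, rfl, hiff⟩ := h
  have haux : ∀ b₁ k k' b₂, bs = b₁ ++ Sum.inr (k, k') :: b₂ →
      G.IsolatedAt (bs.flatMap G.blockRetr) (b₁.flatMap G.blockRetr).length k k' := by
    intro b₁ k k' b₂ hb
    rw [← hρ]
    exact (hiff _ k k').2 ⟨b₁, b₂, hb, rfl⟩
  have hlow : ∀ x, Sum.inl x ∈ bs → ∀ i, x.1 ≠ Edge.half i := by
    intro x hx i
    refine hΓ x ?_ i
    rw [hρ]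
    exact List.mem_flatMap.2 ⟨_, hx, by simp [blockRetr]⟩
  intro a x b e
  by_contra hx
  rw [show a ++ x :: rev x :: b = (a ++ [x]) ++ rev x :: b by simp] at e
  rcases flatMap_cut _ e with ⟨b₁, b₂, rfl, h1, h2⟩ | ⟨b₁, β, b₂, s, s', rfl, hs, hs', hβ, h1, h2⟩
  · obtain rfl | ⟨b₁, β, rfl⟩ := b₁.eq_nil_or_concat'
    · simp at h1
    cases b₂ with
    | nil => simp at h2
    | cons β' b₂ =>
      simp only [List.flatMap_append, List.flatMap_cons, List.flatMap_nil,
        List.append_nil] at h1 h2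
      rcases β with y | ⟨h, k⟩
      · obtain rfl : x = y := by
          simpa [blockPath] using congrArg List.getLast? h1
        rcases β' with y' | ⟨k', l⟩
        · obtain rfl : rev x = y' := by
            simpa [blockPath] using congrArg List.head? h2
          rw [hρ] at hr
          have e' : (b₁ ++ [Sum.inl x] ++ Sum.inl (rev x) :: b₂).flatMap G.blockRetr =
              b₁.flatMap G.blockRetr ++ x :: rev x :: b₂.flatMap G.blockRetr := by
            simp [blockRetr]
          rw [e'] at hr
          exact hr.ne_rev rfl
        · have h3 : rev x = (Edge.half k', false) := by
            simpa [blockPath, auxWord] using congrArg List.head? h2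
          exact hlow x (by simp) k' (congrArg Prod.fst h3)
      · have h3 : x = (Edge.half k, true) := by
          simpa [blockPath, auxWord] using congrArg List.getLast? h1
        subst h3
        rcases β' with y' | ⟨k', l⟩
        · obtain rfl : rev (Edge.half k, true) = y' := by
            simpa [blockPath] using congrArg List.head? h2
          exact hlow _ (List.mem_append_right _ (List.mem_cons_self ..)) k rfl
        · have h4 : k = k' := by
            simpa [blockPath, auxWord, rev] using congrArg List.head? h2
          subst h4
          have h5 := haux b₁ h k (Sum.inr (k, l) :: b₂) (by simp)
          have h6 := haux (b₁ ++ [Sum.inr (h, k)]) k l b₂ rfl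
          refine hf.not_isolatedAt_of_consecutive (p := b₁.flatMap G.blockRetr)
            (q := b₂.flatMap G.blockRetr) h5.1.1 h6.1.1 ?_ (hρ ▸ hr) h5
          simp [blockRetr]
  · rcases β with y | ⟨h, k⟩
    · have := congrArg List.length hβ
      have h3 := List.length_pos_iff.2 hs
      have h4 := List.length_pos_iff.2 hs'
      simp only [blockPath, List.length_singleton, List.length_append] at this
      omega
    · have h5 := haux b₁ h k b₂ rfl
      have h3 : s = [(Edge.half h, false)] ∧ s' = [(Edge.half k, true)] := by
        rcases s with _ | ⟨y, _ | ⟨y', s⟩⟩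
        · exact absurd rfl hs
        · simp only [blockPath, auxWord, List.singleton_append, List.cons.injEq] at hβ
          exact ⟨by rw [hβ.1], hβ.2.symm⟩
        · have := congrArg List.length hβ
          have h4 := List.length_pos_iff.2 hs'
          simp only [blockPath, auxWord, List.length_append, List.length_cons,
            List.length_nil] at this
          omega
      obtain ⟨rfl, rfl⟩ := h3
      have h6 : x = (Edge.half h, false) := by
        simpa using congrArg List.getLast? h1
      subst h6
      have h7 : h = k := by
        simpa [rev] using congrArg List.head? h2
      exact h5.1.1.1 h7

/-- Cutting a path into pieces of relative length at most `M`, all of which become strongly legal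
under `f^N`. -/
theorem _root_.BetaTrainTrack.SelfMap.exists_isChain_of_iter (f : SelfMap G) {N M : ℕ} (hM : 1 ≤ M)
    (hN : ∀ (u v : V) (γ : Word T R H), G.IsPath (Sum.inl u) γ (Sum.inl v) → XTight γ →
      relLength γ ≤ M → ∃ σ, f.StronglyLegal σ ∧
        G.Homotopic (Sum.inl (f.onV^[N] u)) (Sum.inl (f.onV^[N] v)) (f.iter N γ) σ)
    (ℓ : ℕ) : ∀ {u v : V} {γ : Word T R H}, relLength γ ≤ ℓ →
    G.IsPath (Sum.inl u) γ (Sum.inl v) → XTight γ →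
    ∃ K p, f.IsChain (K + 1) (f.onV^[N] u) (f.onV^[N] v) p ∧ K * M ≤ relLength γ ∧
      G.Homotopic (Sum.inl (f.onV^[N] u)) (Sum.inl (f.onV^[N] v)) (f.iter N γ) p := by
  induction ℓ with
  | zero =>
    intro u v γ hℓ hp hX
    obtain ⟨σ, h1, h2⟩ := hN u v γ hp hX (by omega)
    exact ⟨0, σ ++ [], .cons h1 h2.right (.nil _), by simp, by simpa using h2⟩
  | succ ℓ ih =>
    intro u v γ hℓ hp hX
    by_cases hlt : relLength γ ≤ M
    · obtain ⟨σ, h1, h2⟩ := hN u v γ hp hX hlt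
      exact ⟨0, σ ++ [], .cons h1 h2.right (.nil _), by simp, by simpa using h2⟩
    · obtain ⟨a, y, b, rfl, hy, ha⟩ := exists_cut_at_relLength (not_le.1 hlt)
      obtain ⟨w, w', h1, h2, h3⟩ := IsPath.exists_cut_after hp hy
      obtain ⟨σ, h4, h5⟩ := hN u w a h1 (hX.infix ⟨[], y :: b, by simp⟩) ha.le
      rw [relLength_append, ha] at hℓ
      obtain ⟨K, p, h6, h7, h8⟩ := ih (γ := y :: b) (by omega) (h2.append h3)
        (hX.infix ⟨a, [], by simp⟩)
      refine ⟨K + 1, σ ++ p, .cons h4 h5.right h6, ?_, ?_⟩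
      · rw [relLength_append, ha, add_mul]
        omega
      · rw [f.iter_append]
        exact h5.append h8

/-- A single exponent `N` for all paths of relative length at most `M`. -/
theorem exists_stronglyLegal_of_le (hf : IsBetaTrainTrack m) {N M : ℕ} {that : ℕ → ℕ}
    (hthat : ∀ (u v : V) (γ : Word T R H),
      G.IsPath (Sum.inl u) γ (Sum.inl v) → XTight γ →
      ∃ σ, f.StronglyLegal σ ∧
        G.Homotopic (Sum.inl (f.onV^[that (f.ilt γ)] u)) (Sum.inl (f.onV^[that (f.ilt γ)] v))
          (f.iter (that (f.ilt γ)) γ) σ)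
    (hN : ∀ j ≤ M, that j ≤ N) {u v : V} {γ : Word T R H}
    (hp : G.IsPath (Sum.inl u) γ (Sum.inl v)) (hX : XTight γ) (hM : relLength γ ≤ M) :
    ∃ σ, f.StronglyLegal σ ∧
      G.Homotopic (Sum.inl (f.onV^[N] u)) (Sum.inl (f.onV^[N] v)) (f.iter N γ) σ := by
  obtain ⟨σ, h1, h2⟩ := hthat u v γ hp hX
  obtain ⟨d, rfl⟩ := Nat.exists_eq_add_of_le' (hN (f.ilt γ) ((f.ilt_le_relLength γ).trans hM))
  refine ⟨_, hf.stronglyLegal_tighten_iter h1 d, ?_⟩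
  rw [f.iter_add, Function.iterate_add_apply, Function.iterate_add_apply]
  exact (f.homotopic_iter_inl d h2).trans (.tighten (f.isPath_iter_inl d h2.right))

/-- The dichotomy with natural numbers: if `γ` is the image under `f^N` of a normalized path which
is not much longer than `γ`, then `f^N` stretches `γ`. -/
theorem exists_exponent [Finite V] [Finite T] [Finite R] [Finite H] (hf : IsBetaTrainTrack m)
    {κ : ℕ} (hκ : 1 ≤ κ) : ∃ N, 1 ≤ N ∧ ∀ (u v : V) (γ : Word T R H), G.Normalized u v γ →
      ∀ (u' v' : V) (γ' : Word T R H), G.Normalized u' v' γ' → f.onV^[N] u' = u →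
      f.onV^[N] v' = v → G.Homotopic (Sum.inl u) (Sum.inl v) (f.iter N γ') γ →
      relLength γ' < κ * relLength γ →
      κ * relLength γ ≤ G.uncoveredLength (f.image N γ) := by
  obtain ⟨L, hL⟩ := hf.exists_isNielsenExponent
  obtain ⟨s, hs⟩ := hL (2 * L + 1)
  have hM : 2 * L < 2 * L + 1 := Nat.lt_succ_self _
  obtain ⟨t₀, ht₀⟩ := hf.exists_expansion ((κ + 1) * (8 * L + 5))
  obtain ⟨C, hC⟩ := hf.exists_mul_uncoveredLength_le_of_isChain hs hM (κ := κ + 1)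
    (ht₀ (t₀ + 1) (Nat.le_succ _))
  obtain ⟨that, hthat⟩ := hf.eventually_stronglyLegal
  -- pieces of this length make the number of pieces small in comparison with the length of `γ`
  set P : ℕ := 2 * κ * C + 1 with hP
  obtain ⟨B, hB⟩ := ((Set.finite_Iic P).image that).bddAbove
  refine ⟨(B + 1) * (t₀ + 1), Nat.mul_pos (Nat.succ_pos _) (Nat.succ_pos _), ?_⟩
  set N : ℕ := (B + 1) * (t₀ + 1) with hN
  have hBN : B ≤ N := by rw [hN]; nlinarith
  have htN : t₀ ≤ N := by rw [hN]; nlinarith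
  rintro u v γ hγ u' v' γ' hγ' rfl rfl hhom hlt
  obtain ⟨K, p, hp, hK, hpγ⟩ := f.exists_isChain_of_iter (N := N) (M := P) (by omega)
    (fun u v γ h1 h2 h3 => hf.exists_stronglyLegal_of_le hthat
      (fun j hj => (hB ⟨j, hj, rfl⟩).trans hBN) h1 h2 h3) _ le_rfl hγ'.1
    (hf.xTight_of_normalized hγ')
  have hγp : G.Homotopic (Sum.inl (f.onV^[N] u')) (Sum.inl (f.onV^[N] v')) γ p :=
    hhom.symm.trans hpγ
  have hretr : tighten (G.retr p) = G.retr γ := by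
    rw [← hγ.2.2.1.tighten_eq]
    exact tighten_congr (hf.retr_homotopic _ _ _ _ hγp).symm
  have himg : f.image N γ = f.image N p := hf.image_congr N hγp
  have hlen := hγ.2.2.2.relLength_eq
  rw [himg, hlen]
  -- the case of a single strongly legal path is not covered by the estimate for concatenations
  cases K with
  | zero =>
    cases hp with
    | @cons _ _ w _ σ q hσ hu hq =>
      cases hq
      rw [List.append_nil] at hretr ⊢
      have h1 := hf.mul_uncoveredLength_le_of_stronglyLegal hs hM (ht₀ N htN) hσ
      rw [← hretr, (hf.isReduced_retr hσ).tighten_eq]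
      exact le_trans (Nat.mul_le_mul_right _ (Nat.le_succ κ)) h1
  | succ K =>
    rw [← hretr] at hlen ⊢
    refine hf.mul_uncoveredLength_le_image_mul hκ hC hp ?_ B
    rw [← hlen]
    by_contra hcon
    have h1 : κ * relLength γ ≤ κ * ((K + 1 + 1) * C) := Nat.mul_le_mul_left _ (by omega)
    have h2 : κ * ((K + 1 + 1) * C) ≤ (K + 1) * P := by
      rw [hP]
      nlinarith [Nat.zero_le (κ * C * K)]
    omega

end IsBetaTrainTrack
end BetaTrainTrack

theorem corollary6 {V T R S H : Type*} [Finite V] [Finite T] [Finite R] [Finite S] [Finite H]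
    (G : BetaTrainTrack.Complex V T R S H) (f : BetaTrainTrack.SelfMap G)
    (n : ℕ) (α : FreeGroup (Fin n) ≃* FreeGroup (Fin n))
    (m : BetaTrainTrack.Marking G f n α) (hf : BetaTrainTrack.IsBetaTrainTrack m)
    (lam : ℝ) (hlam : 1 < lam) :
    ∃ N : ℕ, 1 ≤ N ∧ ∀ (u v : V) (γ : BetaTrainTrack.Word T R H), G.Normalized u v γ →
      (∃ δ : BetaTrainTrack.Word T R H,
        G.IsNormalization (f.onV^[N] u) (f.onV^[N] v) (f.iter N γ) δ ∧
        lam * (BetaTrainTrack.relLength γ : ℝ) ≤ (BetaTrainTrack.relLength δ : ℝ)) ∨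
      (∀ (u' v' : V) (γ' : BetaTrainTrack.Word T R H), G.Normalized u' v' γ' →
        f.onV^[N] u' = u → f.onV^[N] v' = v →
        G.IsNormalization u v (f.iter N γ') γ →
        lam * (BetaTrainTrack.relLength γ : ℝ) ≤ (BetaTrainTrack.relLength γ' : ℝ)) := by
  obtain ⟨κ, hκ⟩ := exists_nat_ge lam
  have hκ1 : 1 ≤ κ := by
    have : (1 : ℝ) < κ := hlam.trans_le hκ
    exact_mod_cast this.le
  obtain ⟨N, hN1, hN⟩ := hf.exists_exponent hκ1
  refine ⟨N, hN1, fun u v γ hγ => or_iff_not_imp_right.2 fun hcon => ?_⟩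
  push Not at hcon
  obtain ⟨u', v', γ', hγ', hu, hv, hnorm, hlt⟩ := hcon
  have hle : lam * (BetaTrainTrack.relLength γ : ℝ) ≤ κ * BetaTrainTrack.relLength γ :=
    mul_le_mul_of_nonneg_right hκ (Nat.cast_nonneg _)
  have h1 := hN u v γ hγ u' v' γ' hγ' hu hv hnorm.2 (by exact_mod_cast hlt.trans_le hle)
  obtain ⟨δ, hδ, hlen⟩ := hf.exists_isNormalization (f.isPath_iter_inl N hγ.1)
  refine ⟨δ, hδ, hle.trans ?_⟩
  rw [hlen]
  exact_mod_cast h1
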